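/- Let $\nu_0$ be a probability measure on $\mathbb R$ with a density $\nu_0'$ whose Fourier transform $\widehat{\nu_0}(u)=\int e^{-iuE}\nu_0'(E)\,dE$ is absolutely integrable over $\mathbb R$; then $\nu_0'$ may be, and is, taken continuous. Let $s>0$, $E\in\mathbb R$, and let $\rho(0)=(\rho_{\alpha,\delta}(0))_{\alpha,\delta=\pm}$ be a $2\times2$ matrix (in the application, a positive definite matrix of unit trace). Indices $\alpha,\delta=\pm$ are also read as the numbers $\pm1$. For $v>0$ let $(f_+,f_-)$ be the unique pair of functions analytic on $\mathbb C\setminus\mathbb R$ with $\Im f_\alpha(z)\cdot\Im z>0$ and $$f_\alpha(z)=\int_{-\infty}^{\infty}\frac{\nu_0(d\mu)}{\mu+\alpha s-z-v^2f_{-\alpha}(z)},\qquad \Im z\ne0,\ \alpha=\pm,$$ and set $f_\alpha(\mu,z)=(\mu+\alpha s-z-v^2f_{-\alpha}(z))^{-1}$, $f_{\beta,\gamma}(z_1,z_2)=\int\nu_0(d\mu)\,f_\beta(\mu,z_1)f_\gamma(\mu,z_2)$. For $\eta_1,\eta_2>0$ and $t>0$ define the limiting reduced density matrix by $$\rho_{\alpha,\delta}(E,t)=\frac1{(2\pi)^2}\int_{\Im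 z_2=-\eta_2}\!\!dz_2\int_{\Im z_1=\eta_1}\!\!dz_1\,e^{it(z_2-z_1)}\,\frac{f_\alpha(E,z_1)f_\delta(E,z_2)\rho_{\alpha,\delta}(0)+v^2f_{-\alpha}(E,z_1)f_{-\delta}(E,z_2)f_{\alpha,\delta}(z_1,z_2)\rho_{-\alpha,-\delta}(0)}{1-v^4f_{\alpha,\delta}(z_1,z_2)f_{-\alpha,-\delta}(z_1,z_2)},$$ where an integral along a horizontal line is the limit, as $N\to\infty$, of the integral over its part with $|\Re z|\le N$. These iterated integrals converge for all $v,t>0$. Let $f_0(z)=\int\nu_0'(\mu)(\mu-z)^{-1}d\mu$, $\Im z\neq 0$; its boundary values $f_0(x\pm i0)=\lim_{\varepsilon\downarrow0}f_0(x\pm i\varepsilon)$ exist for every $x\in\mathbb R$. Put $\Gamma_\alpha(E)=2\pi[\nu_0'(E)+\nu_0'(E+2\alpha s)]$. Then in the van Hove limit $v\to0^+$, $t=\tau/v^2\to\infty$, with $\tau>0$ fixed, the following holds for $\alpha=\pm$. (i) If $\Gamma_+(E)>0$ and $\Gamma_-(E)>0$, then $$\rho_{\alpha,\alpha}(E,t)\to2\pi\Big[\frac{\nu_0'(E)}{\Gamma_\alpha(E)}\rho_{\alpha,\alpha}(0)+\frac{\nu_0'(E-2\alpha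 s)}{\Gamma_{-\alpha}(E)}\rho_{-\alpha,-\alpha}(0)+e^{-\tau\Gamma_\alpha(E)}\frac{\nu_0'(E+2\alpha s)}{\Gamma_\alpha(E)}\rho_{\alpha,\alpha}(0)-e^{-\tau\Gamma_{-\alpha}(E)}\frac{\nu_0'(E-2\alpha s)}{\Gamma_{-\alpha}(E)}\rho_{-\alpha,-\alpha}(0)\Big].$$ (ii) The off-diagonal entries do not decay but oscillate: $$\rho_{\alpha,-\alpha}(E,t)-\rho_{\alpha,-\alpha}(0)\,e^{-2\alpha sit}\,e^{i\tau(f_0(E+2\alpha s+i0)-f_0(E-2\alpha s-i0))}\to0.$$ -/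

import Mathlib

open MeasureTheory Filter Topology

namespace SpinReservoir

noncomputable section

/-- The index set `{+, -}` of the two-level system is `ℤˣ = {1, -1}`; this is the numerical
value of the index. -/
def sgn (α : ℤˣ) : ℝ := ((α : ℤ) : ℝ)

/-- The pair `f = (f_+, f_-)` is analytic off the real axis, satisfies `Im f_α(z) · Im z > 0`
there, and solves `f_α(z) = ∫ ν₀(dE) / (E + s α - z - v² f_{-α}(z))`. -/
structure IsSelfConsistent (ν₀ : Measure ℝ) (s v : ℝ) (f : ℤˣ → ℂ → ℂ) : Prop where
  analytic : ∀ α, DifferentiableOn ℂ (f α) {z : ℂ | z.im ≠ 0}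
  im_pos : ∀ α (z : ℂ), z.im ≠ 0 → 0 < (f α z).im * z.im
  eqn : ∀ α (z : ℂ), z.im ≠ 0 →
    f α z = ∫ E : ℝ, ((E : ℂ) + s * sgn α - z - v ^ 2 * f (-α) z)⁻¹ ∂ν₀

/-- The functions `f_α(z)`: the solution of the self-consistent system. Only its values at
non-real `z`, where the solution is unique, are ever used. -/
def f (ν₀ : Measure ℝ) (s v : ℝ) : ℤˣ → ℂ → ℂ :=
  Classical.epsilon (IsSelfConsistent ν₀ s v)

/-- The functions `f_α(E, z) = (E + α s - z - v² f_{-α}(z))⁻¹`. -/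
def fE (ν₀ : Measure ℝ) (s v : ℝ) (α : ℤˣ) (E : ℝ) (z : ℂ) : ℂ :=
  ((E : ℂ) + sgn α * s - z - v ^ 2 * f ν₀ s v (-α) z)⁻¹

/-- The two-point functions `f_{β,γ}(z₁, z₂) = ∫ ν₀(dE) f_β(E, z₁) f_γ(E, z₂)`. -/
def f₂ (ν₀ : Measure ℝ) (s v : ℝ) (β γ : ℤˣ) (z₁ z₂ : ℂ) : ℂ :=
  ∫ E : ℝ, fE ν₀ s v β E z₁ * fE ν₀ s v γ E z₂ ∂ν₀

/-- The integral of `g` along the line `Im z = b` converges, as the limit of the integrals over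
the segments from `-N + i b` to `N + i b`. -/
def LineIntegrable (g : ℂ → ℂ) (b : ℝ) : Prop :=
  (∀ N : ℝ, IntervalIntegrable (fun x : ℝ => g (x + b * Complex.I)) volume (-N) N) ∧
    ∃ I : ℂ, Tendsto (fun N : ℝ => ∫ x in (-N)..N, g (x + b * Complex.I)) atTop (𝓝 I)

/-- The integral `lim_{N → ∞} ∫_{-N + i b}^{N + i b} g(z) dz` along the line `Im z = b`. -/
def lineIntegral (g : ℂ → ℂ) (b : ℝ) : ℂ :=
  limUnder atTop fun N : ℝ => ∫ x in (-N)..N, g (x + b * Complex.I)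

/-- The integrand of the double contour integral for the limiting reduced density matrix. -/
def integrand (ν₀ : Measure ℝ) (s v : ℝ) (ρ₀ : Matrix ℤˣ ℤˣ ℂ) (E t : ℝ) (α δ : ℤˣ)
    (z₁ z₂ : ℂ) : ℂ :=
  Complex.exp (Complex.I * t * (z₂ - z₁)) *
    ((fE ν₀ s v α E z₁ * fE ν₀ s v δ E z₂ * ρ₀ α δ +
        v ^ 2 * fE ν₀ s v (-α) E z₁ * fE ν₀ s v (-δ) E z₂ * f₂ ν₀ s v α δ z₁ z₂ *
          ρ₀ (-α) (-δ)) /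
      (1 - v ^ 4 * f₂ ν₀ s v α δ z₁ z₂ * f₂ ν₀ s v (-α) (-δ) z₁ z₂))

/-- The inner integral, over `z₁` on the line `Im z₁ = η₁`. -/
def innerIntegral (ν₀ : Measure ℝ) (s v : ℝ) (ρ₀ : Matrix ℤˣ ℤˣ ℂ) (E t : ℝ) (α δ : ℤˣ)
    (η₁ : ℝ) (z₂ : ℂ) : ℂ :=
  lineIntegral (fun z₁ => integrand ν₀ s v ρ₀ E t α δ z₁ z₂) η₁

/-- All integrals in the formula for the limiting reduced density matrix converge. -/
def FormulaConverges (ν₀ : Measure ℝ) (s v : ℝ) (ρ₀ : Matrix ℤˣ ℤˣ ℂ) (E t : ℝ) (α δ : ℤˣ)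
    (η₁ η₂ : ℝ) : Prop :=
  (∀ z₂ : ℂ, z₂.im = -η₂ →
      LineIntegrable (fun z₁ => integrand ν₀ s v ρ₀ E t α δ z₁ z₂) η₁) ∧
    LineIntegrable (innerIntegral ν₀ s v ρ₀ E t α δ η₁) (-η₂)

/-- The entry `ρ_{α,δ}(E, t)` of the limiting reduced density matrix, as the iterated integral
`(2π)⁻² ∫_{Im z₂ = -η₂} dz₂ ∫_{Im z₁ = η₁} dz₁`. -/
def reducedDensity (ν₀ : Measure ℝ) (s v : ℝ) (ρ₀ : Matrix ℤˣ ℤˣ ℂ) (η₁ η₂ : ℝ) (E t : ℝ)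
    (α δ : ℤˣ) : ℂ :=
  1 / (2 * Real.pi) ^ 2 * lineIntegral (innerIntegral ν₀ s v ρ₀ E t α δ η₁) (-η₂)

/-- The Fourier transform `∫ e^{-iuE} p(E) dE` of a density `p`. -/
def fourierHat (p : ℝ → ℝ) (u : ℝ) : ℂ :=
  ∫ E : ℝ, Complex.exp (-(Complex.I * u * E)) * p E

/-- The Stieltjes transform `f₀(z) = ∫ p(E) dE / (E - z)` of a density `p`. -/
def f₀ (p : ℝ → ℝ) (z : ℂ) : ℂ := ∫ E : ℝ, (p E : ℂ) / ((E : ℂ) - z)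

/-- The boundary value `f₀(x + i0)`. -/
def f₀Above (p : ℝ → ℝ) (x : ℝ) : ℂ :=
  limUnder (𝓝[>] (0 : ℝ)) fun ε : ℝ => f₀ p (x + ε * Complex.I)

/-- The boundary value `f₀(x - i0)`. -/
def f₀Below (p : ℝ → ℝ) (x : ℝ) : ℂ :=
  limUnder (𝓝[>] (0 : ℝ)) fun ε : ℝ => f₀ p (x - ε * Complex.I)

/-- The relaxation rates `Γ_α(E) = 2π [p(E) + p(E + 2 α s)]`. -/
def Γ (p : ℝ → ℝ) (s : ℝ) (α : ℤˣ) (E : ℝ) : ℝ :=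
  2 * Real.pi * (p E + p (E + 2 * sgn α * s))

/-- The diagonal entries of the reduced density matrix in the van Hove limit. -/
def diagonalVH (p : ℝ → ℝ) (s : ℝ) (ρ₀ : Matrix ℤˣ ℤˣ ℂ) (α : ℤˣ) (E τ : ℝ) : ℂ :=
  2 * Real.pi *
    ((p E / Γ p s α E : ℝ) * ρ₀ α α +
      (p (E - 2 * sgn α * s) / Γ p s (-α) E : ℝ) * ρ₀ (-α) (-α) +
      (Real.exp (-τ * Γ p s α E) * (p (E + 2 * sgn α * s) / Γ p s α E) : ℝ) * ρ₀ α α -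
      (Real.exp (-τ * Γ p s (-α) E) * (p (E - 2 * sgn α * s) / Γ p s (-α) E) : ℝ) *
        ρ₀ (-α) (-α))

/-- The off-diagonal entries of the reduced density matrix in the van Hove limit; they still
oscillate with the time `t`. -/
def offDiagonalVH (p : ℝ → ℝ) (s : ℝ) (ρ₀ : Matrix ℤˣ ℤˣ ℂ) (α : ℤˣ) (E t τ : ℝ) : ℂ :=
  ρ₀ α (-α) * Complex.exp (-(2 * sgn α * s * Complex.I * t)) *
    Complex.exp (Complex.I * τ *
      (f₀Above p (E + 2 * sgn α * s) - f₀Below p (E - 2 * sgn α * s)))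

end

end SpinReservoir

/-! Let `M = hatNorm p` be the L¹ norm of the Fourier transform of the density `p`. Writing (x -
z)⁻¹ as a half-line Fourier integral shows that the Stieltjes transform f₀ is bounded by M off the
real axis and extends continuously to each closed half-plane, with jump 2πi p(x)
(`f₀_eq_upperTransform`, `upperTransform_sub_conj`). A solution f_α of the self-consistent system is
f₀ taken at the shifted point z - αs + v² f_{-α}(z). It is therefore bounded by M uniformly in v,
and as v → 0 with z → x inside a half-plane it tends to the boundary value of f₀ at x - αs. A
solution exists because the Picard iteration contracts in a Schwarz-Pick sense; afterwards only the
defining properties of a solution are used.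

The resolvent identity makes f_{β,γ}(z₁, z₂) a difference quotient of f at the shifted points
(`f₂_eq`), so it is jointly analytic and decays in Re(z₁ - z₂). Cauchy-Schwarz together with Im
f₀(z) = Im z ∫ |x - z|⁻² bounds the loop term D = v⁴ f_{α,δ} f_{-α,-δ} by a number below 1 on |Im z|
≥ h (`norm_loopTerm_le`). Now write 1/(1 - D) = 1 + D/(1 - D). The term 1 contributes a product of
two one-variable waves, whose line integrals are taken as limits. Everything else carries a factor
f_{α,δ}, whose decay in Re(z₁ - z₂) makes the double integral absolutely convergent
(`StripBounded`). By Cauchy's theorem the lines may be moved to Im z = ±v². There one rescales z = c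
+ v²(x ± i) around the resonances c = E ± s; all bounds become independent of v, so dominated
convergence applies.

In the limit each wave has a simple pole displaced by a boundary value of f₀, and the product of
waves gives the phase and e^{iτ(f₀(E+2αs+i0) - f₀(E+2δs-i0))}. On the diagonal put Z = x - y + 2i
and let a, b be 2π times the density at the two energies involved. Then D → -ab/((Z+ia)(Z+ib)),
hence 1 - D → Z(Z+i(a+b))/((Z+ia)(Z+ib)): the zero Z = 0 is the stationary state and Z = -i(a+b) is
the relaxation at rate Γ (`one_sub_poleTerm_mul`). The term -e^{-τb} left over from the first
remainder cancels the product of waves. Off the diagonal the rescaled resonances lie at distance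
4s/v², so one two-point function is always far from resonance, both remainders vanish, and only the
oscillating product of waves survives. -/

namespace SpinReservoir

noncomputable section

section

/-! ### The Stieltjes transform of a finite measure -/

/-- The Stieltjes transform of `ν`. -/
def stieltjes (ν : Measure ℝ) (z : ℂ) : ℂ := ∫ x : ℝ, ((x : ℂ) - z)⁻¹ ∂ν

/-- The integral of `|x - z|⁻²` against `ν`. -/
def stieltjesSq (ν : Measure ℝ) (z : ℂ) : ℝ := ∫ x : ℝ, ‖((x : ℂ) - z)⁻¹‖ ^ 2 ∂ν

lemma ofReal_sub_ne_zero {z : ℂ} (hz : z.im ≠ 0) (x : ℝ) : (x : ℂ) - z ≠ 0 := by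
  intro h
  apply hz
  have := congrArg Complex.im h
  simpa using this

lemma norm_inv_ofReal_sub_le {z : ℂ} (hz : z.im ≠ 0) (x : ℝ) :
    ‖((x : ℂ) - z)⁻¹‖ ≤ |z.im|⁻¹ := by
  rw [norm_inv]
  apply inv_anti₀ (abs_pos.2 hz)
  have := Complex.abs_im_le_norm ((x : ℂ) - z)
  simpa using this

lemma continuous_inv_ofReal_sub {z : ℂ} (hz : z.im ≠ 0) :
    Continuous fun x : ℝ => ((x : ℂ) - z)⁻¹ :=
  (Complex.continuous_ofReal.sub continuous_const).inv₀ (ofReal_sub_ne_zero hz)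

variable {ν : Measure ℝ}

lemma integrable_inv_ofReal_sub [IsFiniteMeasure ν] {z : ℂ} (hz : z.im ≠ 0) :
    Integrable (fun x : ℝ => ((x : ℂ) - z)⁻¹) ν :=
  Integrable.of_bound (continuous_inv_ofReal_sub hz).aestronglyMeasurable _
    (ae_of_all _ (norm_inv_ofReal_sub_le hz))

lemma integrable_norm_inv_sq [IsFiniteMeasure ν] {z : ℂ} (hz : z.im ≠ 0) :
    Integrable (fun x : ℝ => ‖((x : ℂ) - z)⁻¹‖ ^ 2) ν := by
  refine Integrable.of_bound ((continuous_inv_ofReal_sub hz).norm.pow 2).aestronglyMeasurable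
    (|z.im|⁻¹ ^ 2) (ae_of_all _ fun x => ?_)
  rw [Real.norm_of_nonneg (by positivity)]
  gcongr
  exact norm_inv_ofReal_sub_le hz x

lemma norm_stieltjes_le [IsProbabilityMeasure ν] {z : ℂ} (hz : z.im ≠ 0) :
    ‖stieltjes ν z‖ ≤ |z.im|⁻¹ := by
  have := norm_integral_le_of_norm_le_const (μ := ν) (ae_of_all _ (norm_inv_ofReal_sub_le hz))
  simpa [stieltjes] using this

/-- The resolvent identity. It drives both the contraction estimate and the closed formula `f₂_eq`
for the two-point functions. -/
lemma stieltjes_sub [IsFiniteMeasure ν] {z w : ℂ} (hz : z.im ≠ 0) (hw : w.im ≠ 0) :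
    stieltjes ν z - stieltjes ν w =
      (z - w) * ∫ x : ℝ, ((x : ℂ) - z)⁻¹ * ((x : ℂ) - w)⁻¹ ∂ν := by
  unfold stieltjes
  rw [← integral_sub (integrable_inv_ofReal_sub hz) (integrable_inv_ofReal_sub hw),
    ← integral_const_mul]
  congr 1 with x
  have h1 := ofReal_sub_ne_zero hz x
  have h2 := ofReal_sub_ne_zero hw x
  field_simp
  ring

lemma im_stieltjes [IsFiniteMeasure ν] {z : ℂ} (hz : z.im ≠ 0) :
    (stieltjes ν z).im = z.im * stieltjesSq ν z := by
  have h : (stieltjes ν z).im = ∫ x : ℝ, (((x : ℂ) - z)⁻¹).im ∂ν := by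
    simpa [stieltjes] using
      (integral_im (𝕜 := ℂ) (integrable_inv_ofReal_sub (ν := ν) hz)).symm
  rw [h, stieltjesSq, ← integral_const_mul]
  congr 1 with x
  rw [Complex.inv_im, norm_inv, Complex.normSq_eq_norm_sq]
  simp [div_eq_mul_inv]

lemma stieltjesSq_nonneg (z : ℂ) : 0 ≤ stieltjesSq ν z :=
  integral_nonneg fun _ => by positivity

lemma stieltjesSq_pos [IsProbabilityMeasure ν] {z : ℂ} (hz : z.im ≠ 0) :
    0 < stieltjesSq ν z := by
  unfold stieltjesSq
  rw [integral_pos_iff_support_of_nonneg (fun _ => by positivity) (integrable_norm_inv_sq hz)]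
  have : Function.support (fun x : ℝ => ‖((x : ℂ) - z)⁻¹‖ ^ 2) = Set.univ := by
    ext x
    simp [ofReal_sub_ne_zero hz x]
  rw [this]
  simp

lemma stieltjesSq_eq [IsFiniteMeasure ν] {z : ℂ} (hz : z.im ≠ 0) :
    stieltjesSq ν z = |(stieltjes ν z).im| / |z.im| := by
  rw [im_stieltjes hz, abs_mul, abs_of_nonneg (stieltjesSq_nonneg z)]
  have : |z.im| ≠ 0 := abs_ne_zero.2 hz
  field_simp

lemma im_stieltjes_mul_pos [IsProbabilityMeasure ν] {z : ℂ} (hz : z.im ≠ 0) :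
    0 < (stieltjes ν z).im * z.im := by
  rw [im_stieltjes hz]
  have := stieltjesSq_pos (ν := ν) hz
  have : 0 < z.im * z.im := mul_self_pos.2 hz
  nlinarith [mul_pos this (stieltjesSq_pos (ν := ν) hz)]

lemma norm_integral_inv_mul_inv_sq_le [IsFiniteMeasure ν] {z w : ℂ} (hz : z.im ≠ 0)
    (hw : w.im ≠ 0) :
    ‖∫ x : ℝ, ((x : ℂ) - z)⁻¹ * ((x : ℂ) - w)⁻¹ ∂ν‖ ^ 2 ≤
      stieltjesSq ν z * stieltjesSq ν w := by
  have hb : ∀ {u : ℂ}, u.im ≠ 0 →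
      MemLp (fun x : ℝ => ‖((x : ℂ) - u)⁻¹‖) (ENNReal.ofReal 2) ν := fun {u} hu =>
    MemLp.of_bound (continuous_inv_ofReal_sub hu).norm.aestronglyMeasurable (|u.im|⁻¹)
      (ae_of_all _ fun x => by simpa using norm_inv_ofReal_sub_le hu x)
  have h1 := integral_mul_le_Lp_mul_Lq_of_nonneg (μ := ν) (p := 2) (q := 2)
    (by constructor <;> norm_num) (ae_of_all _ fun x => norm_nonneg _)
    (ae_of_all _ fun x => norm_nonneg _) (hb hz) (hb hw)
  have h2 : ‖∫ x : ℝ, ((x : ℂ) - z)⁻¹ * ((x : ℂ) - w)⁻¹ ∂ν‖ ≤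
      ∫ x : ℝ, ‖((x : ℂ) - z)⁻¹‖ * ‖((x : ℂ) - w)⁻¹‖ ∂ν := by
    refine (norm_integral_le_integral_norm _).trans (le_of_eq ?_)
    simp_rw [norm_mul]
  have h3 := h2.trans h1
  simp only [Real.rpow_two] at h3
  calc _ ≤ ((stieltjesSq ν z) ^ (1 / (2:ℝ)) * (stieltjesSq ν w) ^ (1 / (2:ℝ))) ^ 2 := by
        gcongr
        exact h3
    _ = _ := by
        rw [mul_pow, ← Real.sqrt_eq_rpow, ← Real.sqrt_eq_rpow,
          Real.sq_sqrt (stieltjesSq_nonneg z), Real.sq_sqrt (stieltjesSq_nonneg w)]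

/-- Since `stieltjesSq ν z` equals |Im m(z)| / |Im z| for the transform m, this is the Schwarz-Pick
inequality: m does not increase |z - w|² / (|Im z| |Im w|). This quantity is the one that contracts
along the Picard iteration. -/
lemma norm_stieltjes_sub_sq_le [IsFiniteMeasure ν] {z w : ℂ} (hz : z.im ≠ 0) (hw : w.im ≠ 0) :
    ‖stieltjes ν z - stieltjes ν w‖ ^ 2 ≤
      ‖z - w‖ ^ 2 * (stieltjesSq ν z * stieltjesSq ν w) := by
  rw [stieltjes_sub hz hw, norm_mul, mul_pow]
  gcongr
  exact norm_integral_inv_mul_inv_sq_le hz hw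

lemma isOpen_im_ne_zero : IsOpen {z : ℂ | z.im ≠ 0} :=
  isOpen_ne_fun Complex.continuous_im continuous_const

lemma hasDerivAt_stieltjes [IsFiniteMeasure ν] {z : ℂ} (hz : z.im ≠ 0) :
    HasDerivAt (stieltjes ν) (∫ x : ℝ, (((x : ℂ) - z) ^ 2)⁻¹ ∂ν) z := by
  have hr : 0 < |z.im| / 2 := by positivity
  have hball : ∀ w ∈ Metric.ball z (|z.im| / 2), |z.im| / 2 ≤ |w.im| := by
    intro w hw
    have h1 : ‖w - z‖ < |z.im| / 2 := by simpa [dist_eq_norm] using hw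
    have h2 : |w.im - z.im| ≤ ‖w - z‖ := by simpa using Complex.abs_im_le_norm (w - z)
    have h3 : |z.im| ≤ |w.im| + |w.im - z.im| := by
      rw [abs_sub_comm]
      calc |z.im| = |w.im + (z.im - w.im)| := by ring_nf
        _ ≤ _ := abs_add_le _ _
    linarith
  have hne : ∀ w ∈ Metric.ball z (|z.im| / 2), w.im ≠ 0 := fun w hw =>
    abs_pos.1 (hr.trans_le (hball w hw))
  refine (hasDerivAt_integral_of_dominated_loc_of_deriv_le (μ := ν)
    (F := fun w x => ((x : ℂ) - w)⁻¹) (F' := fun w x => (((x : ℂ) - w) ^ 2)⁻¹)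
    (bound := fun _ => ((|z.im| / 2) ^ 2)⁻¹) (Metric.ball_mem_nhds z hr) ?_
    (integrable_inv_ofReal_sub hz) ?_ ?_ (integrable_const _) ?_).2
  · filter_upwards [Metric.ball_mem_nhds z hr] with w hw
    exact (continuous_inv_ofReal_sub (hne w hw)).aestronglyMeasurable
  · refine Continuous.aestronglyMeasurable ?_
    simp_rw [← inv_pow]
    exact (continuous_inv_ofReal_sub hz).pow 2
  · refine ae_of_all _ fun x w hw => ?_
    rw [norm_inv, norm_pow]
    gcongr
    refine (hball w hw).trans ?_
    simpa using Complex.abs_im_le_norm ((x : ℂ) - w)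
  · refine ae_of_all _ fun x w hw => ?_
    have h := ((hasDerivAt_id w).const_sub (x : ℂ)).fun_inv (ofReal_sub_ne_zero (hne w hw) x)
    simpa using h

lemma differentiableAt_stieltjes [IsFiniteMeasure ν] {z : ℂ} (hz : z.im ≠ 0) :
    DifferentiableAt ℂ (stieltjes ν) z := (hasDerivAt_stieltjes hz).differentiableAt

/-! ### Existence of a solution of the self-consistent system -/

/-- The argument at which the Stieltjes transform has to be taken in the self-consistent system:
`z - α s + v² w`. -/
def shiftArg (s v : ℝ) (α : ℤˣ) (z w : ℂ) : ℂ := z - sgn α * s + v ^ 2 * w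

lemma shiftArg_im (s v : ℝ) (α : ℤˣ) (z w : ℂ) :
    (shiftArg s v α z w).im = z.im + v ^ 2 * w.im := by
  have : ((v : ℂ) ^ 2 * w).im = v ^ 2 * w.im := by
    rw [← Complex.ofReal_pow, Complex.im_ofReal_mul]
  simp [shiftArg, this]

lemma abs_add_of_mul_pos {a b c : ℝ} (hc : 0 ≤ c) (h : 0 ≤ b * a) :
    |a + c * b| = |a| + c * |b| := by
  have : 0 ≤ a * (c * b) := by nlinarith [mul_nonneg hc h]
  rw [(abs_add_eq_add_abs_iff a (c * b)).2, abs_mul, abs_of_nonneg hc]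
  rcases le_total 0 a with h1 | h1 <;> rcases le_total 0 (c * b) with h2 | h2
  · exact Or.inl ⟨h1, h2⟩
  · rcases h1.eq_or_lt with h3 | h3
    · exact Or.inr ⟨h3.ge, h2⟩
    · exact Or.inl ⟨h1, by nlinarith⟩
  · rcases h1.eq_or_lt with h3 | h3
    · exact Or.inl ⟨h3.ge, h2⟩
    · exact Or.inr ⟨h1, by nlinarith⟩
  · exact Or.inr ⟨h1, h2⟩

lemma abs_shiftArg_im (s v : ℝ) (α : ℤˣ) {z w : ℂ} (h : 0 ≤ w.im * z.im) :
    |(shiftArg s v α z w).im| = |z.im| + v ^ 2 * |w.im| := by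
  rw [shiftArg_im, abs_add_of_mul_pos (sq_nonneg v) h]

lemma shiftArg_im_ne_zero (s v : ℝ) (α : ℤˣ) {z w : ℂ} (hz : z.im ≠ 0)
    (h : 0 ≤ w.im * z.im) : (shiftArg s v α z w).im ≠ 0 := by
  rw [← abs_pos, abs_shiftArg_im s v α h]
  positivity

lemma shiftArg_im_mul_pos (s v : ℝ) (α : ℤˣ) {z w : ℂ} (hz : z.im ≠ 0)
    (h : 0 ≤ w.im * z.im) : 0 < (shiftArg s v α z w).im * z.im := by
  rw [shiftArg_im]
  have := mul_self_pos.2 hz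
  nlinarith [mul_nonneg (sq_nonneg v) h]

lemma im_stieltjes_shiftArg [IsProbabilityMeasure ν] (s v : ℝ) (α : ℤˣ) {z w : ℂ}
    (hz : z.im ≠ 0) (h : 0 ≤ w.im * z.im) :
    0 < (stieltjes ν (shiftArg s v α z w)).im * z.im := by
  have h1 := im_stieltjes_mul_pos (ν := ν) (shiftArg_im_ne_zero s v α hz h)
  have h2 := shiftArg_im_mul_pos s v α hz h
  have h3 := mul_pos h1 h2
  have h4 : 0 < (shiftArg s v α z w).im ^ 2 :=
    pow_pos (abs_pos.2 (shiftArg_im_ne_zero s v α hz h)) 2 |>.trans_eq (sq_abs _)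
  by_contra hcon
  push Not at hcon
  nlinarith [mul_nonneg h4.le (neg_nonneg.2 hcon)]

/-- Picard iterates of the self-consistent system. -/
def picard (ν : Measure ℝ) (s v : ℝ) : ℕ → ℤˣ → ℂ → ℂ
  | 0, _, z => stieltjes ν z
  | n + 1, α, z => stieltjes ν (shiftArg s v α z (picard ν s v n (-α) z))

section picard

variable [IsProbabilityMeasure ν] (s v : ℝ)

lemma picard_im (n : ℕ) (α : ℤˣ) {z : ℂ} (hz : z.im ≠ 0) :
    0 < (picard ν s v n α z).im * z.im := by
  induction n generalizing α with
  | zero => exact im_stieltjes_mul_pos hz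
  | succ n ih => exact im_stieltjes_shiftArg s v α hz (ih (-α)).le

lemma norm_picard_le (n : ℕ) (α : ℤˣ) {z : ℂ} (hz : z.im ≠ 0) :
    ‖picard ν s v n α z‖ ≤ |z.im|⁻¹ := by
  cases n with
  | zero => exact norm_stieltjes_le hz
  | succ n =>
    have h := (picard_im (ν := ν) s v n (-α) hz).le
    refine (norm_stieltjes_le (shiftArg_im_ne_zero s v α hz h)).trans ?_
    rw [abs_shiftArg_im s v α h]
    apply inv_anti₀ (abs_pos.2 hz)
    have : 0 ≤ v ^ 2 * |(picard ν s v n (-α) z).im| := by positivity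
    linarith

lemma differentiableOn_picard (n : ℕ) (α : ℤˣ) :
    DifferentiableOn ℂ (picard ν s v n α) {z : ℂ | z.im ≠ 0} := by
  induction n generalizing α with
  | zero => exact fun z hz => (differentiableAt_stieltjes hz).differentiableWithinAt
  | succ n ih =>
    intro z hz
    have h1 : DifferentiableWithinAt ℂ
        (fun z => shiftArg s v α z (picard ν s v n (-α) z)) {z : ℂ | z.im ≠ 0} z := by
      unfold shiftArg
      exact (differentiableWithinAt_id.sub_const _).add ((ih (-α) z hz).const_mul _)
    exact (differentiableAt_stieltjes (shiftArg_im_ne_zero s v α hz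
      (picard_im (ν := ν) s v n (-α) hz).le)).comp_differentiableWithinAt z h1

/-- Schwarz-Pick type estimate for one step of the self-consistent system. -/
lemma norm_stieltjes_shiftArg_sub_sq_le {z w w' : ℂ} (α : ℤˣ) {h C : ℝ} (hh : 0 < h)
    (hz : h ≤ |z.im|) (hw : 0 < w.im * z.im) (hw' : 0 < w'.im * z.im)
    (hwn : |w.im| ≤ h⁻¹) (hwn' : |w'.im| ≤ h⁻¹)
    (hC : ‖w - w'‖ ^ 2 ≤ C * (|w.im| * |w'.im|)) :
    ‖stieltjes ν (shiftArg s v α z w) - stieltjes ν (shiftArg s v α z w')‖ ^ 2 ≤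
      C * (v ^ 2 / (h ^ 2 + v ^ 2)) ^ 2 *
        (|(stieltjes ν (shiftArg s v α z w)).im| *
          |(stieltjes ν (shiftArg s v α z w')).im|) := by
  have hz0 : z.im ≠ 0 := abs_pos.1 (hh.trans_le hz)
  have key : ∀ {u : ℂ}, 0 < u.im * z.im → |u.im| ≤ h⁻¹ →
      v ^ 2 * |u.im| * stieltjesSq ν (shiftArg s v α z u) ≤
        v ^ 2 / (h ^ 2 + v ^ 2) * |(stieltjes ν (shiftArg s v α z u)).im| := by
    intro u hu hun
    rw [stieltjesSq_eq (shiftArg_im_ne_zero s v α hz0 hu.le), abs_shiftArg_im s v α hu.le,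
      ← mul_div_assoc, mul_div_right_comm]
    refine mul_le_mul_of_nonneg_right ?_ (abs_nonneg _)
    rw [div_le_div_iff₀ (by positivity) (by positivity)]
    -- The claimed ratio bound v²|Im u| / (|Im z| + v²|Im u|) ≤ v²/(h² + v²) amounts to h²|Im u| ≤
    -- |Im z|, which follows from |Im u| ≤ 1/h and h ≤ |Im z|.
    have h1 : h * |u.im| ≤ 1 := by
      calc _ ≤ h * h⁻¹ := by gcongr
        _ = 1 := mul_inv_cancel₀ hh.ne'
    have h2 : h ^ 2 * |u.im| ≤ |z.im| := by
      calc h ^ 2 * |u.im| = h * (h * |u.im|) := by ring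
        _ ≤ h * 1 := by gcongr
        _ ≤ _ := by linarith
    nlinarith [mul_le_mul_of_nonneg_left h2 (sq_nonneg v)]
  have h1 := norm_stieltjes_sub_sq_le (ν := ν) (shiftArg_im_ne_zero s v α hz0 hw.le)
    (shiftArg_im_ne_zero s v α hz0 hw'.le)
  have h2 : shiftArg s v α z w - shiftArg s v α z w' = (v : ℂ) ^ 2 * (w - w') := by
    unfold shiftArg; ring
  rw [h2, norm_mul, mul_pow] at h1
  have hCn : 0 ≤ C := by
    have : 0 < |w.im| * |w'.im| := mul_pos (abs_pos.2 (left_ne_zero_of_mul hw.ne'))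
      (abs_pos.2 (left_ne_zero_of_mul hw'.ne'))
    by_contra hcon
    push Not at hcon
    nlinarith [sq_nonneg ‖w - w'‖]
  calc _ ≤ _ := h1
    _ ≤ ‖(v : ℂ) ^ 2‖ ^ 2 * (C * (|w.im| * |w'.im|)) *
        (stieltjesSq ν (shiftArg s v α z w) * stieltjesSq ν (shiftArg s v α z w')) := by
      have := mul_nonneg (stieltjesSq_nonneg (ν := ν) (shiftArg s v α z w))
        (stieltjesSq_nonneg (ν := ν) (shiftArg s v α z w'))
      gcongr
    _ = C * ((v ^ 2 * |w.im| * stieltjesSq ν (shiftArg s v α z w)) *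
        (v ^ 2 * |w'.im| * stieltjesSq ν (shiftArg s v α z w'))) := by
      rw [norm_pow, Complex.norm_real, Real.norm_eq_abs, sq_abs]; ring
    _ ≤ C * ((v ^ 2 / (h ^ 2 + v ^ 2) * |(stieltjes ν (shiftArg s v α z w)).im|) *
        (v ^ 2 / (h ^ 2 + v ^ 2) * |(stieltjes ν (shiftArg s v α z w')).im|)) := by
      gcongr C * ?_
      exact mul_le_mul (key hw hwn) (key hw' hwn')
        (mul_nonneg (by positivity) (stieltjesSq_nonneg _)) (by positivity)
    _ = _ := by ring

/-- Each step multiplies the Schwarz-Pick quantity by at most (v²/(h²+v²))². The initial constant is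
the displacement |s| + v²/h of the first argument, divided by h because both imaginary parts are at
least h. -/
lemma norm_picard_succ_sub_sq_le {h : ℝ} (hh : 0 < h) (n : ℕ) (α : ℤˣ) {z : ℂ}
    (hz : h ≤ |z.im|) :
    ‖picard ν s v (n + 1) α z - picard ν s v n α z‖ ^ 2 ≤
      (((|s| + v ^ 2 / h) / h) ^ 2 * ((v ^ 2 / (h ^ 2 + v ^ 2)) ^ 2) ^ n) *
        (|(picard ν s v (n + 1) α z).im| * |(picard ν s v n α z).im|) := by
  have hz0 : z.im ≠ 0 := abs_pos.1 (hh.trans_le hz)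
  have him : ∀ n α, |(picard ν s v n α z).im| ≤ h⁻¹ := fun n α =>
    (Complex.abs_im_le_norm _).trans ((norm_picard_le s v n α hz0).trans (inv_anti₀ hh hz))
  induction n generalizing α with
  | zero =>
    have hp := (picard_im (ν := ν) s v 0 (-α) hz0)
    have h1 := norm_stieltjes_sub_sq_le (ν := ν) (shiftArg_im_ne_zero s v α hz0 hp.le) hz0
    rw [stieltjesSq_eq hz0, stieltjesSq_eq (shiftArg_im_ne_zero s v α hz0 hp.le)] at h1
    refine h1.trans ?_
    have h3 : ‖shiftArg s v α z (picard ν s v 0 (-α) z) - z‖ ≤ |s| + v ^ 2 / h := by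
      have : shiftArg s v α z (picard ν s v 0 (-α) z) - z =
          -(sgn α * s : ℂ) + (v : ℂ) ^ 2 * picard ν s v 0 (-α) z := by
        unfold shiftArg; ring
      rw [this]
      refine (norm_add_le _ _).trans ?_
      have hs : ‖-(sgn α * s : ℂ)‖ = |s| := by
        rcases Int.units_eq_one_or α with rfl | rfl <;> simp [sgn]
      rw [hs, norm_mul, norm_pow, Complex.norm_real, Real.norm_eq_abs, sq_abs, div_eq_mul_inv]
      gcongr
      exact (norm_picard_le s v 0 (-α) hz0).trans (inv_anti₀ hh hz)
    have h4 : h ≤ |(shiftArg s v α z (picard ν s v 0 (-α) z)).im| := by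
      rw [abs_shiftArg_im s v α hp.le]
      have : 0 ≤ v ^ 2 * |(picard ν s v 0 (-α) z).im| := by positivity
      linarith
    simp only [picard] at *
    rw [pow_zero, mul_one, div_pow, div_mul_div_comm, div_mul_eq_mul_div, ← mul_div_assoc]
    gcongr
    nlinarith
  | succ n ih =>
    have := norm_stieltjes_shiftArg_sub_sq_le (ν := ν) s v α hh hz
      (picard_im s v (n + 1) (-α) hz0) (picard_im s v n (-α) hz0) (him _ _) (him _ _)
      (ih (-α))
    refine this.trans (le_of_eq ?_)
    simp only [picard]
    ring

lemma dist_picard_succ_le {h : ℝ} (hh : 0 < h) (n : ℕ) (α : ℤˣ) {z : ℂ}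
    (hz : h ≤ |z.im|) :
    dist (picard ν s v n α z) (picard ν s v (n + 1) α z) ≤
      ((|s| + v ^ 2 / h) / h * h⁻¹) * (v ^ 2 / (h ^ 2 + v ^ 2)) ^ n := by
  have hz0 : z.im ≠ 0 := abs_pos.1 (hh.trans_le hz)
  have him : ∀ n α, |(picard ν s v n α z).im| ≤ h⁻¹ := fun n α =>
    (Complex.abs_im_le_norm _).trans ((norm_picard_le s v n α hz0).trans (inv_anti₀ hh hz))
  rw [dist_comm, dist_eq_norm]
  refine le_of_sq_le_sq ?_ (by positivity)
  refine (norm_picard_succ_sub_sq_le s v hh n α hz).trans ?_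
  calc _ ≤ (((|s| + v ^ 2 / h) / h) ^ 2 * ((v ^ 2 / (h ^ 2 + v ^ 2)) ^ 2) ^ n) *
        (h⁻¹ * h⁻¹) := by
        gcongr
        · exact him _ _
        · exact him _ _
    _ = _ := by ring

lemma ratio_lt_one {h : ℝ} (hh : 0 < h) : v ^ 2 / (h ^ 2 + v ^ 2) < 1 := by
  rw [div_lt_one (by positivity)]
  nlinarith

lemma exists_tendsto_picard (α : ℤˣ) {z : ℂ} (hz : z.im ≠ 0) :
    ∃ l, Tendsto (fun n => picard ν s v n α z) atTop (𝓝 l) :=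
  cauchySeq_tendsto_of_complete (cauchySeq_of_le_geometric _ _ (ratio_lt_one v (abs_pos.2 hz))
    fun n => dist_picard_succ_le s v (abs_pos.2 hz) n α le_rfl)

/-- The limit of the Picard iterates. -/
def picardLimit (ν : Measure ℝ) (s v : ℝ) (α : ℤˣ) (z : ℂ) : ℂ :=
  limUnder atTop fun n => picard ν s v n α z

lemma tendsto_picard (α : ℤˣ) {z : ℂ} (hz : z.im ≠ 0) :
    Tendsto (fun n => picard ν s v n α z) atTop (𝓝 (picardLimit ν s v α z)) :=
  tendsto_nhds_limUnder (exists_tendsto_picard s v α hz)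

lemma picardLimit_im_nonneg (α : ℤˣ) {z : ℂ} (hz : z.im ≠ 0) :
    0 ≤ (picardLimit ν s v α z).im * z.im := by
  have := ((Complex.continuous_im.tendsto _).comp
    (tendsto_picard (ν := ν) s v α hz)).mul_const z.im
  exact ge_of_tendsto' this fun n => (picard_im s v n α hz).le

lemma picardLimit_eqn (α : ℤˣ) {z : ℂ} (hz : z.im ≠ 0) :
    picardLimit ν s v α z = stieltjes ν (shiftArg s v α z (picardLimit ν s v (-α) z)) := by
  have h1 := (tendsto_picard (ν := ν) s v α hz).comp (tendsto_add_atTop_nat 1)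
  refine tendsto_nhds_unique h1 ?_
  have h2 : Tendsto (fun n => shiftArg s v α z (picard ν s v n (-α) z)) atTop
      (𝓝 (shiftArg s v α z (picardLimit ν s v (-α) z))) := by
    unfold shiftArg
    exact ((tendsto_picard s v (-α) hz).const_mul _).const_add _
  exact (differentiableAt_stieltjes (shiftArg_im_ne_zero s v α hz
    (picardLimit_im_nonneg s v (-α) hz))).continuousAt.tendsto.comp h2

lemma tendstoUniformlyOn_picard (α : ℤˣ) {h : ℝ} (hh : 0 < h) :
    TendstoUniformlyOn (fun n => picard ν s v n α) (picardLimit ν s v α) atTop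
      {z : ℂ | h ≤ |z.im|} := by
  rw [Metric.tendstoUniformlyOn_iff]
  intro ε hε
  have h1 : Tendsto (fun n : ℕ => ((|s| + v ^ 2 / h) / h * h⁻¹) *
      (v ^ 2 / (h ^ 2 + v ^ 2)) ^ n / (1 - v ^ 2 / (h ^ 2 + v ^ 2))) atTop (𝓝 0) := by
    have := tendsto_pow_atTop_nhds_zero_of_lt_one (by positivity) (ratio_lt_one v hh)
    simpa using (this.const_mul ((|s| + v ^ 2 / h) / h * h⁻¹)).div_const
      (1 - v ^ 2 / (h ^ 2 + v ^ 2))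
  filter_upwards [h1.eventually_lt_const hε] with n hn z hz
  have hz0 : z.im ≠ 0 := abs_pos.1 (hh.trans_le hz)
  rw [dist_comm]
  exact (dist_le_of_le_geometric_of_tendsto _ _ (ratio_lt_one v hh)
    (fun n => dist_picard_succ_le s v hh n α hz) (tendsto_picard s v α hz0) n).trans_lt hn

lemma isSelfConsistent_picardLimit : IsSelfConsistent ν s v (picardLimit ν s v) where
  analytic α := by
    refine TendstoLocallyUniformlyOn.differentiableOn (φ := atTop)
      (F := fun n => picard ν s v n α) ?_
      (Eventually.of_forall fun n => differentiableOn_picard s v n α) isOpen_im_ne_zero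
    refine tendstoLocallyUniformlyOn_of_forall_exists_nhds fun z hz => ?_
    refine ⟨{w : ℂ | |z.im| / 2 ≤ |w.im|}, mem_nhdsWithin_of_mem_nhds ?_,
      tendstoUniformlyOn_picard s v α (half_pos (abs_pos.2 hz))⟩
    have : ∀ᶠ w in 𝓝 z, |z.im| / 2 < |w.im| :=
      (Complex.continuous_im.abs.tendsto z).eventually_const_lt (half_lt_self (abs_pos.2 hz))
    exact this.mono fun w hw => hw.le
  im_pos α z hz := by
    -- Limits preserve only the weak inequality; strict positivity is recovered from the fixed-point
    -- equation, since a Stieltjes transform has strictly positive imaginary part in the upper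
    -- half-plane, and symmetrically below.
    rw [picardLimit_eqn s v α hz]
    exact im_stieltjes_shiftArg s v α hz (picardLimit_im_nonneg s v (-α) hz)
  eqn α z hz := by
    rw [picardLimit_eqn s v α hz]
    unfold stieltjes shiftArg
    congr 1 with x
    congr 1
    ring

/-- The self-consistent system has a solution, so that `f` is one. -/
theorem isSelfConsistent_f : IsSelfConsistent ν s v (f ν s v) :=
  Classical.epsilon_spec ⟨_, isSelfConsistent_picardLimit s v⟩

end picard

end

/-! ### Stieltjes transforms of densities with integrable Fourier transform -/

section density

open scoped FourierTransform ComplexConjugate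

variable {ν : Measure ℝ} {p : ℝ → ℝ}

lemma integrable_density [IsProbabilityMeasure ν] (hc : Continuous p) (hn : ∀ x, 0 ≤ p x)
    (hν : ν = volume.withDensity (fun x => ENNReal.ofReal (p x))) : Integrable p := by
  refine ⟨hc.aestronglyMeasurable, ?_⟩
  rw [hasFiniteIntegral_iff_ofReal (ae_of_all _ hn)]
  have h1 : ν Set.univ = 1 := measure_univ
  rw [hν, withDensity_apply _ MeasurableSet.univ, Measure.restrict_univ] at h1
  rw [h1]
  exact ENNReal.one_lt_top

lemma stieltjes_eq_f₀ (hc : Continuous p) (hn : ∀ x, 0 ≤ p x)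
    (hν : ν = volume.withDensity (fun x => ENNReal.ofReal (p x))) (z : ℂ) :
    stieltjes ν z = f₀ p z := by
  rw [stieltjes, hν, integral_withDensity_eq_integral_toReal_smul
    hc.measurable.ennreal_ofReal (ae_of_all _ fun _ => ENNReal.ofReal_lt_top), f₀]
  congr 1 with x
  rw [ENNReal.toReal_ofReal (hn x), Complex.real_smul, div_eq_mul_inv]

lemma fourierHat_eq (u : ℝ) :
    fourierHat p u = 𝓕 (fun x : ℝ => (p x : ℂ)) (u / (2 * Real.pi)) := by
  rw [fourierHat, Real.fourier_real_eq_integral_exp_smul]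
  congr 1 with x
  rw [smul_eq_mul]
  congr 2
  have : (Real.pi : ℂ) ≠ 0 := by exact_mod_cast Real.pi_ne_zero
  push_cast
  field_simp

lemma conj_fourierHat (u : ℝ) : conj (fourierHat p u) = fourierHat p (-u) := by
  unfold fourierHat
  rw [← integral_conj]
  congr 1 with x
  simp [← Complex.exp_conj]

/-- The half-line Fourier integral `i ∫_{u > 0} e^{iuz} p̂(u) du`. -/
def upperTransform (p : ℝ → ℝ) (z : ℂ) : ℂ :=
  Complex.I * ∫ u in Set.Ioi (0 : ℝ), Complex.exp (Complex.I * u * z) * fourierHat p u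

/-- The `L¹` norm of the Fourier transform of `p`. -/
def hatNorm (p : ℝ → ℝ) : ℝ := ∫ u : ℝ, ‖fourierHat p u‖

lemma norm_exp_I_mul (u : ℝ) (z : ℂ) :
    ‖Complex.exp (Complex.I * u * z)‖ = Real.exp (-(u * z.im)) := by
  rw [Complex.norm_exp]
  simp

lemma norm_exp_mul_le {u : ℝ} (hu : 0 ≤ u) {z : ℂ} (hz : 0 ≤ z.im) (c : ℂ) :
    ‖Complex.exp (Complex.I * u * z) * c‖ ≤ ‖c‖ := by
  rw [norm_mul, norm_exp_I_mul]
  refine mul_le_of_le_one_left (norm_nonneg _) (Real.exp_le_one_iff.2 ?_)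
  nlinarith [mul_nonneg hu hz]

lemma norm_upperTransform_le (hh : Integrable (fourierHat p)) {z : ℂ} (hz : 0 ≤ z.im) :
    ‖upperTransform p z‖ ≤ hatNorm p := by
  rw [upperTransform, norm_mul, Complex.norm_I, one_mul]
  calc _ ≤ ∫ u in Set.Ioi (0 : ℝ), ‖fourierHat p u‖ := by
        refine norm_integral_le_of_norm_le hh.norm.integrableOn ?_
        exact ae_restrict_of_forall_mem measurableSet_Ioi fun u hu =>
          norm_exp_mul_le (le_of_lt hu) hz _
    _ ≤ _ := setIntegral_le_integral hh.norm (ae_of_all _ fun _ => norm_nonneg _)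

lemma continuousOn_upperTransform (hh : Integrable (fourierHat p)) :
    ContinuousOn (upperTransform p) {z : ℂ | 0 ≤ z.im} := by
  refine continuousOn_const.mul ?_
  refine continuousOn_of_dominated (bound := fun u => ‖fourierHat p u‖) ?_ ?_
    hh.norm.integrableOn ?_
  · intro z _
    refine AEStronglyMeasurable.mul (Continuous.aestronglyMeasurable (by fun_prop))
      hh.aestronglyMeasurable.restrict
  · intro z hz
    exact ae_restrict_of_forall_mem measurableSet_Ioi fun u hu =>
      norm_exp_mul_le (le_of_lt hu) hz _
  · exact ae_of_all _ fun u => (by fun_prop : Continuous fun z : ℂ =>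
      Complex.exp (Complex.I * u * z) * fourierHat p u).continuousOn

/-- For Im z > 0, (x - z)⁻¹ = i ∫_{u>0} e^{iu(z-x)} du, and the damping e^{-u Im z} allows Fubini.
The right side stays meaningful, bounded and continuous down to the real axis because p̂ is
integrable. -/
lemma f₀_eq_upperTransform (hp : Integrable p) {z : ℂ} (hz : 0 < z.im) :
    f₀ p z = upperTransform p z := by
  have key : ∀ x : ℝ, (p x : ℂ) / ((x : ℂ) - z) =
      Complex.I * ∫ u in Set.Ioi (0 : ℝ), Complex.exp ((Complex.I * (z - x)) * u) * p x := by
    intro x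
    have hx := ofReal_sub_ne_zero hz.ne' x
    rw [integral_mul_const, integral_exp_mul_complex_Ioi (by simpa using hz)]
    have : z - x ≠ 0 := by rw [← neg_sub]; exact neg_ne_zero.2 hx
    simp only [Complex.ofReal_zero, mul_zero, Complex.exp_zero]
    field_simp
    ring_nf
  have hint : Integrable (Function.uncurry fun (x u : ℝ) =>
      Complex.exp ((Complex.I * (z - x)) * u) * p x)
      ((volume : Measure ℝ).prod (volume.restrict (Set.Ioi (0 : ℝ)))) := by
    have h1 : Integrable (fun u : ℝ => Real.exp (-z.im * u)) (volume.restrict (Set.Ioi 0)) :=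
      integrableOn_exp_mul_Ioi (by simpa using hz) 0
    refine (hp.mul_prod h1).mono ?_ (ae_of_all _ fun q => ?_)
    · refine AEStronglyMeasurable.mul (Continuous.aestronglyMeasurable (by fun_prop)) ?_
      exact (Complex.continuous_ofReal.comp_aestronglyMeasurable
        hp.aestronglyMeasurable).comp_fst
    · simp only [Function.uncurry]
      rw [norm_mul, norm_mul, Complex.norm_exp, Complex.norm_real, mul_comm]
      simp
  rw [f₀]
  simp_rw [key]
  rw [integral_const_mul, integral_integral_swap hint, upperTransform]
  congr 2 with u
  rw [fourierHat, ← integral_const_mul]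
  congr 1 with x
  rw [← mul_assoc, ← Complex.exp_add]
  congr 2
  ring

lemma conj_f₀ (z : ℂ) : conj (f₀ p z) = f₀ p (conj z) := by
  unfold f₀
  rw [← integral_conj]
  congr 1 with x
  simp

lemma f₀_eq_conj_upperTransform (hp : Integrable p) {z : ℂ} (hz : z.im < 0) :
    f₀ p z = conj (upperTransform p (conj z)) := by
  rw [← f₀_eq_upperTransform hp (by simpa using hz), conj_f₀, Complex.conj_conj]

lemma norm_f₀_le (hp : Integrable p) (hh : Integrable (fourierHat p)) {z : ℂ} (hz : z.im ≠ 0) :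
    ‖f₀ p z‖ ≤ hatNorm p := by
  rcases lt_or_gt_of_ne hz with h | h
  · rw [f₀_eq_conj_upperTransform hp h, RCLike.norm_conj]
    exact norm_upperTransform_le hh (by simpa using h.le)
  · rw [f₀_eq_upperTransform hp h]
    exact norm_upperTransform_le hh h.le

/-- Boundary values from above, along arbitrary approach. -/
lemma tendsto_f₀_upper (hp : Integrable p) (hh : Integrable (fourierHat p)) {ι : Type*}
    {l : Filter ι} {g : ι → ℂ} {x : ℝ} (hg : Tendsto g l (𝓝 x)) (him : ∀ᶠ i in l, 0 < (g i).im) :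
    Tendsto (fun i => f₀ p (g i)) l (𝓝 (upperTransform p x)) := by
  have h1 := continuousOn_upperTransform hh (x : ℂ) (by simp)
  have h2 : Tendsto g l (𝓝[{z : ℂ | 0 ≤ z.im}] x) :=
    tendsto_nhdsWithin_iff.2 ⟨hg, him.mono fun i hi => hi.le⟩
  refine (h1.tendsto.comp h2).congr' (him.mono fun i hi => ?_)
  simp only [Function.comp]
  rw [f₀_eq_upperTransform hp hi]

/-- Boundary values from below, along arbitrary approach. -/
lemma tendsto_f₀_lower (hp : Integrable p) (hh : Integrable (fourierHat p)) {ι : Type*}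
    {l : Filter ι} {g : ι → ℂ} {x : ℝ} (hg : Tendsto g l (𝓝 x)) (him : ∀ᶠ i in l, (g i).im < 0) :
    Tendsto (fun i => f₀ p (g i)) l (𝓝 (conj (upperTransform p x))) := by
  have h1 : Tendsto (fun i => conj (g i)) l (𝓝 x) := by
    simpa [Function.comp_def] using (Complex.continuous_conj.tendsto _).comp hg
  have h2 := (Complex.continuous_conj.tendsto _).comp
    (tendsto_f₀_upper hp hh h1 (him.mono fun i hi => by simpa using hi))
  refine h2.congr fun i => ?_
  simp [conj_f₀]

lemma tendsto_f₀_add (hp : Integrable p) (hh : Integrable (fourierHat p)) (x : ℝ) :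
    Tendsto (fun ε : ℝ => f₀ p (x + ε * Complex.I)) (𝓝[>] 0) (𝓝 (upperTransform p x)) := by
  refine tendsto_f₀_upper hp hh ?_ ?_
  · have : Continuous fun ε : ℝ => (x : ℂ) + ε * Complex.I := by fun_prop
    simpa using this.continuousAt.tendsto.mono_left (nhdsWithin_le_nhds (a := (0:ℝ)))
  · filter_upwards [self_mem_nhdsWithin] with ε hε
    simpa using hε

lemma tendsto_f₀_sub (hp : Integrable p) (hh : Integrable (fourierHat p)) (x : ℝ) :
    Tendsto (fun ε : ℝ => f₀ p (x - ε * Complex.I)) (𝓝[>] 0)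
      (𝓝 (conj (upperTransform p x))) := by
  refine tendsto_f₀_lower hp hh ?_ ?_
  · have : Continuous fun ε : ℝ => (x : ℂ) - ε * Complex.I := by fun_prop
    simpa using this.continuousAt.tendsto.mono_left (nhdsWithin_le_nhds (a := (0:ℝ)))
  · filter_upwards [self_mem_nhdsWithin] with ε hε
    simpa using hε

lemma f₀Above_eq (hp : Integrable p) (hh : Integrable (fourierHat p)) (x : ℝ) :
    f₀Above p x = upperTransform p x := (tendsto_f₀_add hp hh x).limUnder_eq

lemma f₀Below_eq (hp : Integrable p) (hh : Integrable (fourierHat p)) (x : ℝ) :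
    f₀Below p x = conj (upperTransform p x) := (tendsto_f₀_sub hp hh x).limUnder_eq

/-- Fourier inversion after rescaling the frequency by 2π; continuity of `p` makes it hold at every
point. -/
lemma integral_exp_mul_fourierHat (hc : Continuous p) (hp : Integrable p)
    (hh : Integrable (fourierHat p)) (x : ℝ) :
    ∫ u : ℝ, Complex.exp (Complex.I * u * x) * fourierHat p u = 2 * Real.pi * p x := by
  have hpi : (0 : ℝ) < 2 * Real.pi := by positivity
  have hF : Integrable (𝓕 (fun x : ℝ => (p x : ℂ))) := by
    have h1 : Integrable (fun u => 𝓕 (fun x : ℝ => (p x : ℂ)) (u / (2 * Real.pi))) :=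
      hh.congr (ae_of_all _ fun u => fourierHat_eq u)
    have := h1.comp_mul_right' hpi.ne'
    simpa [mul_div_cancel_right₀ _ hpi.ne'] using this
  have hinv := congrFun ((Complex.continuous_ofReal.comp hc).fourierInv_fourier_eq hp.ofReal hF) x
  rw [Real.fourierInv_eq'] at hinv
  have h2 := Measure.integral_comp_div (fun w : ℝ =>
    Complex.exp ((2 * Real.pi * inner ℝ w x : ℝ) * Complex.I) •
      𝓕 (fun x : ℝ => (p x : ℂ)) w) (2 * Real.pi)
  rw [abs_of_pos hpi] at h2
  have h3 : (Complex.ofReal ∘ p) = fun x : ℝ => (p x : ℂ) := rfl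
  rw [h3] at hinv
  rw [hinv] at h2
  rw [show (2 * Real.pi * p x : ℂ) = (2 * Real.pi : ℝ) • (p x : ℂ) by simp, ← h2]
  congr 1 with u
  rw [fourierHat_eq, smul_eq_mul]
  congr 2
  have : (Real.pi : ℂ) ≠ 0 := by exact_mod_cast Real.pi_ne_zero
  simp
  field_simp

/-- Plemelj's jump formula. -/
lemma upperTransform_sub_conj (hc : Continuous p) (hp : Integrable p)
    (hh : Integrable (fourierHat p)) (x : ℝ) :
    upperTransform p x - conj (upperTransform p x) = 2 * Real.pi * Complex.I * p x := by
  have hint : Integrable fun u : ℝ => Complex.exp (Complex.I * u * x) * fourierHat p u := by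
    refine hh.mono (AEStronglyMeasurable.mul (Continuous.aestronglyMeasurable (by fun_prop))
      hh.aestronglyMeasurable) (ae_of_all _ fun u => ?_)
    rw [norm_mul, norm_exp_I_mul]
    simp
  -- As `p` is real, conjugating p̂(u) gives p̂(-u). Reflecting u turns the conjugate into the
  -- integral over the negative half-line, so that the difference is the full inversion integral.
  have h1 : conj (upperTransform p x) =
      -(Complex.I * ∫ u in Set.Iic (0 : ℝ),
        Complex.exp (Complex.I * u * x) * fourierHat p u) := by
    have := integral_comp_neg_Ioi (0 : ℝ)
      (fun u : ℝ => Complex.exp (Complex.I * u * x) * fourierHat p u)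
    rw [neg_zero] at this
    rw [← this, upperTransform, map_mul, ← integral_conj, Complex.conj_I, neg_mul]
    congr 3 with u
    rw [map_mul, conj_fourierHat, ← Complex.exp_conj]
    simp
  have h2 := intervalIntegral.integral_Iic_add_Ioi (b := (0:ℝ)) hint.integrableOn hint.integrableOn
  rw [integral_exp_mul_fourierHat hc hp hh] at h2
  rw [h1, upperTransform, sub_neg_eq_add, ← mul_add, add_comm, h2]
  ring

lemma upperTransform_im_nonneg (hc : Continuous p) (hn : ∀ x, 0 ≤ p x) (hp : Integrable p)
    (hh : Integrable (fourierHat p)) (x : ℝ) : 0 ≤ (upperTransform p x).im := by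
  have h := congrArg Complex.im (upperTransform_sub_conj hc hp hh x)
  have h1 : (2 * Real.pi * Complex.I * p x : ℂ) = ((2 * Real.pi * p x : ℝ) : ℂ) * Complex.I := by
    push_cast; ring
  rw [h1] at h
  simp at h
  have := mul_nonneg Real.pi_pos.le (hn x)
  linarith

end density

/-! ### The solution of the self-consistent system and the two-point functions -/

lemma differentiableAt_comp_fst {g : ℂ → ℂ} {q : ℂ × ℂ} (hg : DifferentiableAt ℂ g q.1) :
    DifferentiableAt ℂ (fun q : ℂ × ℂ => g q.1) q :=
  DifferentiableAt.comp q hg differentiableAt_fst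

lemma differentiableAt_comp_snd {g : ℂ → ℂ} {q : ℂ × ℂ} (hg : DifferentiableAt ℂ g q.2) :
    DifferentiableAt ℂ (fun q : ℂ × ℂ => g q.2) q :=
  DifferentiableAt.comp q hg differentiableAt_snd

section twoPoint

variable (ν : Measure ℝ) (s v : ℝ)

/-- The point at which the Stieltjes transform of `ν` equals `f_α(z)`. -/
def selfArg (α : ℤˣ) (z : ℂ) : ℂ := shiftArg s v α z (f ν s v (-α) z)

/-- The product `v⁴ f_{α,δ} f_{-α,-δ}` in the denominator of the density matrix formula. -/
def loopTerm (α δ : ℤˣ) (z₁ z₂ : ℂ) : ℂ :=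
  v ^ 4 * f₂ ν s v α δ z₁ z₂ * f₂ ν s v (-α) (-δ) z₁ z₂

lemma fE_eq (α : ℤˣ) (E : ℝ) (z : ℂ) :
    fE ν s v α E z = ((E : ℂ) - selfArg ν s v α z)⁻¹ := by
  unfold fE selfArg shiftArg
  congr 1
  ring

lemma sgn_neg (α : ℤˣ) : sgn (-α) = -sgn α := by simp [sgn]

lemma abs_sgn (α : ℤˣ) : |sgn α| = 1 := by
  rcases Int.units_eq_one_or α with rfl | rfl <;> simp [sgn]

lemma selfArg_re (α : ℤˣ) (z : ℂ) :
    (selfArg ν s v α z).re = z.re - sgn α * s + v ^ 2 * (f ν s v (-α) z).re := by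
  have : ((v : ℂ) ^ 2 * f ν s v (-α) z).re = v ^ 2 * (f ν s v (-α) z).re := by
    rw [← Complex.ofReal_pow, Complex.re_ofReal_mul]
  simp [selfArg, shiftArg, this]

lemma f₂_eq_integral (β γ : ℤˣ) (z₁ z₂ : ℂ) :
    f₂ ν s v β γ z₁ z₂ = ∫ x : ℝ, ((x : ℂ) - selfArg ν s v β z₁)⁻¹ *
      ((x : ℂ) - selfArg ν s v γ z₂)⁻¹ ∂ν := by
  unfold f₂
  simp_rw [fE_eq]

variable [IsProbabilityMeasure ν]

lemma f_im_mul_pos (α : ℤˣ) {z : ℂ} (hz : z.im ≠ 0) : 0 < (f ν s v α z).im * z.im :=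
  (isSelfConsistent_f s v).im_pos α z hz

lemma selfArg_im_ne_zero (α : ℤˣ) {z : ℂ} (hz : z.im ≠ 0) : (selfArg ν s v α z).im ≠ 0 :=
  shiftArg_im_ne_zero s v α hz (f_im_mul_pos ν s v (-α) hz).le

lemma abs_selfArg_im (α : ℤˣ) {z : ℂ} (hz : z.im ≠ 0) :
    |(selfArg ν s v α z).im| = |z.im| + v ^ 2 * |(f ν s v (-α) z).im| :=
  abs_shiftArg_im s v α (f_im_mul_pos ν s v (-α) hz).le

lemma le_selfArg_im (α : ℤˣ) {z : ℂ} (hz : 0 < z.im) : z.im ≤ (selfArg ν s v α z).im := by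
  have h := f_im_mul_pos ν s v (-α) hz.ne'
  rw [selfArg, shiftArg_im]
  have := pos_of_mul_pos_left h hz.le
  nlinarith [mul_nonneg (sq_nonneg v) this.le]

lemma selfArg_im_le (α : ℤˣ) {z : ℂ} (hz : z.im < 0) : (selfArg ν s v α z).im ≤ z.im := by
  have h := f_im_mul_pos ν s v (-α) hz.ne
  rw [selfArg, shiftArg_im]
  have : (f ν s v (-α) z).im < 0 := by
    by_contra hcon
    push Not at hcon
    nlinarith
  nlinarith [mul_nonneg (sq_nonneg v) (neg_nonneg.2 this.le)]

lemma f_eq (α : ℤˣ) {z : ℂ} (hz : z.im ≠ 0) :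
    f ν s v α z = stieltjes ν (selfArg ν s v α z) := by
  rw [(isSelfConsistent_f s v).eqn α z hz]
  unfold stieltjes selfArg shiftArg
  congr 1 with x
  congr 1
  ring

lemma selfArg_sub_ne_zero (β γ : ℤˣ) {z₁ z₂ : ℂ} (h₁ : 0 < z₁.im) (h₂ : z₂.im < 0) :
    selfArg ν s v β z₁ - selfArg ν s v γ z₂ ≠ 0 := by
  intro h
  have h3 := congrArg Complex.im h
  rw [Complex.sub_im, Complex.zero_im] at h3
  linarith [le_selfArg_im ν s v β h₁, selfArg_im_le ν s v γ h₂]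

lemma f₂_eq (β γ : ℤˣ) {z₁ z₂ : ℂ} (h₁ : 0 < z₁.im) (h₂ : z₂.im < 0) :
    f₂ ν s v β γ z₁ z₂ =
      (f ν s v β z₁ - f ν s v γ z₂) / (selfArg ν s v β z₁ - selfArg ν s v γ z₂) := by
  rw [f₂_eq_integral, f_eq ν s v β h₁.ne', f_eq ν s v γ h₂.ne,
    stieltjes_sub (selfArg_im_ne_zero ν s v β h₁.ne') (selfArg_im_ne_zero ν s v γ h₂.ne),
    mul_div_cancel_left₀ _ (selfArg_sub_ne_zero ν s v β γ h₁ h₂)]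

variable {ν} {M : ℝ}

lemma norm_f_le (hM : ∀ z : ℂ, z.im ≠ 0 → ‖stieltjes ν z‖ ≤ M) (α : ℤˣ) {z : ℂ}
    (hz : z.im ≠ 0) : ‖f ν s v α z‖ ≤ M := by
  rw [f_eq ν s v α hz]
  exact hM _ (selfArg_im_ne_zero ν s v α hz)

/-- By `stieltjesSq_eq` the factor at α is |Im f_α| / (|Im z| + v²|Im f_{-α}|), which alone need not
be below v⁻². In the product over ±α the numerators can be exchanged, and each ratio then has the
form r/(|Im z| + r) with r = v²|Im f| ≤ v²M. -/
lemma stieltjesSq_mul_le (hM : ∀ z : ℂ, z.im ≠ 0 → ‖stieltjes ν z‖ ≤ M) (α : ℤˣ) {z : ℂ}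
    {h : ℝ} (hh : 0 < h) (hz : h ≤ |z.im|) :
    v ^ 4 * (stieltjesSq ν (selfArg ν s v α z) * stieltjesSq ν (selfArg ν s v (-α) z)) ≤
      (v ^ 2 * M / (h + v ^ 2 * M)) ^ 2 := by
  have hz0 : z.im ≠ 0 := abs_pos.1 (hh.trans_le hz)
  have hM0 : 0 ≤ M := (norm_nonneg _).trans (norm_f_le s v hM α hz0)
  have key : ∀ β, v ^ 2 * |(f ν s v β z).im| / (|z.im| + v ^ 2 * |(f ν s v β z).im|) ≤
      v ^ 2 * M / (h + v ^ 2 * M) := by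
    intro β
    have h1 : |(f ν s v β z).im| ≤ M :=
      (Complex.abs_im_le_norm _).trans (norm_f_le s v hM β hz0)
    rw [div_le_div_iff₀ (by positivity) (by positivity)]
    have : v ^ 2 * (|(f ν s v β z).im| * h) ≤ v ^ 2 * (M * |z.im|) := by gcongr
    nlinarith
  rw [stieltjesSq_eq (selfArg_im_ne_zero ν s v α hz0),
    stieltjesSq_eq (selfArg_im_ne_zero ν s v (-α) hz0), ← f_eq ν s v _ hz0, ← f_eq ν s v _ hz0,
    abs_selfArg_im ν s v _ hz0, abs_selfArg_im ν s v _ hz0, neg_neg]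
  calc _ = (v ^ 2 * |(f ν s v α z).im| / (|z.im| + v ^ 2 * |(f ν s v α z).im|)) *
      (v ^ 2 * |(f ν s v (-α) z).im| / (|z.im| + v ^ 2 * |(f ν s v (-α) z).im|)) := by
        rw [div_mul_div_comm, div_mul_div_comm, ← mul_div_assoc]
        ring
    _ ≤ _ := by
        rw [sq (v ^ 2 * M / (h + v ^ 2 * M))]
        exact mul_le_mul (key _) (key _) (by positivity) (by positivity)

/-- Cauchy-Schwarz on both two-point functions yields four factors `stieltjesSq`. Grouping them by
the point z₁ or z₂, instead of by the two-point function, brings α together with -α as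
`stieltjesSq_mul_le` requires. -/
lemma norm_loopTerm_le (hM : ∀ z : ℂ, z.im ≠ 0 → ‖stieltjes ν z‖ ≤ M) (α δ : ℤˣ)
    {z₁ z₂ : ℂ} {h : ℝ} (hh : 0 < h) (h₁ : h ≤ |z₁.im|) (h₂ : h ≤ |z₂.im|) :
    ‖loopTerm ν s v α δ z₁ z₂‖ ≤ (v ^ 2 * M / (h + v ^ 2 * M)) ^ 2 := by
  have hz₁ : z₁.im ≠ 0 := abs_pos.1 (hh.trans_le h₁)
  have hz₂ : z₂.im ≠ 0 := abs_pos.1 (hh.trans_le h₂)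
  refine le_of_sq_le_sq ?_ (sq_nonneg _)
  rw [loopTerm, norm_mul, norm_mul, mul_pow, mul_pow, f₂_eq_integral, f₂_eq_integral]
  have a1 := norm_integral_inv_mul_inv_sq_le (ν := ν) (selfArg_im_ne_zero ν s v α hz₁)
    (selfArg_im_ne_zero ν s v δ hz₂)
  have a2 := norm_integral_inv_mul_inv_sq_le (ν := ν) (selfArg_im_ne_zero ν s v (-α) hz₁)
    (selfArg_im_ne_zero ν s v (-δ) hz₂)
  have b1 := stieltjesSq_mul_le s v hM α hh h₁
  have b2 := stieltjesSq_mul_le s v hM δ hh h₂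
  have hv : ‖(v : ℂ) ^ 4‖ ^ 2 = v ^ 4 * v ^ 4 := by
    rw [norm_pow, Complex.norm_real, Real.norm_eq_abs, ← pow_mul, ← pow_add, Even.pow_abs]
    decide
  rw [hv]
  have c := fun z => stieltjesSq_nonneg (ν := ν) z
  calc _ ≤ v ^ 4 * v ^ 4 *
        (stieltjesSq ν (selfArg ν s v α z₁) * stieltjesSq ν (selfArg ν s v δ z₂)) *
        (stieltjesSq ν (selfArg ν s v (-α) z₁) * stieltjesSq ν (selfArg ν s v (-δ) z₂)) := by
        have := mul_nonneg (c (selfArg ν s v α z₁)) (c (selfArg ν s v δ z₂))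
        gcongr
    _ = (v ^ 4 * (stieltjesSq ν (selfArg ν s v α z₁) * stieltjesSq ν (selfArg ν s v (-α) z₁))) *
      (v ^ 4 * (stieltjesSq ν (selfArg ν s v δ z₂) * stieltjesSq ν (selfArg ν s v (-δ) z₂))) := by
        ring
    _ ≤ (v ^ 2 * M / (h + v ^ 2 * M)) ^ 2 * (v ^ 2 * M / (h + v ^ 2 * M)) ^ 2 := by
        refine mul_le_mul b1 b2 ?_ (sq_nonneg _)
        have := mul_nonneg (c (selfArg ν s v δ z₂)) (c (selfArg ν s v (-δ) z₂))
        positivity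
    _ = _ := by ring

lemma loopBound_lt_one (hM0 : 0 ≤ M) {h : ℝ} (hh : 0 < h) :
    (v ^ 2 * M / (h + v ^ 2 * M)) ^ 2 < 1 := by
  have : v ^ 2 * M / (h + v ^ 2 * M) < 1 := by
    rw [div_lt_one (by positivity)]
    linarith
  exact pow_lt_one₀ (by positivity) this two_ne_zero

lemma norm_inv_one_sub_le {D : ℂ} {q : ℝ} (hq : q < 1) (hD : ‖D‖ ≤ q) :
    ‖(1 - D)⁻¹‖ ≤ (1 - q)⁻¹ := by
  rw [norm_inv]
  apply inv_anti₀ (by linarith)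
  have := norm_sub_norm_le (1 : ℂ) D
  rw [norm_one] at this
  linarith

lemma one_sub_ne_zero_of_norm {D : ℂ} {q : ℝ} (hq : q < 1) (hD : ‖D‖ ≤ q) : 1 - D ≠ 0 := by
  intro h
  have : D = 1 := (sub_eq_zero.1 h).symm
  rw [this, norm_one] at hD
  linarith

lemma one_sub_loopTerm_ne_zero (hM : ∀ z : ℂ, z.im ≠ 0 → ‖stieltjes ν z‖ ≤ M) (α δ : ℤˣ)
    {z₁ z₂ : ℂ} (h₁ : z₁.im ≠ 0) (h₂ : z₂.im ≠ 0) : 1 - loopTerm ν s v α δ z₁ z₂ ≠ 0 := by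
  have hM0 : 0 ≤ M := (norm_nonneg _).trans (hM z₁ h₁)
  have hh : 0 < min |z₁.im| |z₂.im| := lt_min (abs_pos.2 h₁) (abs_pos.2 h₂)
  exact one_sub_ne_zero_of_norm (loopBound_lt_one v hM0 hh)
    (norm_loopTerm_le s v hM α δ hh (min_le_left _ _) (min_le_right _ _))

/-! ### Analyticity -/

/-- The product of the upper and the lower half-plane. -/
def upLow : Set (ℂ × ℂ) := {q | 0 < q.1.im ∧ q.2.im < 0}

lemma isOpen_upLow : IsOpen upLow :=
  (isOpen_lt continuous_const (Complex.continuous_im.comp continuous_fst)).inter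
    (isOpen_lt (Complex.continuous_im.comp continuous_snd) continuous_const)

lemma differentiableAt_f (α : ℤˣ) {z : ℂ} (hz : z.im ≠ 0) : DifferentiableAt ℂ (f ν s v α) z :=
  ((isSelfConsistent_f s v).analytic α z hz).differentiableAt (isOpen_im_ne_zero.mem_nhds hz)

lemma differentiableAt_selfArg (α : ℤˣ) {z : ℂ} (hz : z.im ≠ 0) :
    DifferentiableAt ℂ (selfArg ν s v α) z := by
  unfold selfArg shiftArg
  exact (differentiableAt_id.sub_const _).add ((differentiableAt_f s v (-α) hz).const_mul _)

lemma differentiableAt_fE (α : ℤˣ) (E : ℝ) {z : ℂ} (hz : z.im ≠ 0) :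
    DifferentiableAt ℂ (fE ν s v α E) z := by
  have h : fE ν s v α E = fun z => ((E : ℂ) - selfArg ν s v α z)⁻¹ := by
    ext z
    rw [fE_eq]
  rw [h]
  exact ((differentiableAt_selfArg s v α hz).const_sub _).fun_inv
    (ofReal_sub_ne_zero (selfArg_im_ne_zero ν s v α hz) E)

/-- Joint analyticity is read off the quotient formula `f₂_eq`; its denominator cannot vanish
because the shifted points lie in opposite half-planes. -/
lemma differentiableAt_f₂ (β γ : ℤˣ) {q : ℂ × ℂ} (hq : q ∈ upLow) :
    DifferentiableAt ℂ (fun q : ℂ × ℂ => f₂ ν s v β γ q.1 q.2) q := by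
  have h1 : (fun q : ℂ × ℂ => f₂ ν s v β γ q.1 q.2) =ᶠ[𝓝 q] fun q =>
      (f ν s v β q.1 - f ν s v γ q.2) / (selfArg ν s v β q.1 - selfArg ν s v γ q.2) := by
    filter_upwards [isOpen_upLow.mem_nhds hq] with r hr
    exact f₂_eq ν s v β γ hr.1 hr.2
  rw [h1.differentiableAt_iff]
  simp_rw [div_eq_mul_inv]
  exact ((differentiableAt_comp_fst (differentiableAt_f s v β hq.1.ne')).fun_sub
    (differentiableAt_comp_snd (differentiableAt_f s v γ hq.2.ne))).fun_mul
    (((differentiableAt_comp_fst (differentiableAt_selfArg s v β hq.1.ne')).fun_sub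
      (differentiableAt_comp_snd (differentiableAt_selfArg s v γ hq.2.ne))).fun_inv
    (selfArg_sub_ne_zero ν s v β γ hq.1 hq.2))

lemma differentiableAt_loopTerm (α δ : ℤˣ) {q : ℂ × ℂ} (hq : q ∈ upLow) :
    DifferentiableAt ℂ (fun q : ℂ × ℂ => loopTerm ν s v α δ q.1 q.2) q := by
  unfold loopTerm
  exact ((differentiableAt_f₂ s v α δ hq).const_mul _).mul
    (differentiableAt_f₂ s v (-α) (-δ) hq)

end twoPoint

/-! ### Splitting of the integrand -/

section split

variable (ν : Measure ℝ) (s v t E : ℝ)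

/-- `e^{-itz} f_α(E, z)`. -/
def waveUp (α : ℤˣ) (z : ℂ) : ℂ := Complex.exp (-(Complex.I * t * z)) * fE ν s v α E z

/-- `e^{itz} f_δ(E, z)`. -/
def waveDown (δ : ℤˣ) (z : ℂ) : ℂ := Complex.exp (Complex.I * t * z) * fE ν s v δ E z

/-- The part of the integrand multiplying `ρ_{α,δ}(0)` that is not a product. -/
def rem₁ (α δ : ℤˣ) (z₁ z₂ : ℂ) : ℂ :=
  Complex.exp (Complex.I * t * (z₂ - z₁)) * (fE ν s v α E z₁ * fE ν s v δ E z₂ *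
    (loopTerm ν s v α δ z₁ z₂ * (1 - loopTerm ν s v α δ z₁ z₂)⁻¹))

/-- The part of the integrand multiplying `ρ_{-α,-δ}(0)`. -/
def rem₂ (α δ : ℤˣ) (z₁ z₂ : ℂ) : ℂ :=
  Complex.exp (Complex.I * t * (z₂ - z₁)) * (fE ν s v (-α) E z₁ * fE ν s v (-δ) E z₂ *
    (v ^ 2 * f₂ ν s v α δ z₁ z₂ * (1 - loopTerm ν s v α δ z₁ z₂)⁻¹))

/-- The expansion 1/(1 - D) = 1 + D/(1 - D). The product term has no decay in Re(z₁ - z₂) and is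
treated one variable at a time; `rem₁` and `rem₂` both contain a factor f_{α,δ} and are absolutely
integrable along the lines. -/
lemma integrand_eq (ρ₀ : Matrix ℤˣ ℤˣ ℂ) (α δ : ℤˣ) {z₁ z₂ : ℂ}
    (hD : 1 - loopTerm ν s v α δ z₁ z₂ ≠ 0) :
    integrand ν s v ρ₀ E t α δ z₁ z₂ =
      ρ₀ α δ * waveUp ν s v t E α z₁ * waveDown ν s v t E δ z₂ +
        (ρ₀ α δ * rem₁ ν s v t E α δ z₁ z₂ + ρ₀ (-α) (-δ) * rem₂ ν s v t E α δ z₁ z₂) := by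
  have hexp : Complex.exp (Complex.I * t * (z₂ - z₁)) =
      Complex.exp (-(Complex.I * t * z₁)) * Complex.exp (Complex.I * t * z₂) := by
    rw [← Complex.exp_add]; ring_nf
  unfold integrand waveUp waveDown rem₁ rem₂
  rw [show (1 - (v : ℂ) ^ 4 * f₂ ν s v α δ z₁ z₂ * f₂ ν s v (-α) (-δ) z₁ z₂) =
    1 - loopTerm ν s v α δ z₁ z₂ from rfl, hexp]
  field_simp
  ring

variable [IsProbabilityMeasure ν] {M : ℝ}

lemma differentiableAt_waveUp (α : ℤˣ) {z : ℂ} (hz : z.im ≠ 0) :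
    DifferentiableAt ℂ (waveUp ν s v t E α) z :=
  DifferentiableAt.mul (by fun_prop) (differentiableAt_fE s v α E hz)

lemma differentiableAt_waveDown (α : ℤˣ) {z : ℂ} (hz : z.im ≠ 0) :
    DifferentiableAt ℂ (waveDown ν s v t E α) z :=
  DifferentiableAt.mul (by fun_prop) (differentiableAt_fE s v α E hz)

variable {ν}

lemma differentiableAt_fE_mul_fE (β γ : ℤˣ) {q : ℂ × ℂ} (hq : q ∈ upLow) :
    DifferentiableAt ℂ (fun q : ℂ × ℂ => fE ν s v β E q.1 * fE ν s v γ E q.2) q :=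
  (differentiableAt_comp_fst (differentiableAt_fE s v β E hq.1.ne')).fun_mul
    (differentiableAt_comp_snd (differentiableAt_fE s v γ E hq.2.ne))

lemma differentiableAt_rem₁ (hM : ∀ z : ℂ, z.im ≠ 0 → ‖stieltjes ν z‖ ≤ M) (α δ : ℤˣ)
    {q : ℂ × ℂ} (hq : q ∈ upLow) :
    DifferentiableAt ℂ (fun q : ℂ × ℂ => rem₁ ν s v t E α δ q.1 q.2) q := by
  have h := differentiableAt_loopTerm (ν := ν) s v α δ hq
  exact DifferentiableAt.mul (by fun_prop) ((differentiableAt_fE_mul_fE s v E α δ hq).mul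
    (h.mul ((h.const_sub 1).fun_inv (one_sub_loopTerm_ne_zero s v hM α δ hq.1.ne' hq.2.ne))))

lemma differentiableAt_rem₂ (hM : ∀ z : ℂ, z.im ≠ 0 → ‖stieltjes ν z‖ ≤ M) (α δ : ℤˣ)
    {q : ℂ × ℂ} (hq : q ∈ upLow) :
    DifferentiableAt ℂ (fun q : ℂ × ℂ => rem₂ ν s v t E α δ q.1 q.2) q := by
  have h := differentiableAt_loopTerm (ν := ν) s v α δ hq
  exact DifferentiableAt.mul (by fun_prop)
    ((differentiableAt_fE_mul_fE s v E (-α) (-δ) hq).mul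
      (((differentiableAt_f₂ s v α δ hq).const_mul _).mul
        ((h.const_sub 1).fun_inv (one_sub_loopTerm_ne_zero s v hM α δ hq.1.ne' hq.2.ne))))

end split

section

/-! ### Decay weights -/

/-- The weight `(1 + |x|)⁻¹`. -/
def decay (x : ℝ) : ℝ := (1 + |x|)⁻¹

/-- The integrable weight `(1 + |x|)^(-5/4)`. -/
def weight (x : ℝ) : ℝ := (1 + |x|) ^ (-(5 / 4) : ℝ)

lemma decay_pos (x : ℝ) : 0 < decay x := by unfold decay; positivity

lemma decay_le_one (x : ℝ) : decay x ≤ 1 := by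
  unfold decay
  exact inv_le_one_of_one_le₀ (by linarith [abs_nonneg x])

lemma decay_neg (x : ℝ) : decay (-x) = decay x := by simp [decay]

lemma integrable_weight : Integrable weight := by
  have := integrable_one_add_norm (E := ℝ) (μ := volume) (r := 5 / 4) (by norm_num)
  exact this

lemma decay_sq_le_weight (x : ℝ) : decay x * decay x ≤ weight x := by
  have h : decay x * decay x = (1 + |x|) ^ (-2 : ℝ) := by
    rw [Real.rpow_neg (by positivity), decay, Real.rpow_two, ← mul_inv, sq]
  rw [h, weight]
  exact Real.rpow_le_rpow_of_exponent_le (by linarith [abs_nonneg x]) (by norm_num)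

lemma tendsto_decay_atTop : Tendsto decay atTop (𝓝 0) := by
  unfold decay
  exact (tendsto_atTop_add_const_left _ _ tendsto_abs_atTop_atTop).inv_tendsto_atTop

lemma tendsto_decay_atBot : Tendsto decay atBot (𝓝 0) := by
  unfold decay
  exact (tendsto_atTop_add_const_left _ _ tendsto_abs_atBot_atTop).inv_tendsto_atTop

/-- If c is the largest of the three, c ≥ (ab)^{1/2}, so abc ≥ (ab)^{3/2}; and 5/6 · 3/2 = 5/4 is an
integrable exponent. -/
lemma rpow_neg_mul_le {a b c : ℝ} (ha : 1 ≤ a) (hb : 1 ≤ b) (hac : a ≤ c) (hbc : b ≤ c) :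
    (a * b * c) ^ (-(5 / 6) : ℝ) ≤ a ^ (-(5 / 4) : ℝ) * b ^ (-(5 / 4) : ℝ) := by
  have ha0 : 0 < a := by linarith
  have hb0 : 0 < b := by linarith
  have hc0 : 0 < c := by linarith
  have h1 : (a * b) ^ (1 / 2 : ℝ) ≤ c := by
    rw [← Real.sqrt_eq_rpow]
    exact Real.sqrt_le_iff.2 ⟨hc0.le, by nlinarith⟩
  have h2 : (a * b) ^ (3 / 2 : ℝ) ≤ a * b * c := by
    rw [show (3 / 2 : ℝ) = 1 + 1 / 2 by norm_num, Real.rpow_add (by positivity), Real.rpow_one]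
    gcongr
  calc _ ≤ ((a * b) ^ (3 / 2 : ℝ)) ^ (-(5 / 6) : ℝ) :=
        Real.rpow_le_rpow_of_nonpos (by positivity) h2 (by norm_num)
    _ = _ := by
        rw [← Real.rpow_mul (by positivity), ← Real.mul_rpow ha0.le hb0.le]
        norm_num

/-- The power -1 of abc is split as -1/6 - 5/6: the first part is spent on decay in l, and the
second still dominates by integrable weights in two of the three variables, the third being the
largest. -/
lemma inv_mul_inv_mul_inv_le {a b c l : ℝ} (ha : 1 ≤ a) (hb : 1 ≤ b) (hc : 1 ≤ c) (hl : 1 ≤ l)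
    (h : l ≤ a * b * c) :
    a⁻¹ * b⁻¹ * c⁻¹ ≤ l ^ (-(1 / 6) : ℝ) *
      (a ^ (-(5 / 4) : ℝ) * b ^ (-(5 / 4) : ℝ) + b ^ (-(5 / 4) : ℝ) * c ^ (-(5 / 4) : ℝ) +
        a ^ (-(5 / 4) : ℝ) * c ^ (-(5 / 4) : ℝ)) := by
  have ha0 : 0 < a := by linarith
  have hb0 : 0 < b := by linarith
  have hc0 : 0 < c := by linarith
  have h0 : 0 < a * b * c := by positivity
  have h1 : a⁻¹ * b⁻¹ * c⁻¹ =
      (a * b * c) ^ (-(1 / 6) : ℝ) * (a * b * c) ^ (-(5 / 6) : ℝ) := by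
    rw [← Real.rpow_add h0, ← mul_inv, ← mul_inv, ← Real.rpow_neg_one]
    norm_num
  have h2 : (a * b * c) ^ (-(1 / 6) : ℝ) ≤ l ^ (-(1 / 6) : ℝ) :=
    Real.rpow_le_rpow_of_nonpos (by linarith) h (by norm_num)
  have pa : 0 ≤ a ^ (-(5 / 4) : ℝ) := by positivity
  have pb : 0 ≤ b ^ (-(5 / 4) : ℝ) := by positivity
  have pc : 0 ≤ c ^ (-(5 / 4) : ℝ) := by positivity
  rw [h1]
  refine mul_le_mul h2 ?_ (by positivity) (by positivity)
  have qab := mul_nonneg pa pb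
  have qbc := mul_nonneg pb pc
  have qac := mul_nonneg pa pc
  by_cases hca : a ≤ c ∧ b ≤ c
  · linarith [rpow_neg_mul_le ha hb hca.1 hca.2]
  by_cases hcb : b ≤ a ∧ c ≤ a
  · have := rpow_neg_mul_le hb hc hcb.1 hcb.2
    rw [show b * c * a = a * b * c by ring] at this
    linarith
  · have : a ≤ b ∧ c ≤ b := by
      constructor <;> by_contra hcon <;> push Not at hcon hca hcb
      · rcases le_total a c with h | h
        · exact absurd (hca h) (by linarith)
        · exact absurd (hcb hcon.le) (by linarith)
      · rcases le_total a c with h | h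
        · exact absurd (hca h) (by linarith)
        · exact absurd (hcb (by linarith)) (by linarith)
    have := rpow_neg_mul_le ha hc this.1 this.2
    rw [show a * c * b = a * b * c by ring] at this
    linarith

/-- An integrable function on the plane dominating `decay x * decay y * decay (x - y - L)`. -/
def planeWeight (L x y : ℝ) : ℝ :=
  weight x * weight y + weight y * weight (x - y - L) + weight x * weight (x - y - L)

lemma decay_mul_le (L x y : ℝ) :
    decay x * decay y * decay (x - y - L) ≤ (1 + |L|) ^ (-(1 / 6) : ℝ) * planeWeight L x y := by
  refine inv_mul_inv_mul_inv_le (by linarith [abs_nonneg x]) (by linarith [abs_nonneg y])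
    (by linarith [abs_nonneg (x - y - L)]) (by linarith [abs_nonneg L]) ?_
  have h1 : |L| ≤ |x| + |y| + |x - y - L| := by
    have : L = x - y - (x - y - L) := by ring
    calc |L| = |x - y - (x - y - L)| := by rw [← this]
      _ ≤ |x - y| + |x - y - L| := abs_sub _ _
      _ ≤ _ := by linarith [abs_sub x y]
  have h2 := mul_nonneg (abs_nonneg x) (abs_nonneg y)
  have h3 := mul_nonneg (abs_nonneg x) (abs_nonneg (x - y - L))
  have h4 := mul_nonneg (abs_nonneg y) (abs_nonneg (x - y - L))
  have h5 := mul_nonneg h2 (abs_nonneg (x - y - L))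
  nlinarith

lemma decay_mul_le_zero (x y : ℝ) :
    decay x * decay y * decay (x - y) ≤ planeWeight 0 x y := by
  simpa using decay_mul_le 0 x y

lemma integrable_weight_snd_mul (L : ℝ) :
    Integrable (fun q : ℝ × ℝ => weight q.2 * weight (q.1 - q.2 - L))
      (volume.prod volume) :=
  integrable_weight.convolution_integrand (ContinuousLinearMap.mul ℝ ℝ)
    (integrable_weight.comp_sub_right L)

lemma integrable_weight_fst_mul (L : ℝ) :
    Integrable (fun q : ℝ × ℝ => weight q.1 * weight (q.1 - q.2 - L))
      (volume.prod volume) := by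
  have h := (integrable_weight.convolution_integrand (ContinuousLinearMap.mul ℝ ℝ)
    (integrable_weight.comp_add_right L)).swap
  refine h.congr (ae_of_all _ fun q => ?_)
  simp only [Function.comp, Prod.swap, ContinuousLinearMap.mul_apply']
  congr 1
  unfold weight
  rw [← abs_neg]
  congr 3
  ring

lemma integrable_planeWeight (L : ℝ) :
    Integrable (fun q : ℝ × ℝ => planeWeight L q.1 q.2) (volume.prod volume) :=
  ((integrable_weight.mul_prod integrable_weight).add (integrable_weight_snd_mul L)).add
    (integrable_weight_fst_mul L)

/-- Translation invariance removes L. Thus in `decay_mul_le` all dependence on L sits in the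
prefactor (1+|L|)^{-1/6}, and the integral vanishes as |L| → ∞. -/
lemma integral_planeWeight (L : ℝ) :
    ∫ q : ℝ × ℝ, planeWeight L q.1 q.2 ∂(volume.prod volume) = 3 * (∫ x, weight x) ^ 2 := by
  have i1 := integrable_weight.mul_prod integrable_weight
  have i2 := integrable_weight_snd_mul L
  have i3 := integrable_weight_fst_mul L
  have e2 : ∫ q : ℝ × ℝ, weight q.2 * weight (q.1 - q.2 - L) ∂(volume.prod volume) =
      (∫ x, weight x) ^ 2 := by
    rw [integral_prod_symm _ i2]
    simp_rw [integral_const_mul, sub_sub]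
    simp_rw [integral_sub_right_eq_self weight]
    rw [integral_mul_const, sq]
  have e3 : ∫ q : ℝ × ℝ, weight q.1 * weight (q.1 - q.2 - L) ∂(volume.prod volume) =
      (∫ x, weight x) ^ 2 := by
    rw [integral_prod _ i3]
    simp_rw [integral_const_mul]
    have : ∀ x : ℝ, ∫ y, weight (x - y - L) = ∫ y, weight y := fun x => by
      simp_rw [show ∀ y, x - y - L = (x - L) - y by intro y; ring]
      exact integral_sub_left_eq_self weight volume (x - L)
    simp_rw [this]
    rw [integral_mul_const, sq]
  have h1 := integral_add (i1.add i2) i3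
  have h2 := integral_add i1 i2
  simp only [Pi.add_apply] at h1
  unfold planeWeight
  rw [h1, h2, e2, e3, integral_prod_mul]
  ring

/-! ### Moving lines of integration -/

/-- Integrals along two horizontal lines differ by something that tends to zero. -/
lemma tendsto_sub_line {g : ℂ → ℂ} {b b' C : ℝ}
    (hd : ∀ z : ℂ, z.im ∈ Set.uIcc b b' → DifferentiableAt ℂ g z)
    (hb : ∀ z : ℂ, z.im ∈ Set.uIcc b b' → ‖g z‖ ≤ C * decay z.re) :
    Tendsto (fun N : ℝ => (∫ x in (-N)..N, g (x + b * Complex.I)) -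
      ∫ x in (-N)..N, g (x + b' * Complex.I)) atTop (𝓝 0) := by
  have hv : ∀ {u : ℝ → ℝ}, Tendsto (fun N => decay (u N)) atTop (𝓝 0) →
      Tendsto (fun N => Complex.I • ∫ y in b..b', g (u N + y * Complex.I)) atTop (𝓝 0) := by
    intro u hu
    have h1 : Tendsto (fun N => C * decay (u N) * |b' - b|) atTop (𝓝 0) := by
      simpa using (hu.const_mul C).mul_const |b' - b|
    refine squeeze_zero_norm (fun N => ?_) h1
    rw [norm_smul, Complex.norm_I, one_mul]
    refine intervalIntegral.norm_integral_le_of_norm_le_const fun y hy => ?_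
    have := hb (u N + y * Complex.I) (by simpa using Set.uIoc_subset_uIcc hy)
    simpa using this
  have h2 := (hv (u := fun N => -N) (tendsto_decay_atBot.comp tendsto_neg_atTop_atBot)).sub
    (hv (u := fun N => N) tendsto_decay_atTop)
  rw [sub_zero] at h2
  refine h2.congr fun N => ?_
  have h3 := Complex.integral_boundary_rect_eq_zero_of_differentiableOn g
    ((-N : ℝ) + b * Complex.I) (N + b' * Complex.I) (fun z hz => by
      refine (hd z ?_).differentiableWithinAt
      have := hz.2
      simpa using this)
  simp only [Complex.add_re, Complex.ofReal_re, Complex.mul_re, Complex.I_re, mul_zero,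
    Complex.ofReal_im, Complex.I_im, mul_one, sub_self, add_zero, Complex.add_im, Complex.mul_im,
    zero_add] at h3
  linear_combination -h3

lemma tendsto_integral_line {g : ℝ → ℂ} (hg : Integrable g) :
    Tendsto (fun N : ℝ => ∫ x in (-N)..N, g x) atTop (𝓝 (∫ x, g x)) :=
  intervalIntegral_tendsto_integral hg tendsto_neg_atTop_atBot tendsto_id

lemma integral_line_eq {g : ℂ → ℂ} {b b' C : ℝ}
    (hd : ∀ z : ℂ, z.im ∈ Set.uIcc b b' → DifferentiableAt ℂ g z)
    (hb : ∀ z : ℂ, z.im ∈ Set.uIcc b b' → ‖g z‖ ≤ C * decay z.re)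
    (hi : Integrable fun x : ℝ => g (x + b * Complex.I))
    (hi' : Integrable fun x : ℝ => g (x + b' * Complex.I)) :
    ∫ x : ℝ, g (x + b * Complex.I) = ∫ x : ℝ, g (x + b' * Complex.I) :=
  sub_eq_zero.1 (tendsto_nhds_unique
    ((tendsto_integral_line hi).sub (tendsto_integral_line hi')) (tendsto_sub_line hd hb))

lemma tendsto_line_of_tendsto {g : ℂ → ℂ} {b b' C : ℝ} {I : ℂ}
    (hd : ∀ z : ℂ, z.im ∈ Set.uIcc b b' → DifferentiableAt ℂ g z)
    (hb : ∀ z : ℂ, z.im ∈ Set.uIcc b b' → ‖g z‖ ≤ C * decay z.re)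
    (h : Tendsto (fun N : ℝ => ∫ x in (-N)..N, g (x + b * Complex.I)) atTop (𝓝 I)) :
    Tendsto (fun N : ℝ => ∫ x in (-N)..N, g (x + b' * Complex.I)) atTop (𝓝 I) := by
  simpa using h.sub (tendsto_sub_line hd hb)

/-! ### Iterated line integrals -/

/-- Functions on the product of the upper and the lower half-plane that are analytic and, on
products of closed strips, dominated by the weight `decay x₁ * decay x₂ * decay (x₁ - x₂)`. -/
structure StripBounded (R : ℂ → ℂ → ℂ) : Prop where
  differentiableAt : ∀ q ∈ upLow, DifferentiableAt ℂ (fun q : ℂ × ℂ => R q.1 q.2) q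
  bound : ∀ h H : ℝ, 0 < h → ∃ C, ∀ z₁ z₂ : ℂ, h ≤ z₁.im → z₁.im ≤ H → h ≤ -z₂.im → -z₂.im ≤ H →
    ‖R z₁ z₂‖ ≤ C * (decay z₁.re * decay z₂.re * decay (z₁.re - z₂.re))

namespace StripBounded

variable {R : ℂ → ℂ → ℂ} (hR : StripBounded R)
include hR

lemma bound_pair (a a' b b' : ℝ) (ha : 0 < a) (ha' : 0 < a') (hb : b < 0) (hb' : b' < 0) :
    ∃ C, 0 ≤ C ∧ ∀ z₁ z₂ : ℂ, z₁.im ∈ Set.uIcc a a' → z₂.im ∈ Set.uIcc b b' →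
      ‖R z₁ z₂‖ ≤ C * (decay z₁.re * decay z₂.re * decay (z₁.re - z₂.re)) := by
  obtain ⟨C, hC⟩ := hR.bound (min (min a a') (min (-b) (-b'))) (max (max a a') (max (-b) (-b')))
    (by simp [ha, ha', hb, hb'])
  refine ⟨|C|, abs_nonneg _, fun z₁ z₂ h₁ h₂ => (hC z₁ z₂ ?_ ?_ ?_ ?_).trans ?_⟩
  · exact (min_le_left _ _).trans h₁.1
  · exact h₁.2.trans (le_max_left _ _)
  · refine (min_le_right _ _).trans ?_
    rw [min_neg_neg, neg_le_neg_iff]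
    exact h₂.2
  · refine le_trans ?_ (le_max_right _ _)
    rw [max_neg_neg, neg_le_neg_iff]
    exact h₂.1
  · have := decay_pos z₁.re
    have := decay_pos z₂.re
    have := decay_pos (z₁.re - z₂.re)
    gcongr
    exact le_abs_self C

lemma differentiableAt_fst {z₁ z₂ : ℂ} (h₁ : 0 < z₁.im) (h₂ : z₂.im < 0) :
    DifferentiableAt ℂ (fun z => R z z₂) z₁ :=
  DifferentiableAt.comp (g := fun q : ℂ × ℂ => R q.1 q.2) (f := fun z => (z, z₂)) z₁
    (hR.differentiableAt (z₁, z₂) ⟨h₁, h₂⟩)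
    (differentiableAt_id.prodMk (differentiableAt_const _))

lemma differentiableAt_snd {z₁ z₂ : ℂ} (h₁ : 0 < z₁.im) (h₂ : z₂.im < 0) :
    DifferentiableAt ℂ (fun z => R z₁ z) z₂ :=
  DifferentiableAt.comp (g := fun q : ℂ × ℂ => R q.1 q.2) (f := fun z => (z₁, z)) z₂
    (hR.differentiableAt (z₁, z₂) ⟨h₁, h₂⟩)
    ((differentiableAt_const _).prodMk differentiableAt_id)

/-- The map (z₁, z₂) ↦ (-z₂, -z₁) preserves the product of half-planes and the weight, so facts
about the first variable transfer to the second. -/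
lemma swap : StripBounded fun z₁ z₂ => R (-z₂) (-z₁) where
  differentiableAt q hq :=
    DifferentiableAt.comp (g := fun q : ℂ × ℂ => R q.1 q.2) (f := fun q : ℂ × ℂ => (-q.2, -q.1)) q
      (hR.differentiableAt (-q.2, -q.1) ⟨by simpa using hq.2, by simpa using hq.1⟩)
      (by fun_prop)
  bound h H hh := by
    obtain ⟨C, hC⟩ := hR.bound h H hh
    refine ⟨C, fun z₁ z₂ h1 h2 h3 h4 => (hC (-z₂) (-z₁) (by simpa using h3) (by simpa using h4)
      (by simpa using h1) (by simpa using h2)).trans (le_of_eq ?_)⟩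
    simp only [Complex.neg_re, decay_neg]
    rw [neg_sub_neg]
    ring

variable {a b : ℝ} (ha : 0 < a) (hb : b < 0)
include ha hb

lemma continuous_lines :
    Continuous fun q : ℝ × ℝ => R (q.1 + a * Complex.I) (q.2 + b * Complex.I) := by
  rw [continuous_iff_continuousAt]
  intro q
  have h1 := (hR.differentiableAt (q.1 + a * Complex.I, q.2 + b * Complex.I)
    ⟨by simpa using ha, by simpa using hb⟩).continuousAt
  have h2 : ContinuousAt (fun q : ℝ × ℝ =>
      ((q.1 + a * Complex.I : ℂ), (q.2 + b * Complex.I : ℂ))) q :=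
    (by fun_prop : Continuous _).continuousAt
  exact ContinuousAt.comp (f := fun q : ℝ × ℝ =>
      ((q.1 + a * Complex.I : ℂ), (q.2 + b * Complex.I : ℂ))) (g := fun q : ℂ × ℂ => R q.1 q.2)
    h1 h2

lemma integrable_lines :
    Integrable (fun q : ℝ × ℝ => R (q.1 + a * Complex.I) (q.2 + b * Complex.I))
      (volume.prod volume) := by
  obtain ⟨C, hC0, hC⟩ := hR.bound_pair a a b b ha ha hb hb
  refine ((integrable_planeWeight 0).const_mul C).mono'
    (hR.continuous_lines ha hb).aestronglyMeasurable (ae_of_all _ fun q => ?_)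
  have := hC (q.1 + a * Complex.I) (q.2 + b * Complex.I) (by simp) (by simp)
  refine this.trans ?_
  gcongr
  simpa using decay_mul_le_zero q.1 q.2

lemma integrable_fst {y : ℝ} :
    Integrable (fun x : ℝ => R (x + a * Complex.I) (y + b * Complex.I)) := by
  obtain ⟨C, hC0, hC⟩ := hR.bound_pair a a b b ha ha hb hb
  refine (integrable_weight.const_mul (C * (1 + |y|))).mono'
    ((hR.continuous_lines ha hb).comp (by fun_prop : Continuous fun x : ℝ =>
      (x, y))).aestronglyMeasurable (ae_of_all _ fun x => ?_)
  have h1 := hC (x + a * Complex.I) (y + b * Complex.I) (by simp) (by simp)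
  simp only [Complex.add_re, Complex.ofReal_re, Complex.mul_re, Complex.I_re, mul_zero,
    Complex.ofReal_im, Complex.I_im, mul_one, sub_self, add_zero] at h1
  refine h1.trans ?_
  rw [mul_assoc C (1 + |y|)]
  refine mul_le_mul_of_nonneg_left ?_ hC0
  -- The loss 1 + |y| is harmless since y is fixed; the product of two weights in x is then
  -- integrable.
  have h2 : decay (x - y) ≤ (1 + |y|) * decay x := by
    unfold decay
    rw [← div_eq_mul_inv, inv_eq_one_div, div_le_div_iff₀ (by positivity) (by positivity)]
    have : |x| ≤ |y| + |x - y| := by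
      calc |x| = |y + (x - y)| := by ring_nf
        _ ≤ _ := abs_add_le _ _
    nlinarith [mul_nonneg (abs_nonneg y) (abs_nonneg (x - y))]
  have hx := decay_pos x
  have hy := decay_pos y
  calc _ ≤ decay x * 1 * ((1 + |y|) * decay x) := by
        gcongr
        · exact (decay_pos _).le
        · exact decay_le_one y
    _ = (1 + |y|) * (decay x * decay x) := by ring
    _ ≤ _ := by
        gcongr
        exact decay_sq_le_weight x

omit hb in
lemma integral_fst_eq {a' : ℝ} (ha' : 0 < a') {z : ℂ} (hz : z.im < 0) :
    ∫ x : ℝ, R (x + a * Complex.I) z = ∫ x : ℝ, R (x + a' * Complex.I) z := by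
  obtain ⟨C, hC0, hC⟩ := hR.bound_pair a a' z.im z.im ha ha' hz hz
  have hz' : z = z.re + z.im * Complex.I := (Complex.re_add_im z).symm
  refine integral_line_eq (g := fun w => R w z) (C := C) (fun w hw => ?_) (fun w hw => ?_) ?_ ?_
  · refine hR.differentiableAt_fst ?_ hz
    exact lt_of_lt_of_le (lt_min ha ha') hw.1
  · refine (hC w z hw (by simp)).trans ?_
    have := decay_pos w.re
    gcongr
    calc _ ≤ decay w.re * 1 * 1 := by
          gcongr
          · exact (decay_pos _).le
          · exact decay_le_one _
          · exact decay_le_one _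
      _ = _ := by ring
  · rw [hz']
    exact hR.integrable_fst ha hz
  · rw [hz']
    exact hR.integrable_fst ha' hz

lemma integral_snd_eq {b' : ℝ} (hb' : b' < 0) (x : ℝ) :
    ∫ y : ℝ, R (x + a * Complex.I) (y + b * Complex.I) =
      ∫ y : ℝ, R (x + a * Complex.I) (y + b' * Complex.I) := by
  have h := hR.swap.integral_fst_eq (a := -b) (a' := -b') (by linarith) (by linarith)
    (z := -(x + a * Complex.I)) (by simpa using ha)
  have e : ∀ b : ℝ, ∫ y : ℝ, R (x + a * Complex.I) (y + b * Complex.I) =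
      ∫ y : ℝ, R (- -(x + a * Complex.I)) (-(y + ((-b : ℝ) : ℂ) * Complex.I)) := by
    intro b
    rw [← integral_neg_eq_self]
    congr 1 with y
    rw [neg_neg]
    congr 1
    push_cast
    ring
  rw [e b, e b']
  exact h

/-- The double integral along two horizontal lines does not depend on the lines. -/
lemma integral_lines_eq {a' b' : ℝ} (ha' : 0 < a') (hb' : b' < 0) :
    ∫ y : ℝ, ∫ x : ℝ, R (x + a * Complex.I) (y + b * Complex.I) =
      ∫ y : ℝ, ∫ x : ℝ, R (x + a' * Complex.I) (y + b' * Complex.I) := by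
  have hsw : ∀ {b : ℝ}, b < 0 → ∫ y : ℝ, ∫ x : ℝ, R (x + a' * Complex.I) (y + b * Complex.I) =
      ∫ x : ℝ, ∫ y : ℝ, R (x + a' * Complex.I) (y + b * Complex.I) := fun hb =>
    (integral_integral_swap (f := fun (x y : ℝ) => R (x + a' * Complex.I) (y + _ * Complex.I))
      (hR.integrable_lines ha' hb)).symm
  have h1 : ∀ y : ℝ, ∫ x : ℝ, R (x + a * Complex.I) (y + b * Complex.I) =
      ∫ x : ℝ, R (x + a' * Complex.I) (y + b * Complex.I) := fun y =>
    hR.integral_fst_eq ha ha' (by simpa using hb)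
  simp_rw [h1]
  rw [hsw hb, hsw hb']
  congr 1 with x
  exact hR.integral_snd_eq ha' hb hb' x

end StripBounded

end

section

/-! ### Explicit integrals -/

open scoped FourierTransform

lemma norm_inv_le_decay {w : ℂ} {x h K : ℝ} (hh : 0 < h) (hK : 0 ≤ K) (hw : h ≤ ‖w‖)
    (hx : |x| ≤ ‖w‖ + K) : ‖w⁻¹‖ ≤ ((1 + K) / h + 1) * decay x := by
  have hw0 : 0 < ‖w‖ := hh.trans_le hw
  rw [norm_inv, decay, ← div_eq_mul_inv, inv_eq_one_div,
    div_le_div_iff₀ hw0 (by positivity), one_mul]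
  have : 1 + K ≤ (1 + K) / h * ‖w‖ := by
    rw [div_mul_eq_mul_div, le_div_iff₀ hh]
    gcongr
  linarith

lemma norm_inv_add_le {A : ℂ} (hA : A.im ≠ 0) :
    ∃ C, 0 ≤ C ∧ ∀ x : ℝ, ‖((x : ℂ) + A)⁻¹‖ ≤ C * decay x := by
  refine ⟨(1 + ‖A‖) / |A.im| + 1, by positivity, fun x => ?_⟩
  refine norm_inv_le_decay (abs_pos.2 hA) (norm_nonneg _) ?_ ?_
  · simpa using Complex.abs_im_le_norm ((x : ℂ) + A)
  · have := norm_sub_le ((x : ℂ) + A) A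
    rw [add_sub_cancel_right, Complex.norm_real] at this
    exact this

lemma ofReal_add_ne_zero {A : ℂ} (hA : A.im ≠ 0) (x : ℝ) : (x : ℂ) + A ≠ 0 := by
  simpa using ofReal_sub_ne_zero (z := -A) (by simpa using hA) x

lemma continuous_inv_ofReal_add {A : ℂ} (hA : A.im ≠ 0) :
    Continuous fun x : ℝ => ((x : ℂ) + A)⁻¹ :=
  (Complex.continuous_ofReal.add continuous_const).inv₀ (ofReal_add_ne_zero hA)

lemma integrable_inv_mul_inv {A B : ℂ} (hA : A.im ≠ 0) (hB : B.im ≠ 0) :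
    Integrable fun x : ℝ => ((x : ℂ) + A)⁻¹ * ((x : ℂ) + B)⁻¹ := by
  obtain ⟨C, hC0, hC⟩ := norm_inv_add_le hA
  obtain ⟨D, hD0, hD⟩ := norm_inv_add_le hB
  refine (integrable_weight.const_mul (C * D)).mono'
    ((continuous_inv_ofReal_add hA).mul (continuous_inv_ofReal_add hB)).aestronglyMeasurable
    (ae_of_all _ fun x => ?_)
  rw [norm_mul]
  have := decay_pos x
  calc _ ≤ (C * decay x) * (D * decay x) := by
        gcongr
        · exact hC x
        · exact hD x
    _ = C * D * (decay x * decay x) := by ring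
    _ ≤ _ := by
        gcongr
        exact decay_sq_le_weight x

lemma norm_exp_neg_I_mul_ofReal (τ x : ℝ) : ‖Complex.exp (-(Complex.I * τ * x))‖ = 1 := by
  rw [Complex.norm_exp]
  simp

lemma integrable_exp_mul {τ : ℝ} {g : ℝ → ℂ} (hg : Integrable g) :
    Integrable fun x : ℝ => Complex.exp (-(Complex.I * τ * x)) * g x := by
  refine hg.mono (AEStronglyMeasurable.mul (Continuous.aestronglyMeasurable (by fun_prop))
    hg.aestronglyMeasurable) (ae_of_all _ fun x => ?_)
  rw [norm_mul, norm_exp_neg_I_mul_ofReal, one_mul]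

/-- The function `u ↦ u e^{iuA}` on the positive half-line, extended by zero. -/
def rampExp (A : ℂ) (u : ℝ) : ℂ := (max u 0 : ℝ) * Complex.exp (Complex.I * u * A)

lemma continuous_rampExp (A : ℂ) : Continuous (rampExp A) := by
  unfold rampExp
  fun_prop

lemma rampExp_eq_indicator (A : ℂ) :
    rampExp A = (Set.Ioi (0 : ℝ)).indicator fun u : ℝ =>
      (u : ℂ) * Complex.exp (Complex.I * u * A) := by
  ext u
  rcases le_or_gt u 0 with h | h
  · simp [rampExp, h]
  · simp [rampExp, h, h.le]

lemma integrable_rampExp {A : ℂ} (hA : 0 < A.im) : Integrable (rampExp A) := by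
  rw [rampExp_eq_indicator, integrable_indicator_iff measurableSet_Ioi]
  have h := integrableOn_rpow_mul_exp_neg_mul_rpow (p := 1) (s := 1) (b := A.im)
    (by norm_num) one_pos hA
  refine h.mono' (Continuous.aestronglyMeasurable (by fun_prop)) ?_
  refine ae_restrict_of_forall_mem measurableSet_Ioi fun u hu => ?_
  have hu' : (0 : ℝ) < u := hu
  rw [norm_mul, norm_exp_I_mul, Complex.norm_real, Real.norm_of_nonneg hu'.le, Real.rpow_one]
  simp [mul_comm]

lemma integral_Ioi_mul_exp {B : ℂ} (hB : 0 < B.im) :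
    ∫ u in Set.Ioi (0 : ℝ), (u : ℂ) * Complex.exp (Complex.I * u * B) = -(B ^ 2)⁻¹ := by
  have hB0 : B ≠ 0 := fun h => by simp [h] at hB
  have hI := Complex.I_ne_zero
  have hd : ∀ u ∈ Set.Ici (0 : ℝ), HasDerivAt
      (fun u : ℝ => Complex.exp (Complex.I * u * B) * (u * (Complex.I * B)⁻¹ + (B ^ 2)⁻¹))
      ((u : ℂ) * Complex.exp (Complex.I * u * B)) u := by
    intro u _
    have h1 : HasDerivAt (fun u : ℝ => (u : ℂ)) 1 u := HasDerivAt.ofReal_comp (hasDerivAt_id u)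
    refine ((((h1.const_mul Complex.I).mul_const B).cexp).fun_mul
      ((h1.mul_const (Complex.I * B)⁻¹).add_const (B ^ 2)⁻¹)).congr_deriv ?_
    field_simp
    linear_combination Complex.I_mul_I
  have h0 : Tendsto (fun u : ℝ => ‖Complex.exp (Complex.I * u * B)‖) atTop (𝓝 0) := by
    have := tendsto_rpow_mul_exp_neg_mul_atTop_nhds_zero 0 B.im hB
    refine this.congr fun u => ?_
    rw [norm_exp_I_mul, Real.rpow_zero, one_mul, mul_comm u, neg_mul]
  have h1 : Tendsto (fun u : ℝ => ‖(u : ℂ) * Complex.exp (Complex.I * u * B)‖) atTop (𝓝 0) := by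
    have := tendsto_rpow_mul_exp_neg_mul_atTop_nhds_zero 1 B.im hB
    refine this.congr' ?_
    filter_upwards [eventually_ge_atTop 0] with u hu
    rw [norm_mul, norm_exp_I_mul, Complex.norm_real, Real.norm_of_nonneg hu, Real.rpow_one,
      mul_comm u B.im, neg_mul]
  have ht : Tendsto (fun u : ℝ => Complex.exp (Complex.I * u * B) *
      (u * (Complex.I * B)⁻¹ + (B ^ 2)⁻¹)) atTop (𝓝 0) := by
    have := ((tendsto_zero_iff_norm_tendsto_zero.2 h1).mul_const (Complex.I * B)⁻¹).add
      ((tendsto_zero_iff_norm_tendsto_zero.2 h0).mul_const (B ^ 2)⁻¹)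
    rw [zero_mul, zero_mul, add_zero] at this
    refine this.congr fun u => ?_
    ring
  have hint : IntegrableOn (fun u : ℝ => (u : ℂ) * Complex.exp (Complex.I * u * B))
      (Set.Ioi 0) := by
    rw [← integrable_indicator_iff measurableSet_Ioi, ← rampExp_eq_indicator]
    exact integrable_rampExp hB
  rw [integral_Ioi_of_hasDerivAt_of_tendsto' hd hint ht]
  simp

lemma fourier_rampExp {A : ℂ} (hA : 0 < A.im) (ξ : ℝ) :
    𝓕 (rampExp A) ξ = -(((A - 2 * Real.pi * ξ) ^ 2)⁻¹) := by
  rw [Real.fourier_real_eq_integral_exp_smul, ← integral_Ioi_mul_exp (by simpa using hA),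
    ← integral_indicator measurableSet_Ioi]
  congr 1 with u
  rw [rampExp_eq_indicator]
  by_cases hu : u ∈ Set.Ioi (0 : ℝ)
  · rw [Set.indicator_of_mem hu, Set.indicator_of_mem hu, smul_eq_mul, mul_left_comm,
      ← Complex.exp_add]
    congr 2
    push_cast
    ring
  · rw [Set.indicator_of_notMem hu, Set.indicator_of_notMem hu, smul_zero]

/-- Fourier inversion for the ramp u e^{iuA}. The factor u makes it continuous at 0 and its
transform absolutely integrable, which would fail for a simple pole; the simple pole is recovered by
integration by parts. -/
lemma integral_exp_mul_inv_sq {A : ℂ} (hA : 0 < A.im) (τ : ℝ) :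
    ∫ x : ℝ, Complex.exp (-(Complex.I * τ * x)) * (((x : ℂ) + A)⁻¹ * ((x : ℂ) + A)⁻¹) =
      -(2 * Real.pi) * rampExp A τ := by
  set G : ℝ → ℂ := fun x => Complex.exp (-(Complex.I * τ * x)) *
    (((x : ℂ) + A)⁻¹ * ((x : ℂ) + A)⁻¹) with hG
  have hpi : (-(2 * Real.pi) : ℝ) ≠ 0 := by simp [Real.pi_ne_zero]
  have hF : Integrable (𝓕 (rampExp A)) := by
    have h1 := ((integrable_inv_mul_inv hA.ne' hA.ne').comp_mul_left' hpi).neg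
    refine h1.congr (ae_of_all _ fun ξ => ?_)
    simp only [Pi.neg_apply]
    rw [fourier_rampExp hA, ← mul_inv, ← sq]
    push_cast
    ring_nf
  have hinv := congrFun ((continuous_rampExp A).fourierInv_fourier_eq (integrable_rampExp hA) hF) τ
  rw [Real.fourierInv_eq'] at hinv
  have h2 := Measure.integral_comp_mul_left G (-(2 * Real.pi))
  have h3 : rampExp A τ = -∫ ξ : ℝ, G (-(2 * Real.pi) * ξ) := by
    rw [← hinv, ← integral_neg]
    congr 1 with ξ
    simp only [hG]
    rw [fourier_rampExp hA, smul_eq_mul, ← mul_inv, ← sq, mul_neg]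
    congr 3
    · simp
      ring
    · push_cast
      ring
  rw [h3, h2, abs_inv, abs_neg, abs_of_pos (by positivity), Complex.real_smul]
  have : (Real.pi : ℂ) ≠ 0 := by exact_mod_cast Real.pi_ne_zero
  push_cast
  field_simp

lemma tendsto_inv_ofReal_add {A : ℂ} (hA : A.im ≠ 0) {l : Filter ℝ} {u : ℝ → ℝ}
    (hu : Tendsto (fun N => decay (u N)) l (𝓝 0)) :
    Tendsto (fun N => ((u N : ℂ) + A)⁻¹) l (𝓝 0) := by
  obtain ⟨C, hC0, hC⟩ := norm_inv_add_le hA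
  exact squeeze_zero_norm (fun N => hC (u N)) (by simpa using hu.const_mul C)

/-- Integration by parts reduces the simple pole to the double one; the boundary terms vanish like
1/N. Both signs of τ are allowed: for τ < 0 the ramp is zero, which replaces closing the contour on
the other side. -/
lemma tendsto_integral_exp_mul_inv_aux {A : ℂ} (hA : 0 < A.im) {τ : ℝ} (hτ : τ ≠ 0) :
    Tendsto (fun N : ℝ => ∫ x in (-N)..N,
      Complex.exp (-(Complex.I * τ * x)) * ((x : ℂ) + A)⁻¹) atTop
      (𝓝 (-(2 * Real.pi * Complex.I) * (τ⁻¹ * rampExp A τ))) := by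
  have hτ' : (τ : ℂ) ≠ 0 := by exact_mod_cast hτ
  set e : ℝ → ℂ := fun x => Complex.exp (-(Complex.I * τ * x)) with he
  have hb : ∀ {u : ℝ → ℝ}, Tendsto (fun N => decay (u N)) atTop (𝓝 0) →
      Tendsto (fun N => e (u N) * ((u N : ℂ) + A)⁻¹) atTop (𝓝 0) := fun {u} hu => by
    refine squeeze_zero_norm (fun N => ?_) (tendsto_zero_iff_norm_tendsto_zero.1
      (tendsto_inv_ofReal_add hA.ne' hu))
    rw [norm_mul, he, norm_exp_neg_I_mul_ofReal, one_mul]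
  have hd : ∀ x : ℝ, HasDerivAt (fun x : ℝ => e x * ((x : ℂ) + A)⁻¹)
      (-(Complex.I * τ) * (e x * ((x : ℂ) + A)⁻¹) -
        e x * (((x : ℂ) + A)⁻¹ * ((x : ℂ) + A)⁻¹)) x := by
    intro x
    have hx := ofReal_add_ne_zero hA.ne' x
    have h1 : HasDerivAt (fun x : ℝ => (x : ℂ) + A) 1 x :=
      (HasDerivAt.ofReal_comp (hasDerivAt_id x)).add_const A
    have h2 : HasDerivAt e (e x * (-(Complex.I * τ))) x := by
      have : HasDerivAt (fun x : ℝ => -(Complex.I * τ * (x : ℂ))) (-(Complex.I * τ)) x := by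
        simpa using! ((HasDerivAt.ofReal_comp (hasDerivAt_id x)).const_mul (Complex.I * τ)).fun_neg
      exact this.cexp
    refine (h2.fun_mul (h1.fun_inv hx)).congr_deriv ?_
    rw [neg_div, one_div, sq, mul_inv]
    ring
  have hce : Continuous e := by fun_prop
  have hc1 : Continuous fun x : ℝ => e x * ((x : ℂ) + A)⁻¹ :=
    hce.mul (continuous_inv_ofReal_add hA.ne')
  have hc2 : Continuous fun x : ℝ => e x * (((x : ℂ) + A)⁻¹ * ((x : ℂ) + A)⁻¹) :=
    hce.mul ((continuous_inv_ofReal_add hA.ne').mul (continuous_inv_ofReal_add hA.ne'))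
  have hparts : ∀ N : ℝ, ∫ x in (-N)..N, e x * ((x : ℂ) + A)⁻¹ =
      -(Complex.I * τ)⁻¹ * (e N * ((N : ℂ) + A)⁻¹ - e (-N) * (((-N : ℝ) : ℂ) + A)⁻¹ +
        ∫ x in (-N)..N, e x * (((x : ℂ) + A)⁻¹ * ((x : ℂ) + A)⁻¹)) := by
    intro N
    have h := intervalIntegral.integral_eq_sub_of_hasDerivAt (a := -N) (b := N)
      (fun x _ => hd x) (((hc1.const_mul _).sub hc2).intervalIntegrable _ _)
    rw [intervalIntegral.integral_sub ((hc1.const_mul _).intervalIntegrable _ _)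
      (hc2.intervalIntegrable _ _), intervalIntegral.integral_const_mul] at h
    rw [← h]
    field_simp
    ring
  rw [show (fun N : ℝ => ∫ x in (-N)..N, e x * ((x : ℂ) + A)⁻¹) = _ from funext hparts]
  have h1 := hb (u := fun N => N) tendsto_decay_atTop
  have h2 := hb (u := fun N => -N) (tendsto_decay_atBot.comp tendsto_neg_atTop_atBot)
  have h3 := tendsto_integral_line
    (integrable_exp_mul (τ := τ) (integrable_inv_mul_inv hA.ne' hA.ne'))
  rw [integral_exp_mul_inv_sq hA] at h3
  convert ((h1.sub h2).add h3).const_mul (-(Complex.I * τ)⁻¹) using 2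
  rw [sub_zero, zero_add, mul_inv, Complex.inv_I]
  push_cast
  ring

/-- The Fourier integral of a simple pole in the lower half-plane. -/
lemma tendsto_integral_exp_mul_inv {A : ℂ} (hA : 0 < A.im) {τ : ℝ} (hτ : 0 < τ) :
    Tendsto (fun N : ℝ => ∫ x in (-N)..N,
      Complex.exp (-(Complex.I * τ * x)) * ((x : ℂ) + A)⁻¹) atTop
      (𝓝 (-(2 * Real.pi * Complex.I) * Complex.exp (Complex.I * τ * A))) := by
  convert tendsto_integral_exp_mul_inv_aux hA hτ.ne' using 3
  have hτ' : (τ : ℂ) ≠ 0 := by exact_mod_cast hτ.ne'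
  rw [rampExp, max_eq_left hτ.le]
  push_cast
  field_simp

/-- The Fourier integral of a simple pole in the upper half-plane vanishes. -/
lemma tendsto_integral_exp_mul_inv_zero {B : ℂ} (hB : B.im < 0) {τ : ℝ} (hτ : 0 < τ) :
    Tendsto (fun N : ℝ => ∫ x in (-N)..N,
      Complex.exp (-(Complex.I * τ * x)) * ((x : ℂ) + B)⁻¹) atTop (𝓝 0) := by
  have h := (tendsto_integral_exp_mul_inv_aux (A := -B) (by simpa using hB)
    (τ := -τ) (by simpa using hτ.ne')).neg
  have h0 : rampExp (-B) (-τ) = 0 := by simp [rampExp, hτ.le]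
  rw [h0, mul_zero, mul_zero, neg_zero] at h
  refine h.congr fun N => ?_
  rw [← intervalIntegral.integral_neg]
  have := intervalIntegral.integral_comp_neg (a := -N) (b := N)
    (fun x : ℝ => Complex.exp (-(Complex.I * τ * x)) * ((x : ℂ) + B)⁻¹)
  rw [neg_neg] at this
  rw [← this]
  congr 1 with x
  rw [← mul_neg, ← inv_neg]
  push_cast
  congr 2 <;> ring

lemma inv_mul_inv_eq {a b : ℂ} (ha : a ≠ 0) (hb : b ≠ 0) (hab : b - a ≠ 0) :
    a⁻¹ * b⁻¹ = (b - a)⁻¹ * (a⁻¹ - b⁻¹) := by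
  rw [inv_sub_inv ha hb]
  field_simp

/-- Residue evaluation of `∫ dx / ((x + A)(x + B))`. -/
lemma integral_inv_mul_inv {A B : ℂ} (hA : 0 < A.im) (hB : B.im < 0) :
    ∫ x : ℝ, ((x : ℂ) + A)⁻¹ * ((x : ℂ) + B)⁻¹ = 2 * Real.pi * Complex.I * (A - B)⁻¹ := by
  have hBA : B - A ≠ 0 := fun h => by
    have := congrArg Complex.im h
    simp at this
    linarith
  have hint := integrable_inv_mul_inv hA.ne' hB.ne
  -- The oscillating factor with τ > 0 gives the two partial fractions separate known limits. It is
  -- removed at the end by dominated convergence as τ → 0, which the product of two poles permits.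
  have h1 : ∀ τ : ℝ, 0 < τ →
      ∫ x : ℝ, Complex.exp (-(Complex.I * τ * x)) * (((x : ℂ) + A)⁻¹ * ((x : ℂ) + B)⁻¹) =
        (B - A)⁻¹ * (-(2 * Real.pi * Complex.I) * Complex.exp (Complex.I * τ * A)) := by
    intro τ hτ
    refine tendsto_nhds_unique (tendsto_integral_line (integrable_exp_mul hint)) ?_
    have h := ((tendsto_integral_exp_mul_inv hA hτ).sub
      (tendsto_integral_exp_mul_inv_zero hB hτ)).const_mul (B - A)⁻¹
    rw [sub_zero] at h
    refine h.congr fun N => ?_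
    rw [← intervalIntegral.integral_sub, ← intervalIntegral.integral_const_mul]
    · congr 1 with x
      rw [inv_mul_inv_eq (ofReal_add_ne_zero hA.ne' x) (ofReal_add_ne_zero hB.ne x)
        (by simpa using hBA), add_sub_add_left_eq_sub]
      ring
    · exact Continuous.intervalIntegrable
        (Continuous.mul (by fun_prop) (continuous_inv_ofReal_add hA.ne')) _ _
    · exact Continuous.intervalIntegrable
        (Continuous.mul (by fun_prop) (continuous_inv_ofReal_add hB.ne)) _ _
  have h2 : Tendsto (fun τ : ℝ => ∫ x : ℝ, Complex.exp (-(Complex.I * τ * x)) *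
      (((x : ℂ) + A)⁻¹ * ((x : ℂ) + B)⁻¹)) (𝓝[>] 0)
      (𝓝 (∫ x : ℝ, ((x : ℂ) + A)⁻¹ * ((x : ℂ) + B)⁻¹)) := by
    refine tendsto_integral_filter_of_dominated_convergence
      (fun x : ℝ => ‖((x : ℂ) + A)⁻¹ * ((x : ℂ) + B)⁻¹‖)
      (Eventually.of_forall fun τ => (integrable_exp_mul hint).aestronglyMeasurable) ?_
      hint.norm (ae_of_all _ fun x => ?_)
    · refine Eventually.of_forall fun τ => ae_of_all _ fun x => ?_
      rw [norm_mul, norm_exp_neg_I_mul_ofReal, one_mul]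
    · have : Continuous fun τ : ℝ => Complex.exp (-(Complex.I * τ * x)) *
          (((x : ℂ) + A)⁻¹ * ((x : ℂ) + B)⁻¹) := by fun_prop
      simpa using this.continuousAt.tendsto.mono_left (nhdsWithin_le_nhds (a := (0:ℝ)))
  have h3 : Tendsto (fun τ : ℝ => (B - A)⁻¹ * (-(2 * Real.pi * Complex.I) *
      Complex.exp (Complex.I * τ * A))) (𝓝[>] 0)
      (𝓝 ((B - A)⁻¹ * (-(2 * Real.pi * Complex.I)))) := by
    have : Continuous fun τ : ℝ => (B - A)⁻¹ * (-(2 * Real.pi * Complex.I) *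
      Complex.exp (Complex.I * τ * A)) := by fun_prop
    simpa using this.continuousAt.tendsto.mono_left (nhdsWithin_le_nhds (a := (0:ℝ)))
  rw [tendsto_nhds_unique h2 (h3.congr' (by
    filter_upwards [self_mem_nhdsWithin] with τ hτ
    exact (h1 τ hτ).symm)), ← neg_sub B A, inv_neg]
  ring

end

/-- Iterated line integrals of a product plus a strip-bounded remainder converge. -/
theorem iterated_lineIntegral {G : ℂ → ℂ → ℂ} {U V : ℂ → ℂ} {R : ℂ → ℂ → ℂ} {a b : ℝ}
    (ha : 0 < a) (hb : b < 0)
    (hG : ∀ z₁ z₂ : ℂ, 0 < z₁.im → z₂.im < 0 → G z₁ z₂ = U z₁ * V z₂ + R z₁ z₂)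
    (hUd : ∀ z : ℂ, 0 < z.im → DifferentiableAt ℂ U z)
    (hVd : ∀ z : ℂ, z.im < 0 → DifferentiableAt ℂ V z) (hR : StripBounded R) {IU IV : ℂ}
    (hU : Tendsto (fun N : ℝ => ∫ x in (-N)..N, U (x + a * Complex.I)) atTop (𝓝 IU))
    (hV : Tendsto (fun N : ℝ => ∫ x in (-N)..N, V (x + b * Complex.I)) atTop (𝓝 IV)) :
    (∀ z₂ : ℂ, z₂.im = b → LineIntegrable (fun z₁ => G z₁ z₂) a) ∧
      LineIntegrable (fun z₂ => lineIntegral (fun z₁ => G z₁ z₂) a) b ∧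
      lineIntegral (fun z₂ => lineIntegral (fun z₁ => G z₁ z₂) a) b =
        IU * IV + ∫ y : ℝ, ∫ x : ℝ, R (x + a * Complex.I) (y + b * Complex.I) := by
  have hUc : Continuous fun x : ℝ => U (x + a * Complex.I) := by
    rw [continuous_iff_continuousAt]
    intro x
    exact ContinuousAt.comp (f := fun x : ℝ => (x + a * Complex.I : ℂ))
      (hUd _ (by simpa using ha)).continuousAt (by fun_prop)
  have hVc : Continuous fun x : ℝ => V (x + b * Complex.I) := by
    rw [continuous_iff_continuousAt]
    intro x
    exact ContinuousAt.comp (f := fun x : ℝ => (x + b * Complex.I : ℂ))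
      (hVd _ (by simpa using hb)).continuousAt (by fun_prop)
  have hinner : ∀ z₂ : ℂ, z₂.im = b → (∀ N : ℝ, IntervalIntegrable
      (fun x : ℝ => G (x + a * Complex.I) z₂) volume (-N) N) ∧
      Tendsto (fun N : ℝ => ∫ x in (-N)..N, G (x + a * Complex.I) z₂) atTop
        (𝓝 (IU * V z₂ + ∫ x : ℝ, R (x + a * Complex.I) z₂)) := by
    intro z₂ hz₂
    have hz₂' : z₂.im < 0 := hz₂ ▸ hb
    have e : (fun x : ℝ => G (x + a * Complex.I) z₂) = fun x : ℝ =>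
        U (x + a * Complex.I) * V z₂ + R (x + a * Complex.I) z₂ := by
      ext x
      exact hG _ _ (by simpa using ha) hz₂'
    have i1 : Integrable fun x : ℝ => R (x + a * Complex.I) z₂ := by
      rw [(Complex.re_add_im z₂).symm]
      exact hR.integrable_fst ha hz₂'
    have i2 : ∀ N : ℝ, IntervalIntegrable (fun x : ℝ => U (x + a * Complex.I) * V z₂)
        volume (-N) N := fun N => (hUc.mul_const _).intervalIntegrable _ _
    rw [e]
    refine ⟨fun N => (i2 N).add i1.intervalIntegrable, ?_⟩
    refine ((hU.mul_const (V z₂)).add (tendsto_integral_line i1)).congr fun N => ?_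
    rw [intervalIntegral.integral_add (i2 N) i1.intervalIntegrable,
      intervalIntegral.integral_mul_const]
  have hval : ∀ z₂ : ℂ, z₂.im = b → lineIntegral (fun z₁ => G z₁ z₂) a =
      IU * V z₂ + ∫ x : ℝ, R (x + a * Complex.I) z₂ := fun z₂ hz₂ => (hinner z₂ hz₂).2.limUnder_eq
  have e : (fun y : ℝ => lineIntegral (fun z₁ => G z₁ (y + b * Complex.I)) a) = fun y : ℝ =>
      IU * V (y + b * Complex.I) + ∫ x : ℝ, R (x + a * Complex.I) (y + b * Complex.I) := by
    ext y
    exact hval _ (by simp)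
  -- The remainder is integrated absolutely by Fubini, whereas the limits along growing segments are
  -- needed only for `U` and `V`.
  have i1 : Integrable fun y : ℝ => ∫ x : ℝ, R (x + a * Complex.I) (y + b * Complex.I) :=
    (hR.integrable_lines ha hb).integral_prod_right
  have i2 : ∀ N : ℝ, IntervalIntegrable (fun y : ℝ => IU * V (y + b * Complex.I))
      volume (-N) N := fun N => (hVc.const_mul _).intervalIntegrable _ _
  have hT : Tendsto (fun N : ℝ => ∫ y in (-N)..N,
      lineIntegral (fun z₁ => G z₁ (y + b * Complex.I)) a) atTop
      (𝓝 (IU * IV + ∫ y : ℝ, ∫ x : ℝ, R (x + a * Complex.I) (y + b * Complex.I))) := by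
    rw [e]
    refine ((hV.const_mul IU).add (tendsto_integral_line i1)).congr fun N => ?_
    rw [intervalIntegral.integral_add (i2 N) i1.intervalIntegrable,
      intervalIntegral.integral_const_mul]
  refine ⟨fun z₂ hz₂ => ⟨(hinner z₂ hz₂).1, _, (hinner z₂ hz₂).2⟩, ⟨fun N => ?_, _, hT⟩,
    hT.limUnder_eq⟩
  rw [e]
  exact (i2 N).add i1.intervalIntegrable

/-! ### Single line integrals near a resonance -/

lemma norm_inv_add_add_le {σ w : ℂ} {M : ℝ} (hσ : ‖σ‖ ≤ 1) (hw : ‖w‖ ≤ M)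
    (h : 1 ≤ |(σ + w).im|) (x : ℝ) : ‖((x : ℂ) + σ + w)⁻¹‖ ≤ (3 + M) * decay x := by
  have hM : 0 ≤ M := (norm_nonneg w).trans hw
  have h1 := norm_inv_le_decay (w := (x : ℂ) + σ + w) (x := x) (h := 1) (K := 1 + M) one_pos
    (by positivity) ?_ ?_
  · convert h1 using 2
    ring
  · refine h.trans ?_
    simpa using Complex.abs_im_le_norm ((x : ℂ) + σ + w)
  · have h2 : (x : ℂ) = (x + σ + w) - (σ + w) := by ring
    have h3 := norm_sub_le ((x : ℂ) + σ + w) (σ + w)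
    rw [← h2, Complex.norm_real] at h3
    have := norm_add_le σ w
    have h4 : |x| = ‖x‖ := rfl
    linarith

lemma one_le_abs_im_I_add {w : ℂ} (hw : 0 ≤ w.im) : 1 ≤ |(Complex.I + w).im| := by
  rw [Complex.add_im, Complex.I_im]
  exact (by linarith : (1 : ℝ) ≤ 1 + w.im).trans (le_abs_self _)

lemma ofReal_add_I_add_ne_zero {w : ℂ} (hw : 0 ≤ w.im) (x : ℝ) : (x : ℂ) + Complex.I + w ≠ 0 := by
  rw [add_assoc]
  refine ofReal_add_ne_zero ?_ x
  exact abs_pos.1 (one_pos.trans_le (one_le_abs_im_I_add hw))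

/-- The integrand of the correction to a free wave caused by the self-energy `g`. -/
def waveCorr (τ : ℝ) (g : ℝ → ℂ) (x : ℝ) : ℂ :=
  Complex.exp (-(Complex.I * τ * (x + Complex.I))) *
    (g x * (((x : ℂ) + Complex.I + g x)⁻¹ * ((x : ℂ) + Complex.I)⁻¹))

lemma exp_add_I (τ x : ℝ) : Complex.exp (-(Complex.I * τ * (x + Complex.I))) =
    Real.exp τ * Complex.exp (-(Complex.I * τ * x)) := by
  rw [Complex.ofReal_exp, ← Complex.exp_add]
  congr 1
  linear_combination -τ * Complex.I_mul_I

section wave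

variable {M τ : ℝ} {g : ℝ → ℂ}

lemma norm_waveCorr_le (hM : ∀ x, ‖g x‖ ≤ M) (hi : ∀ x, 0 ≤ (g x).im) (x : ℝ) :
    ‖waveCorr τ g x‖ ≤ Real.exp τ * (M * ((3 + M) * (3 + 0))) * weight x := by
  have hM0 : 0 ≤ M := (norm_nonneg _).trans (hM 0)
  have h1 := norm_inv_add_add_le (σ := Complex.I) (w := g x) (by simp) (hM x)
    (one_le_abs_im_I_add (hi x)) x
  have h2 := norm_inv_add_add_le (σ := Complex.I) (w := 0) (M := 0) (by simp) (by simp)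
    (by simp) x
  rw [add_zero] at h2
  have := decay_pos x
  rw [waveCorr, exp_add_I, norm_mul, norm_mul, norm_mul, norm_mul, norm_exp_neg_I_mul_ofReal,
    mul_one, Complex.norm_real, Real.norm_of_nonneg (Real.exp_pos τ).le]
  calc _ ≤ Real.exp τ * (M * (((3 + M) * decay x) * ((3 + 0) * decay x))) := by
        gcongr
        exact hM x
    _ = Real.exp τ * (M * ((3 + M) * (3 + 0))) * (decay x * decay x) := by ring
    _ ≤ _ := by
        gcongr
        exact decay_sq_le_weight x

lemma continuous_waveCorr (hc : Continuous g) (hi : ∀ x, 0 ≤ (g x).im) :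
    Continuous (waveCorr τ g) := by
  unfold waveCorr
  refine Continuous.mul (by fun_prop) (hc.mul (Continuous.mul ?_ ?_))
  · exact Continuous.inv₀ (by fun_prop) fun x => ofReal_add_I_add_ne_zero (hi x) x
  · exact continuous_inv_ofReal_add (by simp)

lemma integrable_waveCorr (hc : Continuous g) (hM : ∀ x, ‖g x‖ ≤ M) (hi : ∀ x, 0 ≤ (g x).im) :
    Integrable (waveCorr τ g) :=
  (integrable_weight.const_mul _).mono' (continuous_waveCorr hc hi).aestronglyMeasurable
    (ae_of_all _ (norm_waveCorr_le hM hi))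

/-- Here g (x+i+g)⁻¹ (x+i)⁻¹ = (x+i)⁻¹ - (x+i+g)⁻¹, and for constant g both poles have explicit
Fourier integrals. The free term 2πi cancels the first one. -/
lemma integral_waveCorr_const (hτ : 0 < τ) {W : ℂ} (hW : 0 ≤ W.im) :
    2 * Real.pi * Complex.I + ∫ x, waveCorr τ (fun _ => W) x =
      2 * Real.pi * Complex.I * Complex.exp (Complex.I * τ * W) := by
  have hIW : 0 < (Complex.I + W).im := by
    rw [Complex.add_im, Complex.I_im]; linarith
  have hI : 0 < Complex.I.im := by simp
  have hint : Integrable (waveCorr τ fun _ => W) :=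
    integrable_waveCorr continuous_const (fun _ => le_rfl) (fun _ => hW)
  have h := (((tendsto_integral_exp_mul_inv hI hτ).sub
    (tendsto_integral_exp_mul_inv hIW hτ)).const_mul (Real.exp τ : ℂ)).congr' (f₂ := fun N : ℝ =>
      ∫ x in (-N)..N, waveCorr τ (fun _ => W) x) (Eventually.of_forall fun N => by
    simp only
    rw [← intervalIntegral.integral_sub, ← intervalIntegral.integral_const_mul]
    · congr 1 with x
      have h1 := ofReal_add_I_add_ne_zero hW x
      have h2 := ofReal_add_ne_zero hI.ne' x
      rw [waveCorr, exp_add_I, ← add_assoc]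
      field_simp
      ring
    · exact Continuous.intervalIntegrable
        (Continuous.mul (by fun_prop) (continuous_inv_ofReal_add hI.ne')) _ _
    · exact Continuous.intervalIntegrable
        (Continuous.mul (by fun_prop) (continuous_inv_ofReal_add hIW.ne')) _ _)
  rw [tendsto_nhds_unique (tendsto_integral_line hint) h]
  have e1 : Complex.exp (Complex.I * τ * Complex.I) = (Real.exp τ : ℂ)⁻¹ := by
    rw [Complex.ofReal_exp, ← Complex.exp_neg]
    congr 1
    linear_combination τ * Complex.I_mul_I
  have e2 : Complex.exp (Complex.I * τ * (Complex.I + W)) =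
      (Real.exp τ : ℂ)⁻¹ * Complex.exp (Complex.I * τ * W) := by
    rw [← e1, ← Complex.exp_add]
    ring_nf
  have : (Real.exp τ : ℂ) ≠ 0 := by exact_mod_cast (Real.exp_pos τ).ne'
  rw [e1, e2]
  field_simp
  ring

lemma tendsto_integral_waveCorr {ι : Type*} {l : Filter ι} [l.IsCountablyGenerated]
    {G : ι → ℝ → ℂ} {W : ℂ} (hτ : 0 < τ) (hc : ∀ᶠ i in l, Continuous (G i))
    (hM : ∀ᶠ i in l, ∀ x, ‖G i x‖ ≤ M) (hi : ∀ᶠ i in l, ∀ x, 0 ≤ (G i x).im) (hW : 0 ≤ W.im)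
    (hG : ∀ x, Tendsto (fun i => G i x) l (𝓝 W)) :
    Tendsto (fun i => 2 * Real.pi * Complex.I + ∫ x, waveCorr τ (G i) x) l
      (𝓝 (2 * Real.pi * Complex.I * Complex.exp (Complex.I * τ * W))) := by
  rw [← integral_waveCorr_const hτ hW]
  refine Tendsto.const_add _ (tendsto_integral_filter_of_dominated_convergence
    (fun x => Real.exp τ * (M * ((3 + M) * (3 + 0))) * weight x) ?_ ?_
    (integrable_weight.const_mul _) (ae_of_all _ fun x => ?_))
  · filter_upwards [hc, hi] with i h1 h2
    exact (continuous_waveCorr h1 h2).aestronglyMeasurable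
  · filter_upwards [hM, hi] with i h1 h2
    exact ae_of_all _ (norm_waveCorr_le h1 h2)
  · unfold waveCorr
    refine Tendsto.const_mul _ ((hG x).mul (Tendsto.mul_const _ (Tendsto.inv₀ ?_ ?_)))
    · exact (hG x).const_add _
    · exact ofReal_add_I_add_ne_zero hW x

/-- The line integral of `e^{-itz} (c - z - v² g(z))⁻¹` at the height `v²`, in scaled variables. -/
lemma tendsto_integral_wave {g : ℂ → ℂ} {c v t : ℝ} (hv : 0 < v) (ht : 0 < t)
    (hc : ∀ z : ℂ, 0 < z.im → ContinuousAt g z) (hM : ∀ z : ℂ, 0 < z.im → ‖g z‖ ≤ M)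
    (hi : ∀ z : ℂ, 0 < z.im → 0 ≤ (g z).im) :
    Tendsto (fun N : ℝ => ∫ x in (-N)..N,
      (fun z : ℂ => Complex.exp (-(Complex.I * t * z)) * ((c : ℂ) - z - v ^ 2 * g z)⁻¹)
        (x + (v ^ 2 : ℝ) * Complex.I)) atTop
      (𝓝 (Complex.exp (-(Complex.I * t * c)) * (2 * Real.pi * Complex.I +
        ∫ x, waveCorr (t * v ^ 2) (fun x : ℝ => g (c + v ^ 2 * (x + Complex.I))) x))) := by
  have hv2 : 0 < v ^ 2 := by positivity
  have hvc : (v : ℂ) ≠ 0 := by exact_mod_cast hv.ne'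
  have him : ∀ x : ℝ, 0 < ((c : ℂ) + v ^ 2 * (x + Complex.I)).im := fun x => by
    rw [← Complex.ofReal_pow, Complex.add_im, Complex.im_ofReal_mul]
    simp
    positivity
  have hGc : Continuous fun x : ℝ => g (c + v ^ 2 * (x + Complex.I)) := by
    rw [continuous_iff_continuousAt]
    intro x
    exact ContinuousAt.comp (f := fun x : ℝ => (c + v ^ 2 * (x + Complex.I) : ℂ))
      (hc _ (him x)) (by fun_prop)
  have hint := integrable_waveCorr (τ := t * v ^ 2) hGc (fun x => hM _ (him x))
    (fun x => hi _ (him x))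
  set k := waveCorr (t * v ^ 2) (fun x : ℝ => g (c + v ^ 2 * (x + Complex.I))) with hk
  set A : ℂ := (v ^ 2 : ℝ) * Complex.I - c with hA
  have hAim : 0 < A.im := by
    rw [hA, Complex.sub_im, Complex.im_ofReal_mul]
    simp
    positivity
  have hint2 : Integrable fun x : ℝ => k ((x - c) / v ^ 2) :=
    (hint.comp_div hv2.ne').comp_sub_right c
  have hintk : ∫ x : ℝ, k ((x - c) / v ^ 2) = (v : ℂ) ^ 2 * ∫ x, k x := by
    rw [integral_sub_right_eq_self (fun x : ℝ => k (x / v ^ 2)) c, Measure.integral_comp_div,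
      abs_of_pos hv2, Complex.real_smul]
    push_cast
    rfl
  -- With ξ = (x - c)/v² the resolvent is -v⁻²(ξ+i+g)⁻¹. Splitting off the free pole -v⁻²(ξ+i)⁻¹ =
  -- -(x+A)⁻¹ leaves the absolutely integrable correction `waveCorr` in the variable ξ.
  have hpt : ∀ x : ℝ, (fun z : ℂ => Complex.exp (-(Complex.I * t * z)) *
      ((c : ℂ) - z - v ^ 2 * g z)⁻¹) (x + (v ^ 2 : ℝ) * Complex.I) =
      -(Real.exp (t * v ^ 2) : ℂ) * (Complex.exp (-(Complex.I * t * x)) * ((x : ℂ) + A)⁻¹) +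
        Complex.exp (-(Complex.I * t * c)) * ((v : ℂ) ^ 2)⁻¹ * k ((x - c) / v ^ 2) := by
    intro x
    have e0 : (c : ℂ) + v ^ 2 * ((((x - c) / v ^ 2 : ℝ) : ℂ) + Complex.I) =
        x + (v ^ 2 : ℝ) * Complex.I := by
      push_cast
      field_simp
      ring
    have n1 := ofReal_add_I_add_ne_zero (hi _ (him ((x - c) / v ^ 2))) ((x - c) / v ^ 2)
    have n2 := ofReal_add_ne_zero (A := Complex.I) (by simp) ((x - c) / v ^ 2)
    simp only [hk, waveCorr]
    rw [e0] at n1 ⊢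
    set w := g (x + (v ^ 2 : ℝ) * Complex.I)
    set ξ : ℂ := (((x - c) / v ^ 2 : ℝ) : ℂ) with hξ
    have hz : (x : ℂ) + (v ^ 2 : ℝ) * Complex.I = c + v ^ 2 * (ξ + Complex.I) := e0.symm
    have hxA : (x : ℂ) + A = v ^ 2 * (ξ + Complex.I) := by
      rw [hA]; linear_combination hz
    have ex1 : Complex.exp (-(Complex.I * t * (x + (v ^ 2 : ℝ) * Complex.I))) =
        (Real.exp (t * v ^ 2) : ℂ) * Complex.exp (-(Complex.I * t * x)) := by
      rw [Complex.ofReal_exp, ← Complex.exp_add]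
      congr 1
      push_cast
      linear_combination -t * v ^ 2 * Complex.I_mul_I
    have ex2 : Complex.exp (-(Complex.I * t * c)) *
        Complex.exp (-(Complex.I * (t * v ^ 2 : ℝ) * (ξ + Complex.I))) =
        (Real.exp (t * v ^ 2) : ℂ) * Complex.exp (-(Complex.I * t * x)) := by
      rw [← ex1, ← Complex.exp_add]
      congr 1
      rw [hz]
      push_cast
      ring
    rw [ex1, hxA, show (c : ℂ) - (x + (v ^ 2 : ℝ) * Complex.I) - v ^ 2 * w =
      -(v ^ 2 * (ξ + Complex.I + w)) by rw [hz]; ring]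
    rw [show ∀ a b d e : ℂ, a * b * (d * e) = (a * d) * (b * e) by intros; ring, ex2]
    field_simp
    ring
  have hc1 : Continuous fun x : ℝ => -(Real.exp (t * v ^ 2) : ℂ) *
      (Complex.exp (-(Complex.I * t * x)) * ((x : ℂ) + A)⁻¹) :=
    continuous_const.mul (Continuous.mul (by fun_prop) (continuous_inv_ofReal_add hAim.ne'))
  have hlim := ((tendsto_integral_exp_mul_inv hAim ht).const_mul
    (-(Real.exp (t * v ^ 2) : ℂ))).add ((tendsto_integral_line hint2).const_mul
      (Complex.exp (-(Complex.I * t * c)) * ((v : ℂ) ^ 2)⁻¹))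
  rw [hintk] at hlim
  have hval : -(Real.exp (t * v ^ 2) : ℂ) *
      (-(2 * Real.pi * Complex.I) * Complex.exp (Complex.I * t * A)) +
      Complex.exp (-(Complex.I * t * c)) * ((v : ℂ) ^ 2)⁻¹ * ((v : ℂ) ^ 2 * ∫ x, k x) =
      Complex.exp (-(Complex.I * t * c)) * (2 * Real.pi * Complex.I + ∫ x, k x) := by
    have : Complex.exp (-(Complex.I * t * c)) =
        (Real.exp (t * v ^ 2) : ℂ) * Complex.exp (Complex.I * t * A) := by
      rw [Complex.ofReal_exp, ← Complex.exp_add, hA]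
      congr 1
      push_cast
      linear_combination -t * v ^ 2 * Complex.I_mul_I
    rw [this]
    field_simp
  rw [hval] at hlim
  refine hlim.congr fun N => ?_
  simp_rw [hpt]
  rw [intervalIntegral.integral_add (hc1.intervalIntegrable _ _)
    (hint2.const_mul _).intervalIntegrable, intervalIntegral.integral_const_mul,
    intervalIntegral.integral_const_mul]

end wave

/-! ### Decay of the one- and two-point functions and of the remainders on closed strips -/

section bounds

variable {ν : Measure ℝ} [IsProbabilityMeasure ν] {M : ℝ} (s v t E : ℝ)

lemma exists_norm_fE_le (hM : ∀ z : ℂ, z.im ≠ 0 → ‖stieltjes ν z‖ ≤ M) (β : ℤˣ) {h : ℝ}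
    (hh : 0 < h) :
    ∃ C, 0 ≤ C ∧ ∀ z : ℂ, h ≤ |z.im| → ‖fE ν s v β E z‖ ≤ C * decay z.re := by
  have hM0 : 0 ≤ M := (norm_nonneg _).trans (hM Complex.I (by simp))
  refine ⟨(1 + (|E| + |s| + v ^ 2 * M)) / h + 1, by positivity, fun z hz => ?_⟩
  have hz0 : z.im ≠ 0 := abs_pos.1 (hh.trans_le hz)
  rw [fE_eq]
  refine norm_inv_le_decay hh (by positivity) ?_ ?_
  · refine le_trans ?_ (Complex.abs_im_le_norm _)
    rw [Complex.sub_im, Complex.ofReal_im, zero_sub, abs_neg, abs_selfArg_im ν s v β hz0]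
    have : 0 ≤ v ^ 2 * |(f ν s v (-β) z).im| := by positivity
    linarith
  · have h1 := Complex.abs_re_le_norm ((E : ℂ) - selfArg ν s v β z)
    rw [Complex.sub_re, Complex.ofReal_re, selfArg_re] at h1
    have h2 : v ^ 2 * |(f ν s v (-β) z).re| ≤ v ^ 2 * M := by
      gcongr
      exact (Complex.abs_re_le_norm _).trans (norm_f_le s v hM (-β) hz0)
    have h3 : |sgn β * s| = |s| := by rw [abs_mul, abs_sgn, one_mul]
    have h4 : z.re = E + sgn β * s - v ^ 2 * (f ν s v (-β) z).re -
      (E - (z.re - sgn β * s + v ^ 2 * (f ν s v (-β) z).re)) := by ring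
    have h5 : |z.re| ≤ |E| + |sgn β * s| + |v ^ 2 * (f ν s v (-β) z).re| +
        |E - (z.re - sgn β * s + v ^ 2 * (f ν s v (-β) z).re)| := by
      conv_lhs => rw [h4]
      refine (abs_sub _ _).trans (add_le_add_left ((abs_sub _ _).trans
        (add_le_add_left (abs_add_le _ _) _)) _)
    rw [abs_mul (v ^ 2), abs_of_nonneg (sq_nonneg v)] at h5
    linarith

/-- In the quotient `f₂_eq` the numerator is at most 2M, and the denominator differs from z₁ - z₂ in
its real part by at most 2|s| + 2v²M. This is the decay in Re(z₁ - z₂) that makes the remainders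
integrable. -/
lemma exists_norm_f₂_le (hM : ∀ z : ℂ, z.im ≠ 0 → ‖stieltjes ν z‖ ≤ M) (β γ : ℤˣ) {h : ℝ}
    (hh : 0 < h) :
    ∃ C, 0 ≤ C ∧ ∀ z₁ z₂ : ℂ, h ≤ z₁.im → h ≤ -z₂.im →
      ‖f₂ ν s v β γ z₁ z₂‖ ≤ C * decay (z₁.re - z₂.re) := by
  have hM0 : 0 ≤ M := (norm_nonneg _).trans (hM Complex.I (by simp))
  refine ⟨2 * M * ((1 + (2 * |s| + 2 * (v ^ 2 * M))) / h + 1), by positivity,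
    fun z₁ z₂ h₁ h₂ => ?_⟩
  have hz₁ : 0 < z₁.im := hh.trans_le h₁
  have hz₂ : z₂.im < 0 := by linarith
  rw [f₂_eq ν s v β γ hz₁ hz₂, div_eq_mul_inv, norm_mul, mul_assoc]
  have e1 : ‖f ν s v β z₁ - f ν s v γ z₂‖ ≤ 2 * M := by
    refine (norm_sub_le _ _).trans ?_
    linarith [norm_f_le s v hM β hz₁.ne', norm_f_le s v hM γ hz₂.ne]
  refine mul_le_mul e1 (norm_inv_le_decay hh (by positivity) ?_ ?_) (norm_nonneg _)
    (by positivity)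
  · refine le_trans ?_ (Complex.abs_im_le_norm _)
    rw [Complex.sub_im]
    refine le_trans ?_ (le_abs_self _)
    linarith [le_selfArg_im ν s v β hz₁, selfArg_im_le ν s v γ hz₂]
  · have h1 := Complex.abs_re_le_norm (selfArg ν s v β z₁ - selfArg ν s v γ z₂)
    rw [Complex.sub_re, selfArg_re, selfArg_re] at h1
    have h2 : ∀ (α : ℤˣ) {z : ℂ}, z.im ≠ 0 → |v ^ 2 * (f ν s v α z).re| ≤ v ^ 2 * M := by
      intro α z hz
      rw [abs_mul, abs_of_nonneg (sq_nonneg v)]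
      gcongr
      exact (Complex.abs_re_le_norm _).trans (norm_f_le s v hM α hz)
    have h3 : ∀ β : ℤˣ, |sgn β * s| = |s| := fun β => by rw [abs_mul, abs_sgn, one_mul]
    have a1 := abs_le.1 (h2 (-β) hz₁.ne')
    have a2 := abs_le.1 (h2 (-γ) hz₂.ne)
    have a3 := abs_le.1 (h3 β).le
    have a4 := abs_le.1 (h3 γ).le
    have a5 := abs_le.1 h1
    rw [abs_le]
    constructor <;> linarith

lemma norm_exp_diff_le {H : ℝ} {z₁ z₂ : ℂ} (ht : 0 ≤ t) (h₁ : z₁.im ≤ H) (h₂ : -z₂.im ≤ H) :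
    ‖Complex.exp (Complex.I * t * (z₂ - z₁))‖ ≤ Real.exp (t * (2 * H)) := by
  rw [norm_exp_I_mul]
  apply Real.exp_le_exp.2
  rw [← mul_neg]
  gcongr
  simp
  linarith

lemma stripBounded_rem₁ (hM : ∀ z : ℂ, z.im ≠ 0 → ‖stieltjes ν z‖ ≤ M) (ht : 0 ≤ t) (α δ : ℤˣ) :
    StripBounded (rem₁ ν s v t E α δ) where
  differentiableAt q hq := differentiableAt_rem₁ s v t E hM α δ hq
  bound h H hh := by
    have hM0 : 0 ≤ M := (norm_nonneg _).trans (hM Complex.I (by simp))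
    obtain ⟨C₁, c₁, hC₁⟩ := exists_norm_fE_le s v E hM α hh
    obtain ⟨C₂, c₂, hC₂⟩ := exists_norm_fE_le s v E hM δ hh
    obtain ⟨C₃, c₃, hC₃⟩ := exists_norm_f₂_le s v hM α δ hh
    obtain ⟨C₄, c₄, hC₄⟩ := exists_norm_f₂_le s v hM (-α) (-δ) hh
    set q := (v ^ 2 * M / (h + v ^ 2 * M)) ^ 2 with hq
    have hq1 : q < 1 := loopBound_lt_one v hM0 hh
    refine ⟨Real.exp (t * (2 * H)) * (C₁ * C₂ * (v ^ 4 * C₃ * C₄ * (1 - q)⁻¹)),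
      fun z₁ z₂ h₁ h₂ h₃ h₄ => ?_⟩
    have a₁ : h ≤ |z₁.im| := h₁.trans (le_abs_self _)
    have a₂ : h ≤ |z₂.im| := h₃.trans (neg_le_abs _)
    have hD : ‖loopTerm ν s v α δ z₁ z₂‖ ≤ v ^ 4 * (C₃ * decay (z₁.re - z₂.re)) * (C₄ * 1) := by
      rw [loopTerm, norm_mul, norm_mul, norm_pow, Complex.norm_real, Real.norm_eq_abs,
        Even.pow_abs (by decide)]
      have := decay_pos (z₁.re - z₂.re)
      gcongr
      · exact hC₃ _ _ h₁ h₃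
      · refine (hC₄ _ _ h₁ h₃).trans ?_
        gcongr
        exact decay_le_one _
    have hinv := norm_inv_one_sub_le hq1 (norm_loopTerm_le s v hM α δ hh a₁ a₂)
    have d₁ := decay_pos z₁.re
    have d₂ := decay_pos z₂.re
    have d₃ := decay_pos (z₁.re - z₂.re)
    have hq2 : 0 < 1 - q := by linarith
    rw [rem₁, norm_mul, norm_mul, norm_mul, norm_mul]
    calc _ ≤ Real.exp (t * (2 * H)) * ((C₁ * decay z₁.re) * (C₂ * decay z₂.re) *
          (v ^ 4 * (C₃ * decay (z₁.re - z₂.re)) * (C₄ * 1) * (1 - q)⁻¹)) := by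
          gcongr
          · exact norm_exp_diff_le t ht h₂ h₄
          · exact hC₁ _ a₁
          · exact hC₂ _ a₂
      _ = _ := by ring

lemma stripBounded_rem₂ (hM : ∀ z : ℂ, z.im ≠ 0 → ‖stieltjes ν z‖ ≤ M) (ht : 0 ≤ t) (α δ : ℤˣ) :
    StripBounded (rem₂ ν s v t E α δ) where
  differentiableAt q hq := differentiableAt_rem₂ s v t E hM α δ hq
  bound h H hh := by
    have hM0 : 0 ≤ M := (norm_nonneg _).trans (hM Complex.I (by simp))
    obtain ⟨C₁, c₁, hC₁⟩ := exists_norm_fE_le s v E hM (-α) hh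
    obtain ⟨C₂, c₂, hC₂⟩ := exists_norm_fE_le s v E hM (-δ) hh
    obtain ⟨C₃, c₃, hC₃⟩ := exists_norm_f₂_le s v hM α δ hh
    set q := (v ^ 2 * M / (h + v ^ 2 * M)) ^ 2 with hq
    have hq1 : q < 1 := loopBound_lt_one v hM0 hh
    refine ⟨Real.exp (t * (2 * H)) * (C₁ * C₂ * (v ^ 2 * C₃ * (1 - q)⁻¹)),
      fun z₁ z₂ h₁ h₂ h₃ h₄ => ?_⟩
    have a₁ : h ≤ |z₁.im| := h₁.trans (le_abs_self _)
    have a₂ : h ≤ |z₂.im| := h₃.trans (neg_le_abs _)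
    have hD : ‖(v : ℂ) ^ 2 * f₂ ν s v α δ z₁ z₂‖ ≤ v ^ 2 * (C₃ * decay (z₁.re - z₂.re)) := by
      rw [norm_mul, norm_pow, Complex.norm_real, Real.norm_eq_abs, sq_abs]
      gcongr
      exact hC₃ _ _ h₁ h₃
    have hinv := norm_inv_one_sub_le hq1 (norm_loopTerm_le s v hM α δ hh a₁ a₂)
    have d₁ := decay_pos z₁.re
    have d₂ := decay_pos z₂.re
    have d₃ := decay_pos (z₁.re - z₂.re)
    have hq2 : 0 < 1 - q := by linarith
    rw [rem₂, norm_mul, norm_mul, norm_mul, norm_mul]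
    calc _ ≤ Real.exp (t * (2 * H)) * ((C₁ * decay z₁.re) * (C₂ * decay z₂.re) *
          (v ^ 2 * (C₃ * decay (z₁.re - z₂.re)) * (1 - q)⁻¹)) := by
          gcongr
          · exact norm_exp_diff_le t ht h₂ h₄
          · exact hC₁ _ a₁
          · exact hC₂ _ a₂
      _ = _ := by ring

end bounds

lemma StripBounded.const_mul_add {R R' : ℂ → ℂ → ℂ} (hR : StripBounded R) (hR' : StripBounded R')
    (c c' : ℂ) : StripBounded fun z₁ z₂ => c * R z₁ z₂ + c' * R' z₁ z₂ where
  differentiableAt q hq :=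
    ((hR.differentiableAt q hq).const_mul c).fun_add ((hR'.differentiableAt q hq).const_mul c')
  bound h H hh := by
    obtain ⟨C, hC⟩ := hR.bound h H hh
    obtain ⟨C', hC'⟩ := hR'.bound h H hh
    refine ⟨‖c‖ * C + ‖c'‖ * C', fun z₁ z₂ h₁ h₂ h₃ h₄ => (norm_add_le _ _).trans ?_⟩
    rw [norm_mul, norm_mul, add_mul, mul_assoc ‖c‖, mul_assoc ‖c'‖]
    exact add_le_add
      (mul_le_mul_of_nonneg_left (hC _ _ h₁ h₂ h₃ h₄) (norm_nonneg _))
      (mul_le_mul_of_nonneg_left (hC' _ _ h₁ h₂ h₃ h₄) (norm_nonneg _))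

/-! ### The line integrals of the two waves -/

section waves

variable {ν : Measure ℝ} [IsProbabilityMeasure ν] {M : ℝ} (s v t E : ℝ)

/-- The limit of the line integral of `e^{-itz} f_α(E, z)` along lines in the upper half-plane. -/
def upAmplitude (ν : Measure ℝ) (s v t E : ℝ) (α : ℤˣ) : ℂ :=
  Complex.exp (-(Complex.I * t * ((E + sgn α * s : ℝ) : ℂ))) * (2 * Real.pi * Complex.I +
    ∫ x, waveCorr (t * v ^ 2) (fun x : ℝ => f ν s v (-α)
      (((E + sgn α * s : ℝ) : ℂ) + v ^ 2 * (x + Complex.I))) x)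

/-- The limit of the line integral of `e^{itz} f_δ(E, z)` along lines in the lower half-plane. -/
def downAmplitude (ν : Measure ℝ) (s v t E : ℝ) (δ : ℤˣ) : ℂ :=
  -(Complex.exp (-(Complex.I * t * ((-(E + sgn δ * s) : ℝ) : ℂ))) * (2 * Real.pi * Complex.I +
    ∫ x, waveCorr (t * v ^ 2) (fun x : ℝ => -f ν s v (-δ)
      (-(((-(E + sgn δ * s) : ℝ) : ℂ) + v ^ 2 * (x + Complex.I)))) x))

lemma tendsto_waveUp (hM : ∀ z : ℂ, z.im ≠ 0 → ‖stieltjes ν z‖ ≤ M) (hv : 0 < v) (ht : 0 < t)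
    (α : ℤˣ) {a : ℝ} (ha : 0 < a) :
    Tendsto (fun N : ℝ => ∫ x in (-N)..N, waveUp ν s v t E α (x + a * Complex.I)) atTop
      (𝓝 (upAmplitude ν s v t E α)) := by
  have h := tendsto_integral_wave (g := f ν s v (-α)) (c := E + sgn α * s) (M := M) hv ht
    (fun z hz => (differentiableAt_f s v (-α) hz.ne').continuousAt)
    (fun z hz => norm_f_le s v hM (-α) hz.ne')
    (fun z hz => (pos_of_mul_pos_left (f_im_mul_pos ν s v (-α) hz.ne') hz.le).le)
  have e : (fun z : ℂ => Complex.exp (-(Complex.I * t * z)) *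
      (((E + sgn α * s : ℝ) : ℂ) - z - v ^ 2 * f ν s v (-α) z)⁻¹) = waveUp ν s v t E α := by
    ext z
    rw [waveUp, fE]
    push_cast
    rfl
  rw [e] at h
  have hv2 : 0 < v ^ 2 := by positivity
  have hmin : 0 < min (v ^ 2) a := lt_min hv2 ha
  obtain ⟨C, hC0, hC⟩ := exists_norm_fE_le s v E hM α hmin
  refine tendsto_line_of_tendsto (b := v ^ 2) (b' := a)
    (C := Real.exp (t * max (v ^ 2) a) * C) (fun z hz => ?_) (fun z hz => ?_) h
  · exact differentiableAt_waveUp ν s v t E α (hmin.trans_le hz.1).ne'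
  · rw [waveUp, norm_mul, mul_assoc (Real.exp _)]
    have := decay_pos z.re
    gcongr
    · rw [show -(Complex.I * t * z) = Complex.I * t * (-z) by ring, norm_exp_I_mul]
      apply Real.exp_le_exp.2
      rw [← mul_neg]
      gcongr
      simpa using hz.2
    · exact hC z (hz.1.trans (le_abs_self _))

lemma tendsto_waveDown (hM : ∀ z : ℂ, z.im ≠ 0 → ‖stieltjes ν z‖ ≤ M) (hv : 0 < v) (ht : 0 < t)
    (δ : ℤˣ) {b : ℝ} (hb : b < 0) :
    Tendsto (fun N : ℝ => ∫ x in (-N)..N, waveDown ν s v t E δ (x + b * Complex.I)) atTop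
      (𝓝 (downAmplitude ν s v t E δ)) := by
  have him : ∀ z : ℂ, 0 < z.im → (-z).im < 0 := fun z hz => by simpa using hz
  -- The reflection z ↦ -z carries the lower half-plane to the upper one, with self-energy -f(-z),
  -- centre -(E + δs) and an overall sign.
  have h := (tendsto_integral_wave (g := fun z => -f ν s v (-δ) (-z)) (c := -(E + sgn δ * s))
    (M := M) hv ht
    (fun z hz => by
      have h1 := (differentiableAt_f (ν := ν) s v (-δ) (him z hz).ne).continuousAt
      exact (ContinuousAt.comp (f := fun z : ℂ => -z) h1 continuousAt_neg).neg)
    (fun z hz => by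
      rw [norm_neg]
      exact norm_f_le s v hM (-δ) (him z hz).ne)
    (fun z hz => by
      have h1 := f_im_mul_pos ν s v (-δ) (him z hz).ne
      rw [Complex.neg_im] at h1
      rw [Complex.neg_im]
      by_contra hcon
      push Not at hcon
      nlinarith)).neg
  have e : ∀ z : ℂ, Complex.exp (-(Complex.I * t * z)) *
      (((-(E + sgn δ * s) : ℝ) : ℂ) - z - v ^ 2 * -f ν s v (-δ) (-z))⁻¹ =
        -waveDown ν s v t E δ (-z) := by
    intro z
    rw [waveDown, fE, ← mul_neg (Complex.exp _), ← inv_neg]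
    push_cast
    congr 2 <;> ring
  simp_rw [e] at h
  have hv2 : 0 < v ^ 2 := by positivity
  have hmin : 0 < min (v ^ 2) (-b) := lt_min hv2 (by linarith)
  obtain ⟨C, hC0, hC⟩ := exists_norm_fE_le s v E hM δ hmin
  have h2 : Tendsto (fun N : ℝ => ∫ x in (-N)..N,
      waveDown ν s v t E δ (x + (-(v ^ 2) : ℝ) * Complex.I)) atTop
      (𝓝 (downAmplitude ν s v t E δ)) := by
    refine h.congr fun N => ?_
    rw [intervalIntegral.integral_neg, neg_neg]
    have := intervalIntegral.integral_comp_neg (a := -N) (b := N)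
      (fun x : ℝ => waveDown ν s v t E δ (x + (-(v ^ 2) : ℝ) * Complex.I))
    rw [neg_neg] at this
    rw [← this]
    congr 1 with x
    congr 1
    push_cast
    ring
  have hle : ∀ z : ℂ, z.im ∈ Set.uIcc (-(v ^ 2)) b → min (v ^ 2) (-b) ≤ -z.im := fun z hz => by
    have := hz.2
    rw [← neg_le_neg_iff] at this
    refine le_trans (le_of_eq ?_) this
    rw [← min_neg_neg, neg_neg]
  refine tendsto_line_of_tendsto (b := -(v ^ 2)) (b' := b)
    (C := Real.exp (t * max (v ^ 2) (-b)) * C) (fun z hz => ?_) (fun z hz => ?_) h2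
  · refine differentiableAt_waveDown ν s v t E δ ?_
    have := hle z hz
    intro h0
    rw [h0] at this
    linarith
  · rw [waveDown, norm_mul, mul_assoc (Real.exp _)]
    have := decay_pos z.re
    gcongr
    · rw [norm_exp_I_mul]
      apply Real.exp_le_exp.2
      rw [← mul_neg]
      gcongr
      have := hz.1
      rw [← neg_le_neg_iff] at this
      refine this.trans (le_of_eq ?_)
      rw [← max_neg_neg, neg_neg]
    · exact hC z ((hle z hz).trans (neg_le_abs _))

end waves

/-! ### Convergence of the formula and its value -/

section formula

variable {ν : Measure ℝ} [IsProbabilityMeasure ν] {M : ℝ} (s v t E : ℝ)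
  (ρ₀ : Matrix ℤˣ ℤˣ ℂ)

/-- The prescribed heights η₁, η₂ disappear: the amplitudes do not depend on the line, and the
remainders may be evaluated on any lines a > 0 > b. The van Hove limit takes a = v², b = -v². -/
lemma formulaConverges_and_value (hM : ∀ z : ℂ, z.im ≠ 0 → ‖stieltjes ν z‖ ≤ M) (hv : 0 < v)
    (ht : 0 < t) (α δ : ℤˣ) {η₁ η₂ : ℝ} (h₁ : 0 < η₁) (h₂ : 0 < η₂) {a b : ℝ} (ha : 0 < a)
    (hb : b < 0) :
    FormulaConverges ν s v ρ₀ E t α δ η₁ η₂ ∧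
      reducedDensity ν s v ρ₀ η₁ η₂ E t α δ = 1 / (2 * Real.pi) ^ 2 *
        (ρ₀ α δ * upAmplitude ν s v t E α * downAmplitude ν s v t E δ +
          (ρ₀ α δ * (∫ y : ℝ, ∫ x : ℝ,
              rem₁ ν s v t E α δ (x + a * Complex.I) (y + b * Complex.I)) +
            ρ₀ (-α) (-δ) * ∫ y : ℝ, ∫ x : ℝ,
              rem₂ ν s v t E α δ (x + a * Complex.I) (y + b * Complex.I))) := by
  have r₁ := stripBounded_rem₁ s v t E hM ht.le α δ
  have r₂ := stripBounded_rem₂ s v t E hM ht.le α δ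
  have hR := r₁.const_mul_add r₂ (ρ₀ α δ) (ρ₀ (-α) (-δ))
  have h₂' : -η₂ < 0 := by linarith
  have key := iterated_lineIntegral (G := integrand ν s v ρ₀ E t α δ)
    (U := fun z => ρ₀ α δ * waveUp ν s v t E α z) (V := waveDown ν s v t E δ)
    (a := η₁) (b := -η₂) h₁ h₂'
    (fun z₁ z₂ hz₁ hz₂ => integrand_eq ν s v t E ρ₀ α δ
      (one_sub_loopTerm_ne_zero s v hM α δ hz₁.ne' hz₂.ne))
    (fun z hz => (differentiableAt_waveUp ν s v t E α hz.ne').const_mul _)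
    (fun z hz => differentiableAt_waveDown ν s v t E δ hz.ne) hR
    (IU := ρ₀ α δ * upAmplitude ν s v t E α) (IV := downAmplitude ν s v t E δ)
    (by
      simp_rw [intervalIntegral.integral_const_mul]
      exact (tendsto_waveUp s v t E hM hv ht α h₁).const_mul _)
    (tendsto_waveDown s v t E hM hv ht δ h₂')
  refine ⟨⟨key.1, key.2.1⟩, ?_⟩
  have hval := key.2.2
  rw [hR.integral_lines_eq h₁ h₂' ha hb] at hval
  rw [reducedDensity]
  unfold innerIntegral
  rw [hval]
  congr 2
  have i₁ := r₁.integrable_lines ha hb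
  have i₂ := r₂.integrable_lines ha hb
  have e := integral_prod_symm _ ((i₁.const_mul (ρ₀ α δ)).add (i₂.const_mul (ρ₀ (-α) (-δ))))
  rw [integral_add' (i₁.const_mul (ρ₀ α δ)) (i₂.const_mul (ρ₀ (-α) (-δ))),
    integral_const_mul, integral_const_mul, integral_prod_symm _ i₁, integral_prod_symm _ i₂] at e
  rw [e]
  rfl

end formula

/-! ### Integrals over the plane -/

lemma integrable_of_decay {F : ℝ × ℝ → ℂ} {C : ℝ} (hF : Continuous F) (hC0 : 0 ≤ C)
    (hC : ∀ q, ‖F q‖ ≤ C * (decay q.1 * decay q.2 * decay (q.1 - q.2))) :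
    Integrable F (volume.prod volume) := by
  refine ((integrable_planeWeight 0).const_mul C).mono' hF.aestronglyMeasurable
    (ae_of_all _ fun q => (hC q).trans ?_)
  gcongr
  exact decay_mul_le_zero q.1 q.2

lemma tendsto_integral_of_decay {ι : Type*} {l : Filter ι} [l.IsCountablyGenerated]
    {F : ι → ℝ × ℝ → ℂ} {F' : ℝ × ℝ → ℂ} {C : ℝ} (hC0 : 0 ≤ C)
    (hF : ∀ᶠ i in l, Continuous (F i))
    (hC : ∀ᶠ i in l, ∀ q, ‖F i q‖ ≤ C * (decay q.1 * decay q.2 * decay (q.1 - q.2)))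
    (hlim : ∀ q, Tendsto (fun i => F i q) l (𝓝 (F' q))) :
    Tendsto (fun i => ∫ q, F i q ∂(volume.prod volume)) l
      (𝓝 (∫ q, F' q ∂(volume.prod volume))) := by
  refine tendsto_integral_filter_of_dominated_convergence (fun q => C * planeWeight 0 q.1 q.2)
    (hF.mono fun i hi => hi.aestronglyMeasurable) ?_ ((integrable_planeWeight 0).const_mul C)
    (ae_of_all _ hlim)
  filter_upwards [hC] with i hi
  refine ae_of_all _ fun q => (hi q).trans ?_
  gcongr
  exact decay_mul_le_zero q.1 q.2

lemma tendsto_integral_zero_of_decay {ι : Type*} {l : Filter ι}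
    {F : ι → ℝ × ℝ → ℂ} {L : ι → ℝ} {C : ℝ} (hC0 : 0 ≤ C)
    (hC : ∀ᶠ i in l, ∀ q, ‖F i q‖ ≤ C * (decay q.1 * decay q.2 * decay (q.1 - q.2 - L i)))
    (hL : Tendsto (fun i => |L i|) l atTop) :
    Tendsto (fun i => ∫ q, F i q ∂(volume.prod volume)) l (𝓝 0) := by
  have h1 : Tendsto (fun i => C * ((1 + |L i|) ^ (-(1 / 6) : ℝ) * (3 * (∫ x, weight x) ^ 2))) l
      (𝓝 0) := by
    have := (tendsto_rpow_neg_atTop (y := 1 / 6) (by norm_num)).comp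
      (tendsto_atTop_add_const_left l 1 hL)
    simpa [Function.comp_def] using (this.mul_const (3 * (∫ x, weight x) ^ 2)).const_mul C
  refine squeeze_zero_norm' ?_ h1
  filter_upwards [hC] with i hi
  rw [← integral_planeWeight (L i), ← integral_const_mul, ← integral_const_mul]
  refine norm_integral_le_of_norm_le (((integrable_planeWeight (L i)).const_mul _).const_mul C)
    (ae_of_all _ fun q => (hi q).trans ?_)
  exact mul_le_mul_of_nonneg_left (decay_mul_le (L i) q.1 q.2) hC0

/-- In the limiting integrands everything except the two resolvents depends on d = x - y only, so
integrating over y first leaves a one-dimensional residue problem. -/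
lemma integral_shear {H : ℝ × ℝ → ℂ} (hH : Integrable H (volume.prod volume)) :
    ∫ q, H q ∂(volume.prod volume) = ∫ d : ℝ, ∫ y : ℝ, H (d + y, y) := by
  have hmp := measurePreserving_add_prod (volume : Measure ℝ) (volume : Measure ℝ)
  have h1 : ∫ q, H q ∂(volume.prod volume) =
      ∫ q : ℝ × ℝ, H (q.1 + q.2, q.2) ∂(volume.prod volume) := by
    rw [← integral_map hmp.measurable.aemeasurable (by rw [hmp.map_eq]; exact hH.1), hmp.map_eq]
  have h2 := (hmp.integrable_comp hH.1).2 hH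
  simp only [Function.comp_def] at h2
  rw [h1, integral_prod _ h2]

/-- The point `c + v² (x + i)`. -/
def upPt (c v x : ℝ) : ℂ := c + v ^ 2 * (x + Complex.I)

/-- The point `c + v² (y - i)`. -/
def lowPt (c v y : ℝ) : ℂ := c + v ^ 2 * (y - Complex.I)

lemma upPt_im (c v x : ℝ) : (upPt c v x).im = v ^ 2 := by
  rw [upPt, ← Complex.ofReal_pow, Complex.add_im, Complex.im_ofReal_mul]
  simp

lemma lowPt_im (c v y : ℝ) : (lowPt c v y).im = -v ^ 2 := by
  rw [lowPt, ← Complex.ofReal_pow, Complex.add_im, Complex.im_ofReal_mul]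
  simp

/-- The substitution x ↦ c₁ + v²x, y ↦ c₂ + v²y has Jacobian v⁴; the centres are free, to be put at
the resonances. -/
lemma StripBounded.integral_lines_eq_scaled {R : ℂ → ℂ → ℂ} (hR : StripBounded R) {v : ℝ}
    (hv : 0 < v) (c₁ c₂ : ℝ) :
    ∫ y : ℝ, ∫ x : ℝ, R (x + (v ^ 2 : ℝ) * Complex.I) (y + (-v ^ 2 : ℝ) * Complex.I) =
      ∫ q : ℝ × ℝ, v ^ 4 * R (upPt c₁ v q.1) (lowPt c₂ v q.2) ∂(volume.prod volume) := by
  have hv2 : 0 < v ^ 2 := by positivity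
  have hint := hR.integrable_lines hv2 (neg_neg_of_pos hv2)
  rw [← integral_prod_symm (fun q : ℝ × ℝ =>
    R (q.1 + (v ^ 2 : ℝ) * Complex.I) (q.2 + (-v ^ 2 : ℝ) * Complex.I)) hint]
  set g : ℝ × ℝ → ℂ := fun q =>
    R (q.1 + (v ^ 2 : ℝ) * Complex.I) (q.2 + (-v ^ 2 : ℝ) * Complex.I) with hg
  have h1 := Measure.integral_comp_smul ((volume : Measure ℝ).prod (volume : Measure ℝ))
    (fun q => g (q + (c₁, c₂))) (v ^ 2)
  rw [integral_add_right_eq_self (μ := (volume : Measure ℝ).prod (volume : Measure ℝ)) g,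
    Module.finrank_prod, Module.finrank_self, abs_of_pos (by positivity), Complex.real_smul] at h1
  rw [integral_const_mul]
  have h2 : ∀ q : ℝ × ℝ, R (upPt c₁ v q.1) (lowPt c₂ v q.2) = g (v ^ 2 • q + (c₁, c₂)) := by
    intro q
    simp only [hg, upPt, lowPt, Prod.fst_add, Prod.snd_add, Prod.smul_fst, Prod.smul_snd,
      smul_eq_mul]
    push_cast
    congr 1 <;> ring
  simp_rw [h2]
  rw [h1]
  have : (v : ℂ) ≠ 0 := by exact_mod_cast hv.ne'
  push_cast
  field_simp

/-! ### Residue evaluation of the limiting integrals -/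

lemma exp_shift (τ d : ℝ) : Complex.exp (-(Complex.I * τ * (d + 2 * Complex.I))) =
    Real.exp (2 * τ) * Complex.exp (-(Complex.I * τ * d)) := by
  rw [Complex.ofReal_exp, ← Complex.exp_add]
  congr 1
  push_cast
  linear_combination -2 * τ * Complex.I_mul_I

lemma two_I_add_im {κ : ℝ} : (2 * Complex.I + Complex.I * κ).im = 2 + κ := by
  simp

lemma ofReal_two_I_ne_zero {κ : ℝ} (hκ : 0 ≤ κ) (d : ℝ) :
    (d : ℂ) + (2 * Complex.I + Complex.I * κ) ≠ 0 :=
  ofReal_add_ne_zero (by rw [two_I_add_im]; linarith) d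

lemma tendsto_pole {τ κ : ℝ} (hτ : 0 < τ) (hκ : 0 ≤ κ) :
    Tendsto (fun N : ℝ => ∫ d in (-N)..N,
      Complex.exp (-(Complex.I * τ * (d + 2 * Complex.I))) *
        ((d : ℂ) + (2 * Complex.I + Complex.I * κ))⁻¹) atTop
      (𝓝 (-(2 * Real.pi * Complex.I) * Real.exp (-(τ * κ)))) := by
  have h := (tendsto_integral_exp_mul_inv (A := 2 * Complex.I + Complex.I * κ)
    (by rw [two_I_add_im]; linarith) hτ).const_mul (Real.exp (2 * τ) : ℂ)
  have e : (Real.exp (2 * τ) : ℂ) * (-(2 * Real.pi * Complex.I) *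
      Complex.exp (Complex.I * τ * (2 * Complex.I + Complex.I * κ))) =
      -(2 * Real.pi * Complex.I) * Real.exp (-(τ * κ)) := by
    rw [mul_left_comm]
    congr 1
    rw [Complex.ofReal_exp, Complex.ofReal_exp, ← Complex.exp_add]
    congr 1
    push_cast
    linear_combination (2 * τ + τ * κ) * Complex.I_mul_I
  rw [e] at h
  refine h.congr fun N => ?_
  rw [← intervalIntegral.integral_const_mul]
  congr 1 with d
  rw [exp_shift]
  ring

lemma integrable_two_poles {κ κ' : ℝ} (hκ : 0 ≤ κ) (hκ' : 0 ≤ κ') (τ : ℝ) :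
    Integrable fun d : ℝ => Complex.exp (-(Complex.I * τ * (d + 2 * Complex.I))) *
      (((d : ℂ) + (2 * Complex.I + Complex.I * κ))⁻¹ *
        ((d : ℂ) + (2 * Complex.I + Complex.I * κ'))⁻¹) := by
  have h := integrable_inv_mul_inv (A := 2 * Complex.I + Complex.I * κ)
    (B := 2 * Complex.I + Complex.I * κ') (by rw [two_I_add_im]; linarith)
    (by rw [two_I_add_im]; linarith)
  refine ((integrable_exp_mul (τ := τ) h).const_mul (Real.exp (2 * τ) : ℂ)).congr
    (ae_of_all _ fun d => ?_)
  simp only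
  rw [exp_shift]
  ring

lemma integral_two_poles {τ κ κ' : ℝ} (hτ : 0 < τ) (hκ : 0 ≤ κ) (hκ' : 0 ≤ κ') (hne : κ ≠ κ') :
    ∫ d : ℝ, Complex.exp (-(Complex.I * τ * (d + 2 * Complex.I))) *
      (((d : ℂ) + (2 * Complex.I + Complex.I * κ))⁻¹ *
        ((d : ℂ) + (2 * Complex.I + Complex.I * κ'))⁻¹) =
      -(2 * Real.pi) * ((Real.exp (-(τ * κ)) - Real.exp (-(τ * κ'))) / (κ' - κ)) := by
  have hsub : ((κ' : ℂ) - κ) ≠ 0 := by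
    rw [sub_ne_zero]
    exact_mod_cast hne.symm
  refine tendsto_nhds_unique (tendsto_integral_line (integrable_two_poles hκ hκ' τ)) ?_
  have h := ((tendsto_pole hτ hκ).sub (tendsto_pole hτ hκ')).const_mul
    (Complex.I * (κ' - κ) : ℂ)⁻¹
  have e : (Complex.I * (κ' - κ) : ℂ)⁻¹ * (-(2 * Real.pi * Complex.I) * Real.exp (-(τ * κ)) -
      -(2 * Real.pi * Complex.I) * Real.exp (-(τ * κ'))) =
      -(2 * Real.pi) * ((Real.exp (-(τ * κ)) - Real.exp (-(τ * κ'))) / (κ' - κ)) := by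
    have := Complex.I_ne_zero
    field_simp
    ring
  rw [e] at h
  refine h.congr fun N => ?_
  have hcont : ∀ {κ : ℝ}, 0 ≤ κ → Continuous fun d : ℝ =>
      Complex.exp (-(Complex.I * τ * (d + 2 * Complex.I))) *
        ((d : ℂ) + (2 * Complex.I + Complex.I * κ))⁻¹ := fun hκ =>
    Continuous.mul (by fun_prop)
      (continuous_inv_ofReal_add (by rw [two_I_add_im]; linarith))
  rw [← intervalIntegral.integral_sub ((hcont hκ).intervalIntegrable _ _)
    ((hcont hκ').intervalIntegrable _ _), ← intervalIntegral.integral_const_mul]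
  congr 1 with d
  rw [inv_mul_inv_eq (ofReal_two_I_ne_zero hκ d) (ofReal_two_I_ne_zero hκ' d)]
  · rw [show (d : ℂ) + (2 * Complex.I + Complex.I * κ') - (d + (2 * Complex.I + Complex.I * κ)) =
      Complex.I * (κ' - κ) by ring]
    ring
  · rw [show (d : ℂ) + (2 * Complex.I + Complex.I * κ') - (d + (2 * Complex.I + Complex.I * κ)) =
      Complex.I * (κ' - κ) by ring]
    exact mul_ne_zero Complex.I_ne_zero hsub

/-- Reduction of the limiting double integral to a single one. -/
lemma integral_wave_pair {τ κ : ℝ} {W W' : ℂ} (hW : 0 ≤ W.im) (hW' : W'.im ≤ 0)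
    (hWW : W - W' = Complex.I * κ) (K : ℝ → ℂ)
    (hint : Integrable (fun q : ℝ × ℝ =>
      Complex.exp (-(Complex.I * τ * (((q.1 - q.2 : ℝ) : ℂ) + 2 * Complex.I))) *
        (((q.1 : ℂ) + Complex.I + W)⁻¹ * ((q.2 : ℂ) - Complex.I + W')⁻¹ * K (q.1 - q.2)))
      (volume.prod volume)) :
    ∫ q : ℝ × ℝ, Complex.exp (-(Complex.I * τ * (((q.1 - q.2 : ℝ) : ℂ) + 2 * Complex.I))) *
        (((q.1 : ℂ) + Complex.I + W)⁻¹ * ((q.2 : ℂ) - Complex.I + W')⁻¹ * K (q.1 - q.2))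
        ∂(volume.prod volume) =
      ∫ d : ℝ, Complex.exp (-(Complex.I * τ * ((d : ℂ) + 2 * Complex.I))) *
        (K d * (2 * Real.pi * Complex.I *
          ((d : ℂ) + (2 * Complex.I + Complex.I * κ))⁻¹)) := by
  rw [integral_shear hint]
  congr 1 with d
  simp only [add_sub_cancel_right]
  rw [integral_const_mul]
  congr 1
  rw [integral_mul_const, mul_comm]
  congr 1
  -- At fixed d = x - y the two resolvents have poles in y on opposite sides of the real axis. Their
  -- residue depends only on A - B = d + 2i + iκ.
  have h := integral_inv_mul_inv (A := d + Complex.I + W) (B := -Complex.I + W')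
    (by simp only [Complex.add_im, Complex.ofReal_im, Complex.I_im]; linarith)
    (by simp only [Complex.add_im, Complex.neg_im, Complex.I_im]; linarith)
  rw [show (d : ℂ) + Complex.I + W - (-Complex.I + W') =
    d + (2 * Complex.I + Complex.I * κ) by linear_combination hWW] at h
  rw [← h]
  congr 1 with y
  push_cast
  congr 2 <;> ring

/-! ### Scaled bounds -/

section scaled

variable {ν : Measure ℝ} [IsProbabilityMeasure ν] {M : ℝ} (s : ℝ) {v : ℝ}

lemma f_upPt_im_nonneg (hv : 0 < v) (β : ℤˣ) (c x : ℝ) : 0 ≤ (f ν s v β (upPt c v x)).im := by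
  have hz : 0 < (upPt c v x).im := by rw [upPt_im]; positivity
  exact (pos_of_mul_pos_left (f_im_mul_pos ν s v β hz.ne') hz.le).le

lemma f_lowPt_im_nonpos (hv : 0 < v) (β : ℤˣ) (c y : ℝ) : (f ν s v β (lowPt c v y)).im ≤ 0 := by
  have hz : (lowPt c v y).im < 0 := by rw [lowPt_im]; simp; positivity
  have h := f_im_mul_pos ν s v β hz.ne
  by_contra hcon
  push Not at hcon
  nlinarith

/-- At the centre c = E + βs the bare terms cancel, so the factor v² exactly compensates the size of
the resolvent. -/
lemma scaled_fE_up (hv : 0 < v) (β : ℤˣ) (E x : ℝ) :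
    (v : ℂ) ^ 2 * fE ν s v β E (upPt (E + sgn β * s) v x) =
      -((x : ℂ) + Complex.I + f ν s v (-β) (upPt (E + sgn β * s) v x))⁻¹ := by
  have hv' : (v : ℂ) ≠ 0 := by exact_mod_cast hv.ne'
  have h := ofReal_add_I_add_ne_zero (f_upPt_im_nonneg (ν := ν) s hv (-β) (E + sgn β * s) x) x
  rw [fE]
  set w := f ν s v (-β) (upPt (E + sgn β * s) v x)
  rw [show (E : ℂ) + sgn β * s - upPt (E + sgn β * s) v x - v ^ 2 * w =
    -(v ^ 2 * ((x : ℂ) + Complex.I + w)) by rw [upPt]; push_cast; ring, inv_neg, mul_inv, mul_neg,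
    mul_inv_cancel_left₀ (pow_ne_zero 2 hv')]

omit [IsProbabilityMeasure ν] in
lemma scaled_fE_low (hv : 0 < v) (γ : ℤˣ) (E y : ℝ) :
    (v : ℂ) ^ 2 * fE ν s v γ E (lowPt (E + sgn γ * s) v y) =
      -((y : ℂ) - Complex.I + f ν s v (-γ) (lowPt (E + sgn γ * s) v y))⁻¹ := by
  have hv' : (v : ℂ) ≠ 0 := by exact_mod_cast hv.ne'
  rw [fE]
  set w := f ν s v (-γ) (lowPt (E + sgn γ * s) v y)
  rw [show (E : ℂ) + sgn γ * s - lowPt (E + sgn γ * s) v y - v ^ 2 * w =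
    -(v ^ 2 * ((y : ℂ) - Complex.I + w)) by rw [lowPt]; push_cast; ring, inv_neg, mul_inv, mul_neg,
    mul_inv_cancel_left₀ (pow_ne_zero 2 hv')]

lemma one_le_abs_im_neg_I_add {w : ℂ} (hw : w.im ≤ 0) : 1 ≤ |(-Complex.I + w).im| := by
  rw [Complex.add_im, Complex.neg_im, Complex.I_im]
  exact (by linarith : (1 : ℝ) ≤ -(-1 + w.im)).trans (neg_le_abs _)

lemma norm_scaled_fE_up_le (hM : ∀ z : ℂ, z.im ≠ 0 → ‖stieltjes ν z‖ ≤ M) (hv : 0 < v) (β : ℤˣ)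
    (E x : ℝ) : ‖(v : ℂ) ^ 2 * fE ν s v β E (upPt (E + sgn β * s) v x)‖ ≤ (3 + M) * decay x := by
  rw [scaled_fE_up s hv, norm_neg]
  exact norm_inv_add_add_le (by simp)
    (norm_f_le s v hM _ (by rw [upPt_im]; positivity))
    (one_le_abs_im_I_add (f_upPt_im_nonneg s hv _ _ _)) x

lemma norm_scaled_fE_low_le (hM : ∀ z : ℂ, z.im ≠ 0 → ‖stieltjes ν z‖ ≤ M) (hv : 0 < v) (γ : ℤˣ)
    (E y : ℝ) : ‖(v : ℂ) ^ 2 * fE ν s v γ E (lowPt (E + sgn γ * s) v y)‖ ≤ (3 + M) * decay y := by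
  rw [scaled_fE_low s hv, norm_neg, sub_eq_add_neg]
  exact norm_inv_add_add_le (by simp)
    (norm_f_le s v hM _ (by rw [lowPt_im]; simp; positivity))
    (one_le_abs_im_neg_I_add (f_lowPt_im_nonpos s hv _ _ _)) y

/-- The offset (c₁ - c₂ - (β-γ)s)/v² measures the distance from resonance. It vanishes when β = γ
and c₁ = c₂, and otherwise may diverge as v → 0. -/
lemma scaled_f₂ (hv : 0 < v) (β γ : ℤˣ) (c₁ c₂ x y : ℝ) :
    (v : ℂ) ^ 2 * f₂ ν s v β γ (upPt c₁ v x) (lowPt c₂ v y) =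
      (f ν s v β (upPt c₁ v x) - f ν s v γ (lowPt c₂ v y)) *
        (((x - y + (c₁ - c₂ - (sgn β - sgn γ) * s) / v ^ 2 : ℝ) : ℂ) + (2 * Complex.I +
          (f ν s v (-β) (upPt c₁ v x) - f ν s v (-γ) (lowPt c₂ v y))))⁻¹ := by
  have hv' : (v : ℂ) ≠ 0 := by exact_mod_cast hv.ne'
  rw [f₂_eq ν s v β γ (by rw [upPt_im]; positivity) (by rw [lowPt_im]; simp; positivity),
    selfArg, selfArg, shiftArg, shiftArg]
  set w₁ := f ν s v (-β) (upPt c₁ v x)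
  set w₂ := f ν s v (-γ) (lowPt c₂ v y)
  rw [show upPt c₁ v x - sgn β * s + v ^ 2 * w₁ - (lowPt c₂ v y - sgn γ * s + v ^ 2 * w₂) =
    v ^ 2 * (((x - y + (c₁ - c₂ - (sgn β - sgn γ) * s) / v ^ 2 : ℝ) : ℂ) +
      (2 * Complex.I + (w₁ - w₂))) by
    rw [upPt, lowPt]; push_cast; field_simp; ring]
  rw [div_eq_mul_inv, mul_inv, ← mul_assoc, mul_left_comm, mul_assoc,
    inv_mul_cancel_left₀ (pow_ne_zero 2 hv')]

lemma norm_scaled_f₂_le (hM : ∀ z : ℂ, z.im ≠ 0 → ‖stieltjes ν z‖ ≤ M) (hv : 0 < v) (β γ : ℤˣ)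
    (c₁ c₂ x y : ℝ) :
    ‖(v : ℂ) ^ 2 * f₂ ν s v β γ (upPt c₁ v x) (lowPt c₂ v y)‖ ≤ 2 * M * (4 + 2 * M) *
      decay (x - y + (c₁ - c₂ - (sgn β - sgn γ) * s) / v ^ 2) := by
  have hu : (upPt c₁ v x).im ≠ 0 := by rw [upPt_im]; positivity
  have hl : (lowPt c₂ v y).im ≠ 0 := by rw [lowPt_im]; simp; positivity
  have hM0 : 0 ≤ M := (norm_nonneg _).trans (hM _ hu)
  have hsub : ∀ β γ, ‖f ν s v β (upPt c₁ v x) - f ν s v γ (lowPt c₂ v y)‖ ≤ 2 * M := fun β γ => by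
    refine (norm_sub_le _ _).trans ?_
    linarith [norm_f_le s v hM β hu, norm_f_le s v hM γ hl]
  rw [scaled_f₂ s hv, norm_mul, mul_assoc]
  refine mul_le_mul (hsub β γ) ?_ (norm_nonneg _) (by positivity)
  set X := x - y + (c₁ - c₂ - (sgn β - sgn γ) * s) / v ^ 2
  have h1 := f_upPt_im_nonneg (ν := ν) s hv (-β) c₁ x
  have h2 := f_lowPt_im_nonpos (ν := ν) s hv (-γ) c₂ y
  set w := f ν s v (-β) (upPt c₁ v x) - f ν s v (-γ) (lowPt c₂ v y) with hw
  have hwim : 0 ≤ w.im := by rw [hw, Complex.sub_im]; linarith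
  have h3 := norm_inv_le_decay (w := (X : ℂ) + (2 * Complex.I + w)) (x := X) (h := 1)
    (K := 2 + 2 * M) one_pos (by positivity) ?_ ?_
  · refine h3.trans (le_of_eq ?_)
    congr 1
    ring
  · refine le_trans ?_ (Complex.abs_im_le_norm _)
    refine le_trans ?_ (le_abs_self _)
    simp
    linarith
  · have h4 := norm_sub_le ((X : ℂ) + (2 * Complex.I + w)) (2 * Complex.I + w)
    rw [add_sub_cancel_right, Complex.norm_real] at h4
    have h5 := norm_add_le (2 * Complex.I) w
    have h6 : ‖2 * Complex.I‖ = 2 := by simp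
    have h7 := hsub (-β) (-γ)
    have h8 : |X| = ‖X‖ := rfl
    linarith

/-- At height exactly v² the bound v²M/(v² + v²M) equals M/(1+M), free of v. This is why the lines
are moved to ±v². -/
lemma norm_inv_one_sub_loopTerm_scaled_le (hM : ∀ z : ℂ, z.im ≠ 0 → ‖stieltjes ν z‖ ≤ M)
    (hv : 0 < v) (α δ : ℤˣ) (c₁ c₂ x y : ℝ) :
    ‖(1 - loopTerm ν s v α δ (upPt c₁ v x) (lowPt c₂ v y))⁻¹‖ ≤ (1 - (M / (1 + M)) ^ 2)⁻¹ := by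
  have hv2 : 0 < v ^ 2 := by positivity
  have hM0 : 0 ≤ M := (norm_nonneg _).trans (hM Complex.I (by simp))
  have h := norm_loopTerm_le s v hM α δ hv2 (z₁ := upPt c₁ v x) (z₂ := lowPt c₂ v y)
    (by rw [upPt_im]; exact le_abs_self _) (by rw [lowPt_im, abs_neg]; exact le_abs_self _)
  have h1 := loopBound_lt_one v hM0 hv2
  have e : v ^ 2 * M / (v ^ 2 + v ^ 2 * M) = M / (1 + M) := by field_simp
  rw [e] at h h1
  exact norm_inv_one_sub_le h1 h

lemma loopConst_pos (hM0 : 0 ≤ M) : 0 < (1 - (M / (1 + M)) ^ 2)⁻¹ := by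
  have : M / (1 + M) < 1 := by
    rw [div_lt_one (by positivity)]
    linarith
  have : (M / (1 + M)) ^ 2 < 1 := pow_lt_one₀ (by positivity) this two_ne_zero
  exact inv_pos.2 (by linarith)

lemma exp_scaled (τ : ℝ) (hv : 0 < v) (c₁ c₂ x y : ℝ) :
    Complex.exp (Complex.I * (τ / v ^ 2 : ℝ) * (lowPt c₂ v y - upPt c₁ v x)) =
      Complex.exp (Complex.I * ((τ / v ^ 2 * (c₂ - c₁) : ℝ) : ℂ)) *
        Complex.exp (-(Complex.I * τ * (((x - y : ℝ) : ℂ) + 2 * Complex.I))) := by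
  have hv' : (v : ℂ) ≠ 0 := by exact_mod_cast hv.ne'
  rw [← Complex.exp_add, upPt, lowPt]
  congr 1
  push_cast
  field_simp
  ring

lemma norm_exp_phase (r : ℝ) : ‖Complex.exp (Complex.I * (r : ℂ))‖ = 1 := by
  rw [mul_comm, Complex.norm_exp_ofReal_mul_I]

lemma norm_exp_scaled (τ : ℝ) (hv : 0 < v) (c₁ c₂ x y : ℝ) :
    ‖Complex.exp (Complex.I * (τ / v ^ 2 : ℝ) * (lowPt c₂ v y - upPt c₁ v x))‖ =
      Real.exp (2 * τ) := by
  rw [exp_scaled τ hv, norm_mul, norm_exp_phase, exp_shift, norm_mul, norm_exp_neg_I_mul_ofReal,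
    Complex.norm_real, Real.norm_of_nonneg (Real.exp_pos _).le, one_mul, mul_one]

omit [IsProbabilityMeasure ν] in
lemma loopTerm_scaled (α δ : ℤˣ) (z₁ z₂ : ℂ) :
    loopTerm ν s v α δ z₁ z₂ =
      ((v : ℂ) ^ 2 * f₂ ν s v α δ z₁ z₂) * ((v : ℂ) ^ 2 * f₂ ν s v (-α) (-δ) z₁ z₂) := by
  rw [loopTerm]
  ring

omit [IsProbabilityMeasure ν] in
lemma scaled_rem₁ (t E : ℝ) (α δ : ℤˣ) (z₁ z₂ : ℂ) :
    (v : ℂ) ^ 4 * rem₁ ν s v t E α δ z₁ z₂ = Complex.exp (Complex.I * t * (z₂ - z₁)) *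
      ((v ^ 2 * fE ν s v α E z₁) * (v ^ 2 * fE ν s v δ E z₂) *
        (loopTerm ν s v α δ z₁ z₂ * (1 - loopTerm ν s v α δ z₁ z₂)⁻¹)) := by
  rw [rem₁]
  ring

omit [IsProbabilityMeasure ν] in
lemma scaled_rem₂ (t E : ℝ) (α δ : ℤˣ) (z₁ z₂ : ℂ) :
    (v : ℂ) ^ 4 * rem₂ ν s v t E α δ z₁ z₂ = Complex.exp (Complex.I * t * (z₂ - z₁)) *
      ((v ^ 2 * fE ν s v (-α) E z₁) * (v ^ 2 * fE ν s v (-δ) E z₂) *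
        (v ^ 2 * f₂ ν s v α δ z₁ z₂ * (1 - loopTerm ν s v α δ z₁ z₂)⁻¹)) := by
  rw [rem₂]
  ring

/-- A constant bounding the scaled remainders. -/
def remConst (M τ : ℝ) : ℝ :=
  Real.exp (2 * τ) * ((3 + M) * (3 + M) *
    ((1 + 2 * M * (4 + 2 * M)) * (2 * M * (4 + 2 * M)) * (1 - (M / (1 + M)) ^ 2)⁻¹))

lemma remConst_nonneg (hM0 : 0 ≤ M) (τ : ℝ) : 0 ≤ remConst M τ := by
  have := loopConst_pos hM0
  unfold remConst
  positivity

lemma norm_mul_mul_mul_mul_le {e a b c d : ℂ} {E A B C D : ℝ} (he : ‖e‖ = E) (ha : ‖a‖ ≤ A)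
    (hb : ‖b‖ ≤ B) (hc : ‖c‖ ≤ C) (hd : ‖d‖ ≤ D) :
    ‖e * (a * b * (c * d))‖ ≤ E * (A * B * (C * D)) := by
  have hE := he ▸ norm_nonneg e
  have hA := (norm_nonneg a).trans ha
  have hC := (norm_nonneg c).trans hc
  have hB := (norm_nonneg b).trans hb
  rw [norm_mul, norm_mul, norm_mul, norm_mul, he]
  gcongr

/-- Centred at E + αs and E + δs, f_{α,δ} is at zero offset and supplies decay(x - y), hence a
dominating function independent of v. The second two-point function is displaced by 2(α-δ)s/v² and
supplies an extra factor that vanishes pointwise off the diagonal. -/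
lemma norm_scaled_rem₁_le (hM : ∀ z : ℂ, z.im ≠ 0 → ‖stieltjes ν z‖ ≤ M) (hv : 0 < v) (τ E : ℝ)
    (α δ : ℤˣ) (x y : ℝ) :
    ‖(v : ℂ) ^ 4 * rem₁ ν s v (τ / v ^ 2) E α δ (upPt (E + sgn α * s) v x)
        (lowPt (E + sgn δ * s) v y)‖ ≤
      remConst M τ * (decay x * decay y * decay (x - y)) *
        decay (x - y + 2 * (sgn α - sgn δ) * s / v ^ 2) := by
  have hM0 : 0 ≤ M := (norm_nonneg _).trans (hM Complex.I (by simp))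
  have hL := loopConst_pos hM0
  have k := norm_scaled_f₂_le s hM hv α δ (E + sgn α * s) (E + sgn δ * s) x y
  have k' := norm_scaled_f₂_le s hM hv (-α) (-δ) (E + sgn α * s) (E + sgn δ * s) x y
  rw [show x - y + (E + sgn α * s - (E + sgn δ * s) - (sgn α - sgn δ) * s) / v ^ 2 = x - y by
    ring] at k
  rw [show x - y + (E + sgn α * s - (E + sgn δ * s) - (sgn (-α) - sgn (-δ)) * s) / v ^ 2 =
    x - y + 2 * (sgn α - sgn δ) * s / v ^ 2 by rw [sgn_neg, sgn_neg]; ring] at k'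
  have dx := decay_pos x
  have dy := decay_pos y
  have dd := decay_pos (x - y)
  have dl := decay_pos (x - y + 2 * (sgn α - sgn δ) * s / v ^ 2)
  rw [scaled_rem₁]
  have u := norm_scaled_fE_up_le s hM hv α E x
  have w := norm_scaled_fE_low_le s hM hv δ E y
  have i := norm_inv_one_sub_loopTerm_scaled_le s hM hv α δ (E + sgn α * s) (E + sgn δ * s) x y
  calc _ ≤ Real.exp (2 * τ) * (((3 + M) * decay x) * ((3 + M) * decay y) *
        ((2 * M * (4 + 2 * M) * decay (x - y)) *
          (2 * M * (4 + 2 * M) * decay (x - y + 2 * (sgn α - sgn δ) * s / v ^ 2)) *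
            (1 - (M / (1 + M)) ^ 2)⁻¹)) := by
        refine norm_mul_mul_mul_mul_le (norm_exp_scaled τ hv _ _ _ _) u w ?_ i
        rw [loopTerm_scaled, norm_mul]
        gcongr
    _ ≤ Real.exp (2 * τ) * (((3 + M) * decay x) * ((3 + M) * decay y) *
        ((2 * M * (4 + 2 * M) * decay (x - y)) *
          ((1 + 2 * M * (4 + 2 * M)) * decay (x - y + 2 * (sgn α - sgn δ) * s / v ^ 2)) *
            (1 - (M / (1 + M)) ^ 2)⁻¹)) := by
        gcongr
        linarith
    _ = _ := by rw [remConst]; ring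

/-- The resolvents are now centred at E - αs and E - δs, so f_{α,δ} itself is displaced. Off the
diagonal the dominating function travels with v and must be integrated with its shift. -/
lemma norm_scaled_rem₂_le (hM : ∀ z : ℂ, z.im ≠ 0 → ‖stieltjes ν z‖ ≤ M) (hv : 0 < v) (τ E : ℝ)
    (α δ : ℤˣ) (x y : ℝ) :
    ‖(v : ℂ) ^ 4 * rem₂ ν s v (τ / v ^ 2) E α δ (upPt (E + sgn (-α) * s) v x)
        (lowPt (E + sgn (-δ) * s) v y)‖ ≤
      remConst M τ * (decay x * decay y * decay (x - y - 2 * (sgn α - sgn δ) * s / v ^ 2)) := by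
  have hM0 : 0 ≤ M := (norm_nonneg _).trans (hM Complex.I (by simp))
  have hL := loopConst_pos hM0
  have k := norm_scaled_f₂_le s hM hv α δ (E + sgn (-α) * s) (E + sgn (-δ) * s) x y
  rw [show x - y + (E + sgn (-α) * s - (E + sgn (-δ) * s) - (sgn α - sgn δ) * s) / v ^ 2 =
    x - y - 2 * (sgn α - sgn δ) * s / v ^ 2 by rw [sgn_neg, sgn_neg]; ring] at k
  have dx := decay_pos x
  have dy := decay_pos y
  have dl := decay_pos (x - y - 2 * (sgn α - sgn δ) * s / v ^ 2)
  rw [scaled_rem₂]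
  have u := norm_scaled_fE_up_le s hM hv (-α) E x
  have w := norm_scaled_fE_low_le s hM hv (-δ) E y
  have i := norm_inv_one_sub_loopTerm_scaled_le s hM hv α δ (E + sgn (-α) * s)
    (E + sgn (-δ) * s) x y
  calc _ ≤ Real.exp (2 * τ) * (((3 + M) * decay x) * ((3 + M) * decay y) *
        ((2 * M * (4 + 2 * M) * decay (x - y - 2 * (sgn α - sgn δ) * s / v ^ 2)) *
            (1 - (M / (1 + M)) ^ 2)⁻¹)) :=
        norm_mul_mul_mul_mul_le (norm_exp_scaled τ hv _ _ _ _) u w k i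
    -- A factor at least 1 is inserted so that one constant serves both remainders.
    _ ≤ Real.exp (2 * τ) * (((3 + M) * decay x) * ((3 + M) * decay y) *
        (((1 + 2 * M * (4 + 2 * M)) *
          (2 * M * (4 + 2 * M) * decay (x - y - 2 * (sgn α - sgn δ) * s / v ^ 2))) *
            (1 - (M / (1 + M)) ^ 2)⁻¹)) := by
        gcongr Real.exp _ * (_ * (?_ * _))
        have h2 : 0 ≤ 2 * M * (4 + 2 * M) := by positivity
        exact le_mul_of_one_le_left (by positivity) (by linarith)
    _ = _ := by rw [remConst]; ring

lemma StripBounded.continuous_scaled {R : ℂ → ℂ → ℂ} (hR : StripBounded R) (hv : 0 < v)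
    (c₁ c₂ : ℝ) :
    Continuous fun q : ℝ × ℝ => (v : ℂ) ^ 4 * R (upPt c₁ v q.1) (lowPt c₂ v q.2) := by
  rw [continuous_iff_continuousAt]
  intro q
  have h1 := (hR.differentiableAt (upPt c₁ v q.1, lowPt c₂ v q.2)
    ⟨by rw [upPt_im]; positivity, by rw [lowPt_im]; simp; positivity⟩).continuousAt
  have h2 : Continuous fun q : ℝ × ℝ => (upPt c₁ v q.1, lowPt c₂ v q.2) := by
    unfold upPt lowPt
    fun_prop
  exact (ContinuousAt.comp (f := fun q : ℝ × ℝ => (upPt c₁ v q.1, lowPt c₂ v q.2))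
    (g := fun q : ℂ × ℂ => R q.1 q.2) h1 h2.continuousAt).const_mul _

end scaled

/-! ### Scaled limits -/

section limits

open scoped ComplexConjugate

variable {ν : Measure ℝ} [IsProbabilityMeasure ν] {p : ℝ → ℝ} (s : ℝ)

lemma tendsto_selfArg_of_tendsto {M : ℝ} (hM : ∀ z : ℂ, z.im ≠ 0 → ‖stieltjes ν z‖ ≤ M) (β : ℤˣ)
    {g : ℝ → ℂ} {c : ℝ} (hg : Tendsto g (𝓝[>] 0) (𝓝 c)) (him : ∀ v, 0 < v → (g v).im ≠ 0) :
    Tendsto (fun v => selfArg ν s v β (g v)) (𝓝[>] 0) (𝓝 ((c - sgn β * s : ℝ) : ℂ)) := by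
  have hv2 : Tendsto (fun v : ℝ => v ^ 2 * M) (𝓝[>] 0) (𝓝 0) := by
    have : Continuous fun v : ℝ => v ^ 2 * M := by fun_prop
    simpa using this.continuousAt.tendsto.mono_left (nhdsWithin_le_nhds (a := (0 : ℝ)))
  have h1 : Tendsto (fun v : ℝ => (v : ℂ) ^ 2 * f ν s v (-β) (g v)) (𝓝[>] 0) (𝓝 0) := by
    refine squeeze_zero_norm' ?_ hv2
    filter_upwards [self_mem_nhdsWithin] with v hv
    rw [norm_mul, norm_pow, Complex.norm_real, Real.norm_eq_abs, sq_abs]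
    gcongr
    exact norm_f_le s v hM (-β) (him v hv)
  have h2 := (hg.sub_const (sgn β * s : ℂ)).add h1
  rw [add_zero] at h2
  push_cast
  exact h2

lemma tendsto_upPt (c x : ℝ) : Tendsto (fun v => upPt c v x) (𝓝[>] 0) (𝓝 c) := by
  have : Continuous fun v : ℝ => upPt c v x := by unfold upPt; fun_prop
  have h := this.continuousAt.tendsto.mono_left (nhdsWithin_le_nhds (a := (0 : ℝ)) (s := Set.Ioi 0))
  simpa [upPt] using h

lemma tendsto_lowPt (c y : ℝ) : Tendsto (fun v => lowPt c v y) (𝓝[>] 0) (𝓝 c) := by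
  have : Continuous fun v : ℝ => lowPt c v y := by unfold lowPt; fun_prop
  have h := this.continuousAt.tendsto.mono_left (nhdsWithin_le_nhds (a := (0 : ℝ)) (s := Set.Ioi 0))
  simpa [lowPt] using h

variable (hp : Integrable p) (hh : Integrable (fourierHat p)) (hS : ∀ z, stieltjes ν z = f₀ p z)
include hp hh hS

omit [IsProbabilityMeasure ν] in
lemma norm_stieltjes_le_hatNorm : ∀ z : ℂ, z.im ≠ 0 → ‖stieltjes ν z‖ ≤ hatNorm p := fun z hz => by
  rw [hS]
  exact norm_f₀_le hp hh hz

/-- Since v² f is at most v²M in norm, the shifted point tends to c - βs, and it stays in the upper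
half-plane. Boundary values along arbitrary approach then give the limit, independently of the
scaled variable x. -/
lemma tendsto_f_up (β : ℤˣ) (c x : ℝ) :
    Tendsto (fun v => f ν s v β (upPt c v x)) (𝓝[>] 0)
      (𝓝 (upperTransform p ((c - sgn β * s : ℝ) : ℂ))) := by
  have hM := norm_stieltjes_le_hatNorm hp hh hS
  have him : ∀ v, 0 < v → 0 < (upPt c v x).im := fun v hv => by rw [upPt_im]; positivity
  have h := tendsto_f₀_upper hp hh (tendsto_selfArg_of_tendsto s hM β (tendsto_upPt c x)
    fun v hv => (him v hv).ne') (by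
      filter_upwards [self_mem_nhdsWithin] with v hv
      exact (him v hv).trans_le (le_selfArg_im ν s v β (him v hv)))
  refine h.congr' ?_
  filter_upwards [self_mem_nhdsWithin] with v hv
  rw [f_eq ν s v β (him v hv).ne', hS]

lemma tendsto_f_low (β : ℤˣ) (c y : ℝ) :
    Tendsto (fun v => f ν s v β (lowPt c v y)) (𝓝[>] 0)
      (𝓝 (conj (upperTransform p ((c - sgn β * s : ℝ) : ℂ)))) := by
  have hM := norm_stieltjes_le_hatNorm hp hh hS
  have him : ∀ v, 0 < v → (lowPt c v y).im < 0 := fun v hv => by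
    rw [lowPt_im]
    have : 0 < v ^ 2 := by positivity
    linarith
  have h := tendsto_f₀_lower hp hh (tendsto_selfArg_of_tendsto s hM β (tendsto_lowPt c y)
    fun v hv => (him v hv).ne) (by
      filter_upwards [self_mem_nhdsWithin] with v hv
      exact (selfArg_im_le ν s v β (him v hv)).trans_lt (him v hv))
  refine h.congr' ?_
  filter_upwards [self_mem_nhdsWithin] with v hv
  rw [f_eq ν s v β (him v hv).ne, hS]

variable (hc : Continuous p) (hn : ∀ x, 0 ≤ p x)
include hc hn

lemma tendsto_scaled_fE_up (β : ℤˣ) (E x : ℝ) :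
    Tendsto (fun v : ℝ => (v : ℂ) ^ 2 * fE ν s v β E (upPt (E + sgn β * s) v x)) (𝓝[>] 0)
      (𝓝 (-((x : ℂ) + Complex.I + upperTransform p ((E + 2 * sgn β * s : ℝ) : ℂ))⁻¹)) := by
  have h := tendsto_f_up s hp hh hS (-β) (E + sgn β * s) x
  rw [show E + sgn β * s - sgn (-β) * s = E + 2 * sgn β * s by rw [sgn_neg]; ring] at h
  refine (((h.const_add ((x : ℂ) + Complex.I)).inv₀ (ofReal_add_I_add_ne_zero
    (upperTransform_im_nonneg hc hn hp hh _) x)).neg).congr' ?_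
  filter_upwards [self_mem_nhdsWithin] with v hv
  rw [scaled_fE_up s hv]

lemma tendsto_scaled_fE_low (γ : ℤˣ) (E y : ℝ) :
    Tendsto (fun v : ℝ => (v : ℂ) ^ 2 * fE ν s v γ E (lowPt (E + sgn γ * s) v y)) (𝓝[>] 0)
      (𝓝 (-((y : ℂ) - Complex.I +
        conj (upperTransform p ((E + 2 * sgn γ * s : ℝ) : ℂ)))⁻¹)) := by
  have h := tendsto_f_low s hp hh hS (-γ) (E + sgn γ * s) y
  rw [show E + sgn γ * s - sgn (-γ) * s = E + 2 * sgn γ * s by rw [sgn_neg]; ring] at h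
  have hne : (y : ℂ) - Complex.I + conj (upperTransform p ((E + 2 * sgn γ * s : ℝ) : ℂ)) ≠ 0 := by
    rw [sub_eq_add_neg, add_assoc]
    refine ofReal_add_ne_zero (abs_pos.1 (one_pos.trans_le (one_le_abs_im_neg_I_add ?_))) y
    have := upperTransform_im_nonneg hc hn hp hh (E + 2 * sgn γ * s)
    rw [Complex.conj_im]
    linarith
  refine (((h.const_add ((y : ℂ) - Complex.I)).inv₀ hne).neg).congr' ?_
  filter_upwards [self_mem_nhdsWithin] with v hv
  rw [scaled_fE_low s hv]

/-- The scaled diagonal two-point function at a resonance. -/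
lemma tendsto_scaled_f₂ (β : ℤˣ) (c x y : ℝ) :
    Tendsto (fun v : ℝ => (v : ℂ) ^ 2 * f₂ ν s v β β (upPt c v x) (lowPt c v y)) (𝓝[>] 0)
      (𝓝 (Complex.I * (2 * Real.pi * p (c - sgn β * s) : ℝ) *
        (((x - y : ℝ) : ℂ) + (2 * Complex.I +
          Complex.I * (2 * Real.pi * p (c + sgn β * s) : ℝ)))⁻¹)) := by
  have hj : ∀ r : ℝ, upperTransform p (r : ℂ) - conj (upperTransform p (r : ℂ)) =
      Complex.I * (2 * Real.pi * p r : ℝ) := fun r => by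
    rw [upperTransform_sub_conj hc hp hh]
    push_cast
    ring
  have h1 := (tendsto_f_up s hp hh hS β c x).sub (tendsto_f_low s hp hh hS β c y)
  have h2 := (tendsto_f_up s hp hh hS (-β) c x).sub (tendsto_f_low s hp hh hS (-β) c y)
  rw [hj] at h1 h2
  rw [show c - sgn (-β) * s = c + sgn β * s by rw [sgn_neg]; ring] at h2
  refine (h1.mul (((h2.const_add (2 * Complex.I)).const_add ((x - y : ℝ) : ℂ)).inv₀
    (ofReal_two_I_ne_zero (mul_nonneg (by positivity) (hn _)) _))).congr' ?_
  filter_upwards [self_mem_nhdsWithin] with v hv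
  rw [scaled_f₂ s hv]
  simp

end limits

/-! ### The limiting kernels -/

/-- The limit of the scaled two-point function at a resonance. -/
def poleTerm (a b d : ℝ) : ℂ := Complex.I * a * ((d : ℂ) + (2 * Complex.I + Complex.I * b))⁻¹

section kernels

variable {a b τ : ℝ}

lemma continuous_poleTerm (hb : 0 ≤ b) : Continuous (poleTerm a b) := by
  unfold poleTerm
  exact continuous_const.mul (Continuous.inv₀ (by fun_prop) (ofReal_two_I_ne_zero hb))

lemma ofReal_add_two_I_ne_zero (d : ℝ) : (d : ℂ) + 2 * Complex.I ≠ 0 := by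
  simpa using ofReal_two_I_ne_zero le_rfl d

/-- With Z = d + 2i, (Z+ia)(Z+ib) + ab = Z(Z + i(a+b)): the constant terms cancel. The root Z = 0
produces the non-decaying part and Z = -i(a+b) the exponential with the total rate. -/
lemma one_sub_poleTerm_mul (ha : 0 ≤ a) (hb : 0 ≤ b) (d : ℝ) :
    1 - poleTerm a b d * poleTerm b a d =
      ((d : ℂ) + 2 * Complex.I) * (d + (2 * Complex.I + Complex.I * (a + b : ℝ))) *
        (((d : ℂ) + (2 * Complex.I + Complex.I * a))⁻¹ *
          ((d : ℂ) + (2 * Complex.I + Complex.I * b))⁻¹) := by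
  have h1 := ofReal_two_I_ne_zero ha d
  have h2 := ofReal_two_I_ne_zero hb d
  rw [poleTerm, poleTerm]
  set A := (d : ℂ) + (2 * Complex.I + Complex.I * a) with hA
  set B := (d : ℂ) + (2 * Complex.I + Complex.I * b) with hB
  have e : A * B + a * b = ((d : ℂ) + 2 * Complex.I) *
      (d + (2 * Complex.I + Complex.I * (a + b : ℝ))) := by
    rw [hA, hB]
    push_cast
    linear_combination (a * b : ℂ) * Complex.I_mul_I
  rw [← e]
  field_simp
  linear_combination -(a * b : ℂ) * Complex.I_sq

lemma one_sub_poleTerm_mul_ne_zero (ha : 0 ≤ a) (hb : 0 ≤ b) (d : ℝ) :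
    1 - poleTerm a b d * poleTerm b a d ≠ 0 := by
  rw [one_sub_poleTerm_mul ha hb]
  exact mul_ne_zero (mul_ne_zero (ofReal_add_two_I_ne_zero d)
    (ofReal_two_I_ne_zero (add_nonneg ha hb) d)) (mul_ne_zero
      (inv_ne_zero (ofReal_two_I_ne_zero ha d)) (inv_ne_zero (ofReal_two_I_ne_zero hb d)))

lemma continuous_inv_one_sub_poleTerm_mul (ha : 0 ≤ a) (hb : 0 ≤ b) :
    Continuous fun d => (1 - poleTerm a b d * poleTerm b a d)⁻¹ :=
  (continuous_const.sub ((continuous_poleTerm hb).mul (continuous_poleTerm ha))).inv₀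
    (one_sub_poleTerm_mul_ne_zero ha hb)

/-- The kernel reduces to -2πi ab / (Z (Z+ib) (Z+i(a+b))) with Z = d + 2i. Partial fractions leave
two two-pole integrals, whose three poles give the three exponents 0, b and a+b. -/
lemma integral_exp_mul_loop_kernel (hτ : 0 < τ) (ha : 0 ≤ a) (hb : 0 ≤ b) (hab : 0 < a + b) :
    ∫ d : ℝ, Complex.exp (-(Complex.I * τ * ((d : ℂ) + 2 * Complex.I))) *
      (poleTerm a b d * poleTerm b a d * (1 - poleTerm a b d * poleTerm b a d)⁻¹ *
        (2 * Real.pi * Complex.I * ((d : ℂ) + (2 * Complex.I + Complex.I * b))⁻¹)) =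
      (2 * Real.pi) ^ 2 * (a / (a + b) + b / (a + b) * Real.exp (-(τ * (a + b))) -
        Real.exp (-(τ * b))) := by
  have habC : (a : ℂ) + b ≠ 0 := by exact_mod_cast hab.ne'
  -- If a or b vanishes, so does the kernel, and the right side is zero too. For a = 0 the poles at
  -- b and a+b would coincide, which `integral_two_poles` excludes.
  rcases ha.eq_or_lt with rfl | ha'
  · have hbC : (b : ℂ) ≠ 0 := by simpa using habC
    simp [poleTerm, hbC]
  rcases hb.eq_or_lt with rfl | hb'
  · have haC : (a : ℂ) ≠ 0 := by simpa using habC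
    simp [poleTerm, haC]
  have haC : (a : ℂ) ≠ 0 := by exact_mod_cast ha'.ne'
  have hbC : (b : ℂ) ≠ 0 := by exact_mod_cast hb'.ne'
  have e : ∀ d : ℝ, Complex.exp (-(Complex.I * τ * ((d : ℂ) + 2 * Complex.I))) *
      (poleTerm a b d * poleTerm b a d * (1 - poleTerm a b d * poleTerm b a d)⁻¹ *
        (2 * Real.pi * Complex.I * ((d : ℂ) + (2 * Complex.I + Complex.I * b))⁻¹)) =
      -(2 * Real.pi * a) * (Complex.exp (-(Complex.I * τ * ((d : ℂ) + 2 * Complex.I))) *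
        (((d : ℂ) + (2 * Complex.I + Complex.I * (0 : ℝ)))⁻¹ *
          ((d : ℂ) + (2 * Complex.I + Complex.I * (a + b : ℝ)))⁻¹) -
        Complex.exp (-(Complex.I * τ * ((d : ℂ) + 2 * Complex.I))) *
        (((d : ℂ) + (2 * Complex.I + Complex.I * b))⁻¹ *
          ((d : ℂ) + (2 * Complex.I + Complex.I * (a + b : ℝ)))⁻¹)) := fun d => by
    rw [one_sub_poleTerm_mul ha hb, poleTerm, poleTerm]
    have h0 := ofReal_add_two_I_ne_zero d
    have h1 := ofReal_two_I_ne_zero ha d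
    have h2 := ofReal_two_I_ne_zero hb d
    have h3 := ofReal_two_I_ne_zero hab.le d
    set A := (d : ℂ) + (2 * Complex.I + Complex.I * a) with hA
    set B := (d : ℂ) + (2 * Complex.I + Complex.I * b) with hB
    set C := (d : ℂ) + (2 * Complex.I + Complex.I * (a + b : ℝ))
    rw [Complex.ofReal_zero, mul_zero, add_zero]
    set Z := (d : ℂ) + 2 * Complex.I with hZ
    have hBZ : B = Z + Complex.I * b := by rw [hB, hZ]; ring
    field_simp
    rw [hBZ]
    linear_combination Complex.I * b * Complex.I_sq
  simp_rw [e]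
  rw [integral_const_mul, integral_sub (integrable_two_poles le_rfl hab.le τ)
    (integrable_two_poles hb hab.le τ), integral_two_poles hτ le_rfl hab.le hab.ne,
    integral_two_poles hτ hb hab.le (by linarith)]
  push_cast
  simp only [mul_zero, neg_zero, Complex.exp_zero, sub_zero, add_sub_cancel_right]
  field_simp
  ring

/-- The wave pole at Z = -ia cancels a zero of (1 - D)⁻¹, and the kernel becomes -2πa / (Z (Z +
i(a+b))) with Z = d + 2i. -/
lemma integral_exp_mul_transfer_kernel (hτ : 0 < τ) (ha : 0 ≤ a) (hb : 0 ≤ b) (hab : 0 < a + b) :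
    ∫ d : ℝ, Complex.exp (-(Complex.I * τ * ((d : ℂ) + 2 * Complex.I))) *
      (poleTerm a b d * (1 - poleTerm a b d * poleTerm b a d)⁻¹ *
        (2 * Real.pi * Complex.I * ((d : ℂ) + (2 * Complex.I + Complex.I * a))⁻¹)) =
      (2 * Real.pi) ^ 2 * (a / (a + b) - a / (a + b) * Real.exp (-(τ * (a + b)))) := by
  have habC : (a : ℂ) + b ≠ 0 := by exact_mod_cast hab.ne'
  have e : ∀ d : ℝ, Complex.exp (-(Complex.I * τ * ((d : ℂ) + 2 * Complex.I))) *
      (poleTerm a b d * (1 - poleTerm a b d * poleTerm b a d)⁻¹ *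
        (2 * Real.pi * Complex.I * ((d : ℂ) + (2 * Complex.I + Complex.I * a))⁻¹)) =
      -(2 * Real.pi * a) * (Complex.exp (-(Complex.I * τ * ((d : ℂ) + 2 * Complex.I))) *
        (((d : ℂ) + (2 * Complex.I + Complex.I * (0 : ℝ)))⁻¹ *
          ((d : ℂ) + (2 * Complex.I + Complex.I * (a + b : ℝ)))⁻¹)) := fun d => by
    rw [one_sub_poleTerm_mul ha hb, poleTerm]
    have h0 := ofReal_add_two_I_ne_zero d
    have h1 := ofReal_two_I_ne_zero ha d
    have h2 := ofReal_two_I_ne_zero hb d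
    have h3 := ofReal_two_I_ne_zero hab.le d
    set A := (d : ℂ) + (2 * Complex.I + Complex.I * a) with hA
    set B := (d : ℂ) + (2 * Complex.I + Complex.I * b) with hB
    set C := (d : ℂ) + (2 * Complex.I + Complex.I * (a + b : ℝ))
    rw [Complex.ofReal_zero, mul_zero, add_zero]
    set Z := (d : ℂ) + 2 * Complex.I with hZ
    field_simp
    linear_combination a * Complex.I_sq
  simp_rw [e]
  rw [integral_const_mul, integral_two_poles hτ le_rfl hab.le hab.ne]
  push_cast
  simp only [mul_zero, neg_zero, Complex.exp_zero, sub_zero]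
  field_simp

lemma continuous_wave_pair {W W' : ℂ} (hW : 0 ≤ W.im) (hW' : W'.im ≤ 0) {K : ℝ → ℂ}
    (hK : Continuous K) (τ : ℝ) :
    Continuous fun q : ℝ × ℝ =>
      Complex.exp (-(Complex.I * τ * (((q.1 - q.2 : ℝ) : ℂ) + 2 * Complex.I))) *
        (((q.1 : ℂ) + Complex.I + W)⁻¹ * ((q.2 : ℂ) - Complex.I + W')⁻¹ * K (q.1 - q.2)) := by
  have h1 : Continuous fun q : ℝ × ℝ => ((q.1 : ℂ) + Complex.I + W)⁻¹ :=
    Continuous.inv₀ (by fun_prop) fun q => ofReal_add_I_add_ne_zero hW q.1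
  have h2 : Continuous fun q : ℝ × ℝ => ((q.2 : ℂ) - Complex.I + W')⁻¹ := by
    refine Continuous.inv₀ (by fun_prop) fun q => ?_
    rw [sub_eq_add_neg, add_assoc]
    exact ofReal_add_ne_zero (abs_pos.1 (one_pos.trans_le (one_le_abs_im_neg_I_add hW'))) q.2
  have h3 : Continuous fun q : ℝ × ℝ => K (q.1 - q.2) := by fun_prop
  have h4 : Continuous fun q : ℝ × ℝ =>
      Complex.exp (-(Complex.I * τ * (((q.1 - q.2 : ℝ) : ℂ) + 2 * Complex.I))) := by fun_prop
  exact h4.mul ((h1.mul h2).mul h3)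

end kernels

section

open scoped ComplexConjugate

lemma upperTransform_sub_conj_eq {p : ℝ → ℝ} (hc : Continuous p) (hp : Integrable p)
    (hh : Integrable (fourierHat p)) (r : ℝ) :
    upperTransform p (r : ℂ) - conj (upperTransform p (r : ℂ)) =
      Complex.I * (2 * Real.pi * p r : ℝ) := by
  rw [upperTransform_sub_conj hc hp hh]
  push_cast
  ring

variable {ν : Measure ℝ} [IsProbabilityMeasure ν] {p : ℝ → ℝ} (s : ℝ)
  (hp : Integrable p) (hh : Integrable (fourierHat p)) (hS : ∀ z, stieltjes ν z = f₀ p z)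
  (hc : Continuous p) (hn : ∀ x, 0 ≤ p x)
include hp hh hS hc hn

/-! ### The amplitudes in the van Hove limit -/

/-- After removal of the fast phase, the self-energy converges to the constant f₀(E + 2αs + i0), for
which the wave integral is explicit. -/
lemma tendsto_upAmplitude {τ : ℝ} (hτ : 0 < τ) (E : ℝ) (α : ℤˣ) :
    Tendsto (fun v : ℝ => Complex.exp (Complex.I * (τ / v ^ 2 : ℝ) * (E + sgn α * s : ℝ)) *
        upAmplitude ν s v (τ / v ^ 2) E α) (𝓝[>] 0)
      (𝓝 (2 * Real.pi * Complex.I * Complex.exp (Complex.I * τ *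
        upperTransform p ((E + 2 * sgn α * s : ℝ) : ℂ)))) := by
  have hM := norm_stieltjes_le_hatNorm hp hh hS
  have him : ∀ v x : ℝ, 0 < v → (upPt (E + sgn α * s) v x).im ≠ 0 := fun v x hv => by
    rw [upPt_im]
    positivity
  have h := tendsto_integral_waveCorr (M := hatNorm p) (l := 𝓝[>] (0 : ℝ))
    (G := fun v x => f ν s v (-α) (upPt (E + sgn α * s) v x)) hτ ?_ ?_ ?_
    (upperTransform_im_nonneg hc hn hp hh (E + 2 * sgn α * s)) (fun x => ?_)
  · refine h.congr' ?_
    filter_upwards [self_mem_nhdsWithin] with v hv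
    have hv' : v ≠ 0 := (Set.mem_Ioi.1 hv).ne'
    rw [upAmplitude, ← mul_assoc, ← Complex.exp_add, add_neg_cancel, Complex.exp_zero, one_mul,
      div_mul_cancel₀ _ (pow_ne_zero 2 hv')]
    rfl
  · filter_upwards [self_mem_nhdsWithin] with v hv
    rw [continuous_iff_continuousAt]
    intro x
    have h1 : Continuous (upPt (E + sgn α * s) v) := by unfold upPt; fun_prop
    exact ContinuousAt.comp (differentiableAt_f s v (-α) (him v x hv)).continuousAt
      h1.continuousAt
  · filter_upwards [self_mem_nhdsWithin] with v hv x
    exact norm_f_le s v hM _ (him v x hv)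
  · filter_upwards [self_mem_nhdsWithin] with v hv x
    exact f_upPt_im_nonneg s hv _ _ _
  · have h := tendsto_f_up s hp hh hS (-α) (E + sgn α * s) x
    rwa [show E + sgn α * s - sgn (-α) * s = E + 2 * sgn α * s by rw [sgn_neg]; ring] at h

lemma tendsto_downAmplitude {τ : ℝ} (hτ : 0 < τ) (E : ℝ) (δ : ℤˣ) :
    Tendsto (fun v : ℝ => Complex.exp (-(Complex.I * (τ / v ^ 2 : ℝ) * (E + sgn δ * s : ℝ))) *
        downAmplitude ν s v (τ / v ^ 2) E δ) (𝓝[>] 0)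
      (𝓝 (-(2 * Real.pi * Complex.I * Complex.exp (Complex.I * τ *
        -conj (upperTransform p ((E + 2 * sgn δ * s : ℝ) : ℂ)))))) := by
  have hM := norm_stieltjes_le_hatNorm hp hh hS
  have him : ∀ v x : ℝ, 0 < v → (lowPt (E + sgn δ * s) v (-x)).im ≠ 0 := fun v x hv => by
    rw [lowPt_im, neg_ne_zero]
    positivity
  have hpt : ∀ v x : ℝ, -(((-(E + sgn δ * s) : ℝ) : ℂ) + (v : ℂ) ^ 2 * (x + Complex.I)) =
      lowPt (E + sgn δ * s) v (-x) := fun v x => by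
    rw [lowPt]
    push_cast
    ring
  have h := tendsto_integral_waveCorr (M := hatNorm p) (l := 𝓝[>] (0 : ℝ))
    (G := fun v x => -f ν s v (-δ) (lowPt (E + sgn δ * s) v (-x)))
    (W := -conj (upperTransform p ((E + 2 * sgn δ * s : ℝ) : ℂ))) hτ ?_ ?_ ?_ ?_ (fun x => ?_)
  · refine h.neg.congr' ?_
    filter_upwards [self_mem_nhdsWithin] with v hv
    have hv' : v ≠ 0 := (Set.mem_Ioi.1 hv).ne'
    rw [downAmplitude, mul_neg, ← mul_assoc, ← Complex.exp_add,
      div_mul_cancel₀ _ (pow_ne_zero 2 hv')]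
    simp_rw [hpt]
    rw [show ∀ r : ℝ, -(Complex.I * (τ / v ^ 2 : ℝ) * (r : ℂ)) +
      -(Complex.I * (τ / v ^ 2 : ℝ) * ((-r : ℝ) : ℂ)) = 0 from fun r => by push_cast; ring,
      Complex.exp_zero, one_mul]
  · filter_upwards [self_mem_nhdsWithin] with v hv
    rw [continuous_iff_continuousAt]
    intro x
    have h1 : Continuous fun x : ℝ => lowPt (E + sgn δ * s) v (-x) := by unfold lowPt; fun_prop
    exact (ContinuousAt.comp (f := fun x : ℝ => lowPt (E + sgn δ * s) v (-x))
      (differentiableAt_f s v (-δ) (him v x hv)).continuousAt h1.continuousAt).neg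
  · filter_upwards [self_mem_nhdsWithin] with v hv x
    rw [norm_neg]
    exact norm_f_le s v hM _ (him v x hv)
  · filter_upwards [self_mem_nhdsWithin] with v hv x
    rw [Complex.neg_im]
    exact neg_nonneg.2 (f_lowPt_im_nonpos s hv _ _ _)
  · rw [Complex.neg_im, Complex.conj_im, neg_neg]
    exact upperTransform_im_nonneg hc hn hp hh _
  · have h := tendsto_f_low s hp hh hS (-δ) (E + sgn δ * s) (-x)
    rw [show E + sgn δ * s - sgn (-δ) * s = E + 2 * sgn δ * s by rw [sgn_neg]; ring] at h
    exact h.neg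

/-- The product of the amplitudes, freed of its oscillating phase. -/
lemma tendsto_amplitudes {τ : ℝ} (hτ : 0 < τ) (E : ℝ) (α δ : ℤˣ) :
    Tendsto (fun v : ℝ => Complex.exp ((sgn α - sgn δ) * s * Complex.I * (τ / v ^ 2 : ℝ)) *
        (upAmplitude ν s v (τ / v ^ 2) E α * downAmplitude ν s v (τ / v ^ 2) E δ)) (𝓝[>] 0)
      (𝓝 ((2 * Real.pi) ^ 2 * Complex.exp (Complex.I * τ *
        (upperTransform p ((E + 2 * sgn α * s : ℝ) : ℂ) -
          conj (upperTransform p ((E + 2 * sgn δ * s : ℝ) : ℂ)))))) := by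
  have h := (tendsto_upAmplitude s hp hh hS hc hn hτ E α).mul
    (tendsto_downAmplitude s hp hh hS hc hn hτ E δ)
  convert h using 2 with v
  · rw [mul_mul_mul_comm, ← Complex.exp_add]
    congr 2
    push_cast
    ring
  · rw [sub_eq_add_neg, mul_add, Complex.exp_add]
    linear_combination (2 * Real.pi) ^ 2 * Complex.exp (Complex.I * τ *
      upperTransform p ((E + 2 * sgn α * s : ℝ) : ℂ)) * Complex.exp (Complex.I * τ *
        -conj (upperTransform p ((E + 2 * sgn δ * s : ℝ) : ℂ))) * Complex.I_sq

/-! ### The remainders in the van Hove limit -/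

lemma tendsto_rem₁_diag {τ : ℝ} (hτ : 0 < τ) (E : ℝ) (α : ℤˣ) (hΓ : 0 < Γ p s α E) :
    Tendsto (fun v : ℝ => ∫ y : ℝ, ∫ x : ℝ, rem₁ ν s v (τ / v ^ 2) E α α
        (x + (v ^ 2 : ℝ) * Complex.I) (y + (-v ^ 2 : ℝ) * Complex.I)) (𝓝[>] 0)
      (𝓝 ((2 * Real.pi) ^ 2 * (((p E / (p E + p (E + 2 * sgn α * s)) : ℝ) : ℂ) +
        ((p (E + 2 * sgn α * s) / (p E + p (E + 2 * sgn α * s)) *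
          Real.exp (-(τ * Γ p s α E)) : ℝ) : ℂ) -
        (Real.exp (-(τ * (2 * Real.pi * p (E + 2 * sgn α * s)))) : ℂ)))) := by
  have hM := norm_stieltjes_le_hatNorm hp hh hS
  have hM0 : 0 ≤ hatNorm p := (norm_nonneg _).trans (hM Complex.I (by simp))
  have hπ := Real.pi_pos
  set a := 2 * Real.pi * p E with ha
  set b := 2 * Real.pi * p (E + 2 * sgn α * s) with hb
  have ha0 : 0 ≤ a := mul_nonneg (by positivity) (hn _)
  have hb0 : 0 ≤ b := mul_nonneg (by positivity) (hn _)
  have hΓab : Γ p s α E = a + b := by rw [Γ, ha, hb]; ring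
  set W := upperTransform p ((E + 2 * sgn α * s : ℝ) : ℂ) with hW
  have hWim : 0 ≤ W.im := upperTransform_im_nonneg hc hn hp hh _
  have hWW : W - conj W = Complex.I * b := upperTransform_sub_conj_eq hc hp hh _
  set K : ℝ → ℂ := fun d => poleTerm a b d * poleTerm b a d *
    (1 - poleTerm a b d * poleTerm b a d)⁻¹ with hK
  have hKc : Continuous K := ((continuous_poleTerm hb0).mul (continuous_poleTerm ha0)).mul
    (continuous_inv_one_sub_poleTerm_mul ha0 hb0)
  set c := E + sgn α * s with hcdef
  have hbound : ∀ v : ℝ, 0 < v → ∀ q : ℝ × ℝ,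
      ‖(v : ℂ) ^ 4 * rem₁ ν s v (τ / v ^ 2) E α α (upPt c v q.1) (lowPt c v q.2)‖ ≤
        remConst (hatNorm p) τ * (decay q.1 * decay q.2 * decay (q.1 - q.2)) := fun v hv q => by
    have h1 := norm_scaled_rem₁_le s hM hv τ E α α q.1 q.2
    refine h1.trans (mul_le_of_le_one_right ?_ (decay_le_one _))
    have := remConst_nonneg hM0 τ
    have := decay_pos q.1
    have := decay_pos q.2
    have := decay_pos (q.1 - q.2)
    positivity
  have hlim : ∀ q : ℝ × ℝ, Tendsto (fun v : ℝ =>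
      (v : ℂ) ^ 4 * rem₁ ν s v (τ / v ^ 2) E α α (upPt c v q.1) (lowPt c v q.2)) (𝓝[>] 0)
      (𝓝 (Complex.exp (-(Complex.I * τ * (((q.1 - q.2 : ℝ) : ℂ) + 2 * Complex.I))) *
        (((q.1 : ℂ) + Complex.I + W)⁻¹ * ((q.2 : ℂ) - Complex.I + conj W)⁻¹ *
          K (q.1 - q.2)))) := fun q => by
    have k := tendsto_scaled_f₂ s hp hh hS hc hn α c q.1 q.2
    have k' := tendsto_scaled_f₂ s hp hh hS hc hn (-α) c q.1 q.2
    rw [show c - sgn α * s = E by rw [hcdef]; ring,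
      show c + sgn α * s = E + 2 * sgn α * s by rw [hcdef]; ring] at k
    rw [show c - sgn (-α) * s = E + 2 * sgn α * s by rw [hcdef, sgn_neg]; ring,
      show c + sgn (-α) * s = E by rw [hcdef, sgn_neg]; ring] at k'
    have hL : Tendsto (fun v : ℝ => loopTerm ν s v α α (upPt c v q.1) (lowPt c v q.2)) (𝓝[>] 0)
        (𝓝 (poleTerm a b (q.1 - q.2) * poleTerm b a (q.1 - q.2))) := by
      simp_rw [loopTerm_scaled]
      exact k.mul k'
    have h := (((tendsto_scaled_fE_up s hp hh hS hc hn α E q.1).mul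
      (tendsto_scaled_fE_low s hp hh hS hc hn α E q.2)).mul
        (hL.mul ((hL.const_sub 1).inv₀ (one_sub_poleTerm_mul_ne_zero ha0 hb0 _)))).const_mul
          (Complex.exp (-(Complex.I * τ * (((q.1 - q.2 : ℝ) : ℂ) + 2 * Complex.I))))
    rw [neg_mul_neg] at h
    refine h.congr' ?_
    filter_upwards [self_mem_nhdsWithin] with v hv
    rw [scaled_rem₁, exp_scaled τ hv, sub_self, mul_zero, Complex.ofReal_zero, mul_zero,
      Complex.exp_zero, one_mul]
  have hT := tendsto_integral_of_decay (remConst_nonneg hM0 τ) (F := fun (v : ℝ) (q : ℝ × ℝ) =>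
    (v : ℂ) ^ 4 * rem₁ ν s v (τ / v ^ 2) E α α (upPt c v q.1) (lowPt c v q.2))
    (l := 𝓝[>] (0 : ℝ)) (by
      filter_upwards [self_mem_nhdsWithin] with v hv
      exact (stripBounded_rem₁ s v (τ / v ^ 2) E hM (by positivity) α α).continuous_scaled hv c c)
    (by filter_upwards [self_mem_nhdsWithin] with v hv using hbound v hv) hlim
  -- The bound uniform in v passes to the pointwise limit and gives integrability of the limiting
  -- integrand, which the change of variables needs.
  have hint := integrable_of_decay (continuous_wave_pair hWim (W' := conj W)
    (by rw [Complex.conj_im]; linarith) hKc τ) (remConst_nonneg hM0 τ) fun q =>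
      le_of_tendsto (hlim q).norm (by
        filter_upwards [self_mem_nhdsWithin] with v hv using hbound v hv q)
  rw [integral_wave_pair hWim (by rw [Complex.conj_im]; linarith) hWW K hint,
    integral_exp_mul_loop_kernel hτ ha0 hb0 (hΓab ▸ hΓ)] at hT
  convert hT.congr' ?_ using 2
  · rw [hΓab, show p E / (p E + p (E + 2 * sgn α * s)) = a / (a + b) by
      rw [ha, hb]; field_simp, show p (E + 2 * sgn α * s) / (p E + p (E + 2 * sgn α * s)) =
        b / (a + b) by rw [ha, hb]; field_simp]
    push_cast
    ring
  · filter_upwards [self_mem_nhdsWithin] with v hv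
    rw [(stripBounded_rem₁ s v (τ / v ^ 2) E hM (by positivity) α α).integral_lines_eq_scaled
      hv c c]

/-- This is the transfer from the state -α: the resolvents are centred at E - αs, so the rates are a
= 2πp(E - 2αs) and b = 2πp(E), with sum Γ_{-α}(E). -/
lemma tendsto_rem₂_diag {τ : ℝ} (hτ : 0 < τ) (E : ℝ) (α : ℤˣ) (hΓ : 0 < Γ p s (-α) E) :
    Tendsto (fun v : ℝ => ∫ y : ℝ, ∫ x : ℝ, rem₂ ν s v (τ / v ^ 2) E α α
        (x + (v ^ 2 : ℝ) * Complex.I) (y + (-v ^ 2 : ℝ) * Complex.I)) (𝓝[>] 0)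
      (𝓝 ((2 * Real.pi) ^ 2 * (((p (E - 2 * sgn α * s) /
        (p E + p (E - 2 * sgn α * s)) : ℝ) : ℂ) -
        ((p (E - 2 * sgn α * s) / (p E + p (E - 2 * sgn α * s)) *
          Real.exp (-(τ * Γ p s (-α) E)) : ℝ) : ℂ)))) := by
  have hM := norm_stieltjes_le_hatNorm hp hh hS
  have hM0 : 0 ≤ hatNorm p := (norm_nonneg _).trans (hM Complex.I (by simp))
  have hπ := Real.pi_pos
  have hE : E + 2 * sgn (-α) * s = E - 2 * sgn α * s := by rw [sgn_neg]; ring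
  set a := 2 * Real.pi * p (E - 2 * sgn α * s) with ha
  set b := 2 * Real.pi * p E with hb
  have ha0 : 0 ≤ a := mul_nonneg (by positivity) (hn _)
  have hb0 : 0 ≤ b := mul_nonneg (by positivity) (hn _)
  have hΓab : Γ p s (-α) E = a + b := by rw [Γ, ha, hb, hE]; ring
  set W := upperTransform p ((E - 2 * sgn α * s : ℝ) : ℂ) with hW
  have hWim : 0 ≤ W.im := upperTransform_im_nonneg hc hn hp hh _
  have hWW : W - conj W = Complex.I * a := upperTransform_sub_conj_eq hc hp hh _
  set K : ℝ → ℂ := fun d => poleTerm a b d * (1 - poleTerm a b d * poleTerm b a d)⁻¹ with hK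
  have hKc : Continuous K := (continuous_poleTerm hb0).mul
    (continuous_inv_one_sub_poleTerm_mul ha0 hb0)
  set c := E + sgn (-α) * s with hcdef
  have hbound : ∀ v : ℝ, 0 < v → ∀ q : ℝ × ℝ,
      ‖(v : ℂ) ^ 4 * rem₂ ν s v (τ / v ^ 2) E α α (upPt c v q.1) (lowPt c v q.2)‖ ≤
        remConst (hatNorm p) τ * (decay q.1 * decay q.2 * decay (q.1 - q.2)) := fun v hv q => by
    simpa using norm_scaled_rem₂_le s hM hv τ E α α q.1 q.2
  have hlim : ∀ q : ℝ × ℝ, Tendsto (fun v : ℝ =>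
      (v : ℂ) ^ 4 * rem₂ ν s v (τ / v ^ 2) E α α (upPt c v q.1) (lowPt c v q.2)) (𝓝[>] 0)
      (𝓝 (Complex.exp (-(Complex.I * τ * (((q.1 - q.2 : ℝ) : ℂ) + 2 * Complex.I))) *
        (((q.1 : ℂ) + Complex.I + W)⁻¹ * ((q.2 : ℂ) - Complex.I + conj W)⁻¹ *
          K (q.1 - q.2)))) := fun q => by
    have k := tendsto_scaled_f₂ s hp hh hS hc hn α c q.1 q.2
    have k' := tendsto_scaled_f₂ s hp hh hS hc hn (-α) c q.1 q.2
    rw [show c - sgn α * s = E - 2 * sgn α * s by rw [hcdef, sgn_neg]; ring,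
      show c + sgn α * s = E by rw [hcdef, sgn_neg]; ring] at k
    rw [show c - sgn (-α) * s = E by rw [hcdef]; ring,
      show c + sgn (-α) * s = E - 2 * sgn α * s by rw [hcdef, sgn_neg]; ring] at k'
    have hL : Tendsto (fun v : ℝ => loopTerm ν s v α α (upPt c v q.1) (lowPt c v q.2)) (𝓝[>] 0)
        (𝓝 (poleTerm a b (q.1 - q.2) * poleTerm b a (q.1 - q.2))) := by
      simp_rw [loopTerm_scaled]
      exact k.mul k'
    have u := tendsto_scaled_fE_up s hp hh hS hc hn (-α) E q.1
    have w := tendsto_scaled_fE_low s hp hh hS hc hn (-α) E q.2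
    rw [hE] at u w
    have h := ((u.mul w).mul
        (k.mul ((hL.const_sub 1).inv₀ (one_sub_poleTerm_mul_ne_zero ha0 hb0 _)))).const_mul
          (Complex.exp (-(Complex.I * τ * (((q.1 - q.2 : ℝ) : ℂ) + 2 * Complex.I))))
    rw [neg_mul_neg] at h
    refine h.congr' ?_
    filter_upwards [self_mem_nhdsWithin] with v hv
    rw [scaled_rem₂, exp_scaled τ hv, sub_self, mul_zero, Complex.ofReal_zero, mul_zero,
      Complex.exp_zero, one_mul]
  have hT := tendsto_integral_of_decay (remConst_nonneg hM0 τ) (F := fun (v : ℝ) (q : ℝ × ℝ) =>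
    (v : ℂ) ^ 4 * rem₂ ν s v (τ / v ^ 2) E α α (upPt c v q.1) (lowPt c v q.2))
    (l := 𝓝[>] (0 : ℝ)) (by
      filter_upwards [self_mem_nhdsWithin] with v hv
      exact (stripBounded_rem₂ s v (τ / v ^ 2) E hM (by positivity) α α).continuous_scaled hv c c)
    (by filter_upwards [self_mem_nhdsWithin] with v hv using hbound v hv) hlim
  have hint := integrable_of_decay (continuous_wave_pair hWim (W' := conj W)
    (by rw [Complex.conj_im]; linarith) hKc τ) (remConst_nonneg hM0 τ) fun q =>
      le_of_tendsto (hlim q).norm (by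
        filter_upwards [self_mem_nhdsWithin] with v hv using hbound v hv q)
  rw [integral_wave_pair hWim (by rw [Complex.conj_im]; linarith) hWW K hint,
    integral_exp_mul_transfer_kernel hτ ha0 hb0 (hΓab ▸ hΓ)] at hT
  convert hT.congr' ?_ using 2
  · rw [hΓab, show p (E - 2 * sgn α * s) / (p E + p (E - 2 * sgn α * s)) = a / (a + b) by
      rw [ha, hb, add_comm (p E)]; field_simp]
    push_cast
    ring
  · filter_upwards [self_mem_nhdsWithin] with v hv
    rw [(stripBounded_rem₂ s v (τ / v ^ 2) E hM (by positivity) α α).integral_lines_eq_scaled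
      hv c c]

end

/-! ### Off-diagonal remainders and the gap between resonances -/

section

open scoped ComplexConjugate

lemma tendsto_decay_of_abs {ι : Type*} {l : Filter ι} {g : ι → ℝ}
    (hg : Tendsto (fun i => |g i|) l atTop) : Tendsto (fun i => decay (g i)) l (𝓝 0) := by
  simpa [Function.comp_def, decay] using tendsto_decay_atTop.comp hg

/-- The gap is 4s/v² in scaled variables; positivity of s enters the limit only here. -/
lemma tendsto_abs_gap {s : ℝ} (hs : 0 < s) (α : ℤˣ) :
    Tendsto (fun v : ℝ => |2 * (sgn α - sgn (-α)) * s / v ^ 2|) (𝓝[>] 0) atTop := by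
  have h1 : Tendsto (fun v : ℝ => (v ^ 2)⁻¹) (𝓝[>] 0) atTop := by
    simpa [Function.comp_def, inv_pow] using
      (tendsto_pow_atTop two_ne_zero).comp (tendsto_inv_nhdsGT_zero (𝕜 := ℝ))
  refine (h1.const_mul_atTop (show 0 < 4 * s by positivity)).congr fun v => ?_
  rw [sgn_neg, abs_div, abs_mul, sub_neg_eq_add, abs_of_pos hs, abs_mul, ← two_mul, abs_mul,
    abs_sgn, abs_of_nonneg (sq_nonneg v), div_eq_mul_inv]
  norm_num

section

variable {ν : Measure ℝ} [IsProbabilityMeasure ν] {M : ℝ} {s : ℝ}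
  (hM : ∀ z : ℂ, z.im ≠ 0 → ‖stieltjes ν z‖ ≤ M) (hs : 0 < s)
include hM hs

/-- The dominating function is fixed, and the integrand tends to zero pointwise because the
displaced two-point function decays; dominated convergence suffices. -/
lemma tendsto_rem₁_offDiag {τ : ℝ} (hτ : 0 < τ) (E : ℝ) (α : ℤˣ) :
    Tendsto (fun v : ℝ => ∫ y : ℝ, ∫ x : ℝ, rem₁ ν s v (τ / v ^ 2) E α (-α)
        (x + (v ^ 2 : ℝ) * Complex.I) (y + (-v ^ 2 : ℝ) * Complex.I)) (𝓝[>] 0) (𝓝 0) := by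
  have hM0 : 0 ≤ M := (norm_nonneg _).trans (hM Complex.I (by simp))
  have hC := remConst_nonneg hM0 τ
  have hbound : ∀ q : ℝ × ℝ, 0 ≤ remConst M τ * (decay q.1 * decay q.2 * decay (q.1 - q.2)) :=
    fun q => by
      have := decay_pos q.1
      have := decay_pos q.2
      have := decay_pos (q.1 - q.2)
      positivity
  have h := tendsto_integral_of_decay hC (F := fun (v : ℝ) (q : ℝ × ℝ) =>
    (v : ℂ) ^ 4 * rem₁ ν s v (τ / v ^ 2) E α (-α) (upPt (E + sgn α * s) v q.1)
      (lowPt (E + sgn (-α) * s) v q.2)) (F' := fun _ => 0) (l := 𝓝[>] (0 : ℝ)) ?_ ?_ fun q => ?_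
  · rw [integral_zero] at h
    refine h.congr' ?_
    filter_upwards [self_mem_nhdsWithin] with v hv
    rw [(stripBounded_rem₁ s v (τ / v ^ 2) E hM (by positivity) α (-α)).integral_lines_eq_scaled
      hv]
  · filter_upwards [self_mem_nhdsWithin] with v hv
    exact (stripBounded_rem₁ s v (τ / v ^ 2) E hM (by positivity) α (-α)).continuous_scaled hv _ _
  · filter_upwards [self_mem_nhdsWithin] with v hv q
    exact (norm_scaled_rem₁_le s hM hv τ E α (-α) q.1 q.2).trans
      (mul_le_of_le_one_right (hbound q) (decay_le_one _))
  · have hd : Tendsto (fun v : ℝ => |q.1 - q.2 + 2 * (sgn α - sgn (-α)) * s / v ^ 2|)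
        (𝓝[>] 0) atTop := by
      refine tendsto_atTop_mono (fun v => ?_)
        (tendsto_atTop_add_const_right _ (-|q.1 - q.2|) (tendsto_abs_gap hs α))
      have := abs_sub_abs_le_abs_sub (2 * (sgn α - sgn (-α)) * s / v ^ 2) (-(q.1 - q.2))
      rw [abs_neg, sub_neg_eq_add, add_comm (2 * _ * s / v ^ 2)] at this
      linarith
    have h1 := (tendsto_decay_of_abs hd).const_mul
      (remConst M τ * (decay q.1 * decay q.2 * decay (q.1 - q.2)))
    rw [mul_zero] at h1
    refine squeeze_zero_norm' ?_ h1
    filter_upwards [self_mem_nhdsWithin] with v hv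
    exact norm_scaled_rem₁_le s hM hv τ E α (-α) q.1 q.2

/-- Only decay in x - y - L with L = 4αs/v² is available, so the dominating function moves with v.
The gain (1+|L|)^{-1/6} of `decay_mul_le` forces the whole integral to zero. -/
lemma tendsto_rem₂_offDiag {τ : ℝ} (hτ : 0 < τ) (E : ℝ) (α : ℤˣ) :
    Tendsto (fun v : ℝ => ∫ y : ℝ, ∫ x : ℝ, rem₂ ν s v (τ / v ^ 2) E α (-α)
        (x + (v ^ 2 : ℝ) * Complex.I) (y + (-v ^ 2 : ℝ) * Complex.I)) (𝓝[>] 0) (𝓝 0) := by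
  have hM0 : 0 ≤ M := (norm_nonneg _).trans (hM Complex.I (by simp))
  have h := tendsto_integral_zero_of_decay (remConst_nonneg hM0 τ)
    (F := fun (v : ℝ) (q : ℝ × ℝ) => (v : ℂ) ^ 4 * rem₂ ν s v (τ / v ^ 2) E α (-α)
      (upPt (E + sgn (-α) * s) v q.1) (lowPt (E + sgn (- -α) * s) v q.2)) (l := 𝓝[>] (0 : ℝ))
    (L := fun v => 2 * (sgn α - sgn (-α)) * s / v ^ 2) ?_ (tendsto_abs_gap hs α)
  · refine h.congr' ?_
    filter_upwards [self_mem_nhdsWithin] with v hv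
    rw [(stripBounded_rem₂ s v (τ / v ^ 2) E hM (by positivity) α (-α)).integral_lines_eq_scaled
      hv]
  · filter_upwards [self_mem_nhdsWithin] with v hv q
    exact norm_scaled_rem₂_le s hM hv τ E α (-α) q.1 q.2

end

/-! ### The reduced density matrix in the van Hove limit -/

variable {ν : Measure ℝ} [IsProbabilityMeasure ν] {p : ℝ → ℝ} {s : ℝ}
  (hp : Integrable p) (hh : Integrable (fourierHat p)) (hS : ∀ z, stieltjes ν z = f₀ p z)
  (hc : Continuous p) (hn : ∀ x, 0 ≤ p x) (ρ₀ : Matrix ℤˣ ℤˣ ℂ) {η₁ η₂ : ℝ} (h₁ : 0 < η₁)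
  (h₂ : 0 < η₂)
include hp hh hS hc hn h₁ h₂

lemma tendsto_reducedDensity_diag {τ : ℝ} (hτ : 0 < τ) (E : ℝ) (α : ℤˣ)
    (hΓ : ∀ β, 0 < Γ p s β E) :
    Tendsto (fun v : ℝ => reducedDensity ν s v ρ₀ η₁ η₂ E (τ / v ^ 2) α α) (𝓝[>] 0)
      (𝓝 (diagonalVH p s ρ₀ α E τ)) := by
  have hM := norm_stieltjes_le_hatNorm hp hh hS
  have hA := tendsto_amplitudes s hp hh hS hc hn hτ E α α
  have hR₁ := tendsto_rem₁_diag s hp hh hS hc hn hτ E α (hΓ α)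
  have hR₂ := tendsto_rem₂_diag s hp hh hS hc hn hτ E α (hΓ (-α))
  have h := ((hA.const_mul (ρ₀ α α)).add
    ((hR₁.const_mul (ρ₀ α α)).add (hR₂.const_mul (ρ₀ (-α) (-α))))).const_mul
      (1 / (2 * Real.pi : ℂ) ^ 2)
  refine Tendsto.congr' ?_ (h.trans (le_of_eq (congrArg 𝓝 ?_)))
  · filter_upwards [self_mem_nhdsWithin] with v hv
    have hv2 : 0 < v ^ 2 := pow_pos hv 2
    rw [(formulaConverges_and_value s v (τ / v ^ 2) E ρ₀ hM hv (by positivity) α α h₁ h₂ hv2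
      (neg_neg_of_pos hv2)).2]
    simp only [sub_self, zero_mul, Complex.exp_zero, one_mul, mul_assoc]
  · have hπ := Real.pi_pos
    have hπ' : (Real.pi : ℂ) ≠ 0 := by exact_mod_cast hπ.ne'
    have e1 : p E / (p E + p (E + 2 * sgn α * s)) = 2 * Real.pi * (p E / Γ p s α E) := by
      rw [Γ]; field_simp
    have e2 : p (E + 2 * sgn α * s) / (p E + p (E + 2 * sgn α * s)) =
        2 * Real.pi * (p (E + 2 * sgn α * s) / Γ p s α E) := by
      rw [Γ]; field_simp
    have e3 : p (E - 2 * sgn α * s) / (p E + p (E - 2 * sgn α * s)) =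
        2 * Real.pi * (p (E - 2 * sgn α * s) / Γ p s (-α) E) := by
      rw [Γ, sgn_neg, show E + 2 * -sgn α * s = E - 2 * sgn α * s by ring]; field_simp
    -- By the jump formula the product of the waves is exp(-2πτ p(E + 2αs)). It cancels the negative
    -- exponential in the limit of `rem₁`, so only the rates Γ_{±α} remain.
    have e4 : Complex.exp (Complex.I * τ * (upperTransform p ((E + 2 * sgn α * s : ℝ) : ℂ) -
        conj (upperTransform p ((E + 2 * sgn α * s : ℝ) : ℂ)))) =
        (Real.exp (-(τ * (2 * Real.pi * p (E + 2 * sgn α * s)))) : ℂ) := by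
      rw [upperTransform_sub_conj_eq hc hp hh, Complex.ofReal_exp]
      congr 1
      push_cast
      linear_combination (τ * (2 * Real.pi * p (E + 2 * sgn α * s)) : ℂ) * Complex.I_mul_I
    rw [e1, e2, e3, e4, diagonalVH, neg_mul, neg_mul]
    push_cast
    field_simp
    ring

lemma tendsto_reducedDensity_offDiag (hs : 0 < s) {τ : ℝ} (hτ : 0 < τ) (E : ℝ) (α : ℤˣ) :
    Tendsto (fun v : ℝ => reducedDensity ν s v ρ₀ η₁ η₂ E (τ / v ^ 2) α (-α) -
      offDiagonalVH p s ρ₀ α E (τ / v ^ 2) τ) (𝓝[>] 0) (𝓝 0) := by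
  have hM := norm_stieltjes_le_hatNorm hp hh hS
  have hA := tendsto_amplitudes s hp hh hS hc hn hτ E α (-α)
  have hR₁ := tendsto_rem₁_offDiag hM hs hτ E α
  have hR₂ := tendsto_rem₂_offDiag hM hs hτ E α
  set X : ℂ := Complex.exp (Complex.I * τ * (upperTransform p ((E + 2 * sgn α * s : ℝ) : ℂ) -
    conj (upperTransform p ((E + 2 * sgn (-α) * s : ℝ) : ℂ)))) with hX
  have hπ' : (2 * Real.pi : ℂ) ^ 2 ≠ 0 :=
    pow_ne_zero 2 (mul_ne_zero two_ne_zero (by exact_mod_cast Real.pi_pos.ne'))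
  have hr := ((hR₁.const_mul (ρ₀ α (-α))).add (hR₂.const_mul (ρ₀ (-α) α))).const_mul
    (1 / (2 * Real.pi : ℂ) ^ 2)
  have ha := ((hA.const_mul (1 / (2 * Real.pi : ℂ) ^ 2)).sub_const X).const_mul (ρ₀ α (-α))
  rw [← mul_assoc (1 / _), one_div_mul_cancel hπ', one_mul, sub_self, mul_zero] at ha
  -- The limit was taken with the phase divided out. Multiplying the vanishing difference by a phase
  -- of modulus one restores the oscillation without changing the limit.
  have ha' : Tendsto (fun v : ℝ => Complex.exp (-(2 * sgn α * s * Complex.I * (τ / v ^ 2 : ℝ))) *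
      (ρ₀ α (-α) * (1 / (2 * Real.pi : ℂ) ^ 2 *
        (Complex.exp ((sgn α - sgn (-α)) * s * Complex.I * (τ / v ^ 2 : ℝ)) *
          (upAmplitude ν s v (τ / v ^ 2) E α * downAmplitude ν s v (τ / v ^ 2) E (-α))) - X)))
      (𝓝[>] 0) (𝓝 0) := by
    refine squeeze_zero_norm (fun v => le_of_eq ?_) (tendsto_zero_iff_norm_tendsto_zero.1 ha)
    rw [norm_mul, show -(2 * sgn α * s * Complex.I * (τ / v ^ 2 : ℝ)) =
      Complex.I * ((-(2 * sgn α * s * (τ / v ^ 2)) : ℝ) : ℂ) by push_cast; ring, norm_exp_phase,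
      one_mul]
  have h := ha'.add hr
  simp only [mul_zero, add_zero] at h
  refine h.congr' ?_
  filter_upwards [self_mem_nhdsWithin] with v hv
  have hv2 : 0 < v ^ 2 := pow_pos hv 2
  rw [(formulaConverges_and_value s v (τ / v ^ 2) E ρ₀ hM hv (by positivity) α (-α) h₁ h₂ hv2
    (neg_neg_of_pos hv2)).2, offDiagonalVH, neg_neg, f₀Above_eq hp hh, f₀Below_eq hp hh,
    show E - 2 * sgn α * s = E + 2 * sgn (-α) * s by rw [sgn_neg]; ring, ← hX]
  have hexp : Complex.exp (-(2 * sgn α * s * Complex.I * (τ / v ^ 2 : ℝ))) *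
      Complex.exp ((sgn α - sgn (-α)) * s * Complex.I * (τ / v ^ 2 : ℝ)) = 1 := by
    rw [← Complex.exp_add, sgn_neg, Complex.exp_eq_one_iff]
    exact ⟨0, by push_cast; ring⟩
  linear_combination (ρ₀ α (-α) * (1 / (2 * Real.pi : ℂ) ^ 2 *
    (upAmplitude ν s v (τ / v ^ 2) E α * downAmplitude ν s v (τ / v ^ 2) E (-α)))) * hexp

end

end

end SpinReservoir

theorem theoremt (ν₀ : Measure ℝ) [IsProbabilityMeasure ν₀] (p : ℝ → ℝ)
    (hp_cont : Continuous p) (hp_nonneg : ∀ E, 0 ≤ p E)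
    (hν₀ : ν₀ = volume.withDensity (fun E => ENNReal.ofReal (p E)))
    (hp_hat : Integrable (SpinReservoir.fourierHat p))
    (s : ℝ) (hs : 0 < s) (ρ₀ : Matrix ℤˣ ℤˣ ℂ) (E : ℝ)
    (η₁ η₂ : ℝ) (hη₁ : 0 < η₁) (hη₂ : 0 < η₂) :
    -- the double integral converges at all positive couplings and times
    (∀ v t : ℝ, 0 < v → 0 < t → ∀ α δ : ℤˣ,
      SpinReservoir.FormulaConverges ν₀ s v ρ₀ E t α δ η₁ η₂) ∧
    -- the boundary values of the Stieltjes transform of the density exist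
    (∀ x : ℝ,
      Tendsto (fun ε : ℝ => SpinReservoir.f₀ p (x + ε * Complex.I)) (𝓝[>] 0)
        (𝓝 (SpinReservoir.f₀Above p x)) ∧
      Tendsto (fun ε : ℝ => SpinReservoir.f₀ p (x - ε * Complex.I)) (𝓝[>] 0)
        (𝓝 (SpinReservoir.f₀Below p x))) ∧
    -- the diagonal entries in the limit `v → 0`, `t = τ / v²`
    ((∀ β : ℤˣ, 0 < SpinReservoir.Γ p s β E) → ∀ τ : ℝ, 0 < τ → ∀ α : ℤˣ,
      Tendsto (fun v : ℝ => SpinReservoir.reducedDensity ν₀ s v ρ₀ η₁ η₂ E (τ / v ^ 2) α α)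
        (𝓝[>] 0) (𝓝 (SpinReservoir.diagonalVH p s ρ₀ α E τ))) ∧
    -- the off-diagonal entries in the limit `v → 0`, `t = τ / v²`
    (∀ τ : ℝ, 0 < τ → ∀ α : ℤˣ,
      Tendsto (fun v : ℝ =>
          SpinReservoir.reducedDensity ν₀ s v ρ₀ η₁ η₂ E (τ / v ^ 2) α (-α) -
            SpinReservoir.offDiagonalVH p s ρ₀ α E (τ / v ^ 2) τ)
        (𝓝[>] 0) (𝓝 0)) := by
  have hp := SpinReservoir.integrable_density hp_cont hp_nonneg hν₀
  have hS := SpinReservoir.stieltjes_eq_f₀ hp_cont hp_nonneg hν₀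
  refine ⟨fun v t hv ht α δ => ?_, fun x => ⟨?_, ?_⟩, fun hΓ τ hτ α => ?_, fun τ hτ α => ?_⟩
  · exact (SpinReservoir.formulaConverges_and_value s v t E ρ₀
      (SpinReservoir.norm_stieltjes_le_hatNorm hp hp_hat hS) hv ht α δ hη₁ hη₂ one_pos
      neg_one_lt_zero).1
  · rw [SpinReservoir.f₀Above_eq hp hp_hat]
    exact SpinReservoir.tendsto_f₀_add hp hp_hat x
  · rw [SpinReservoir.f₀Below_eq hp hp_hat]
    exact SpinReservoir.tendsto_f₀_sub hp hp_hat x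
  · exact SpinReservoir.tendsto_reducedDensity_diag hp hp_hat hS hp_cont hp_nonneg ρ₀ hη₁ hη₂ hτ E α
      hΓ
  · exact SpinReservoir.tendsto_reducedDensity_offDiag hp hp_hat hS hp_cont hp_nonneg ρ₀ hη₁ hη₂ hs
      hτ E α
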